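/- **Setting.** Let $0\le m<n$ be integers and let $\lambda_1,\dots,\lambda_n\in C^2([0,1])$ satisfy $$\lambda_1(x)<\dots<\lambda_m(x)<0<\lambda_{m+1}(x)<\dots<\lambda_n(x),\qquad x\in[0,1].$$ Put $\Lambda=\mathrm{diag}(\lambda_1,\dots,\lambda_n)$, $\Lambda_-=\mathrm{diag}(\lambda_1,\dots,\lambda_m)$, $\Lambda_+=\mathrm{diag}(\lambda_{m+1},\dots,\lambda_n)$. Let $\Sigma=(\sigma_{ij})$ be an $n\times n$ real matrix function with $\sigma_{ij}\in C^2([0,1])$ and $\sigma_{ii}\equiv 0$, and let $Q=(q_{kj})\in\mathbb R^{(n-m)\times m}$. For $w=(w_-,w_+)\in\mathbb R^m\times\mathbb R^{n-m}$ consider $$w_t(t,x)+\Lambda(x)w_x(t,x)=\Sigma(x)w(t,x),\quad w_+(t,0)=Qw_-(t,0),\quad w_-(t,1)=U(t),\quad w(0,x)=w_0(x)\tag{1}$$ for $t\ge0$, $x\in[0,1]$, with input $U=(U_1,\dots,U_m)$. Let $\|w\|_{L^2}^2=\sum_{i=1}^n\int_0^1w_i(x)^2dx$. **Kernel.** Let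 $k^{(1)}_{ij},k^{(2)}_{ij}\in C^\infty([0,1])$ be arbitrary. A *kernel* is a bounded measurable matrix function $K=(K_{ij})_{i,j=1}^n$ on $\mathcal T=\{0\le\xi\le x\le1\}$ such that $$\lambda_i(x)\partial_xK_{ij}(x,\xi)+\lambda_j(\xi)\partial_\xi K_{ij}(x,\xi)=-\sum_{k=1}^n\bigl(\sigma_{kj}(\xi)+\delta_{kj}\lambda_j'(\xi)\bigr)K_{ik}(x,\xi)$$ holds in integrated form along every arc of a characteristic $\dot x=\lambda_i(x)$, $\dot\xi=\lambda_j(\xi)$ lying in $\mathcal T\setminus\{(0,0)\}$, and * $K_{ij}(x,x)=\dfrac{\sigma_{ij}(x)}{\lambda_i(x)-\lambda_j(x)}$ for $i\ne j$, $0<x\le1$; * $K_{ij}(x,0)=-\dfrac1{\lambda_j(0)}\sum_{k=1}^{n-m}\lambda_{m+k}(0)K_{i,m+k}(x,0)q_{kj}$ for $1\le i\le j\le m$, $0<x\le1$; * $K_{ij}(1,\xi)=k^{(1)}_{ij}(\xi)$ for $1\le j<i\le m$ and for $m+1\le i<j\le n$, $0\le\xi<1$; * $K_{ij}(x,0)=k^{(2)}_{ij}(x)$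 for $m+1\le j\le i\le n$, $0<x\le1$. **Solutions.** An *$L^2$ solution* of (1) is a function $w\in C^0([0,\infty);(L^2(0,1))^n)$ with $w(0)=w_0$ such that for every $T\ge0$ and every $\varphi=(\varphi_-,\varphi_+)\in C^1([0,T]\times[0,1];\mathbb R^n)$ with $\varphi_+(t,1)=0$ and $\Lambda_-(0)\varphi_-(t,0)+Q^{\mathsf T}\Lambda_+(0)\varphi_+(t,0)=0$ for $t\in[0,T]$, $$\int_0^1\varphi(T,x)\cdot w(T,x)\,dx=\int_0^1\varphi(0,x)\cdot w_0(x)\,dx+\int_0^T\!\!\int_0^1\bigl(\varphi_t+(\Lambda\varphi)_x+\Sigma^{\mathsf T}\varphi\bigr)\cdot w\,dx\,dt-\int_0^T\varphi_-(t,1)\cdot\Lambda_-(1)U(t)\,dt .$$ **Theorem.** A kernel $K$ exists. For every kernel $K$, consider the closed loop of (1) with the feedback $$U_i(t)=\int_0^1\sum_{j=1}^nK_{ij}(1,\xi)\,w_j(t,\xi)\,d\xi,\qquad i=1,\dots,m.$$ 1. For every $w_0\in(L^2(0,1))^n$ the closed loop has an $L^2$ solution. 2. For every $\eta>0$ there is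 $c>0$ such that for every $w_0\in(L^2(0,1))^n$ every $L^2$ solution $w$ of the closed loop satisfies $\|w(t,\cdot)\|_{L^2}\le c\,e^{-\eta t}\|w_0\|_{L^2}$ for all $t\ge0$. 3. Every $L^2$ solution $w$ of the closed loop satisfies $w(t,\cdot)=0$ for all $t>t_F$, where $$t_F=\int_0^1\Bigl(\frac1{\lambda_{m+1}(s)}+\sum_{r=1}^m\frac1{|\lambda_r(s)|}\Bigr)ds .$$ -/

import Mathlib

open MeasureTheory Set
open scoped ContDiff

noncomputable section

/-- Data of the linear hyperbolic system `w_t + Λ(x) w_x = Σ(x) w` on `[0,1]` with the boundary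
condition `w₊(t,0) = Q w₋(t,0)`. There are `m` negative and `p` positive speeds, so the state has
`n = m + p` components; `Fin.castAdd p r` are the indices of `w₋`, `Fin.natAdd m s` those of `w₊`. -/
structure HypSystem (m p : ℕ) where
  /-- the diagonal entries `λ_i(x)` of `Λ(x)` -/
  lam : Fin (m + p) → ℝ → ℝ
  /-- the coupling matrix `Σ(x)` -/
  sig : ℝ → Matrix (Fin (m + p)) (Fin (m + p)) ℝ
  /-- the boundary matrix at `x = 0` -/
  Q : Matrix (Fin p) (Fin m) ℝ
  lam_contDiff : ∀ i, ContDiffOn ℝ 2 (lam i) (Icc 0 1)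
  sig_contDiff : ∀ i j, ContDiffOn ℝ 2 (fun x => sig x i j) (Icc 0 1)
  lam_strictMono : ∀ x ∈ Icc (0 : ℝ) 1, StrictMono fun i => lam i x
  lam_neg : ∀ x ∈ Icc (0 : ℝ) 1, ∀ r : Fin m, lam (Fin.castAdd p r) x < 0
  lam_pos : ∀ x ∈ Icc (0 : ℝ) 1, ∀ s : Fin p, 0 < lam (Fin.natAdd m s) x
  sig_diag : ∀ x ∈ Icc (0 : ℝ) 1, ∀ i, sig x i i = 0

namespace HypSystem

variable {m p : ℕ}

/-- The derivative `λ_i'` on `[0,1]` (one-sided at the end points). -/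
def lam' (S : HypSystem m p) (i : Fin (m + p)) (x : ℝ) : ℝ :=
  derivWithin (S.lam i) (Icc 0 1) x

/-! ### Kernel equations -/

/-- The triangle `{(x, ξ) : 0 ≤ ξ ≤ x ≤ 1}`. -/
def triangle : Set (ℝ × ℝ) := {q | 0 ≤ q.2 ∧ q.2 ≤ q.1 ∧ q.1 ≤ 1}

/-- `s ↦ (X s, Y s)`, `s ∈ [a,b]`, is an arc of a characteristic of the operator
`λ_i(x) ∂_x + λ_j(ξ) ∂_ξ`, contained in the triangle and avoiding the corner `(0,0)`
(where boundary data meet that need not be compatible). -/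
structure IsCharArc (S : HypSystem m p) (i j : Fin (m + p)) (a b : ℝ) (X Y : ℝ → ℝ) : Prop where
  le : a ≤ b
  derivX : ∀ s ∈ Icc a b, HasDerivWithinAt X (S.lam i (X s)) (Icc a b) s
  derivY : ∀ s ∈ Icc a b, HasDerivWithinAt Y (S.lam j (Y s)) (Icc a b) s
  mem : ∀ s ∈ Icc a b, (X s, Y s) ∈ triangle \ {((0 : ℝ), (0 : ℝ))}

/-- `K` is a (bounded, possibly discontinuous) solution on the triangle of
`λ_i(x) ∂_x K_ij + λ_j(ξ) ∂_ξ K_ij = - ∑_k (σ_kj(ξ) + δ_kj λ_j'(ξ)) K_ik`,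
the differential equation being integrated along its characteristics, with the boundary conditions
on the diagonal, on `ξ = 0` and on `x = 1`; `k₁`, `k₂` are the artificial boundary data.
`K i j (x, ξ)` stands for `K_ij(x, ξ)`; values off the triangle play no role. -/
structure IsKernel (S : HypSystem m p) (k₁ k₂ : Fin (m + p) → Fin (m + p) → ℝ → ℝ)
    (K : Fin (m + p) → Fin (m + p) → ℝ × ℝ → ℝ) : Prop where
  measurable : ∀ i j, Measurable (triangle.domRestrict (K i j))
  bounded : ∃ M : ℝ, ∀ i j, ∀ q ∈ triangle, |K i j q| ≤ M
  /-- the differential equation along characteristics -/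
  equation : ∀ i j a b X Y, S.IsCharArc i j a b X Y →
    K i j (X b, Y b) - K i j (X a, Y a) =
      ∫ s in a..b, - ∑ k, (S.sig (Y s) k j + if k = j then S.lam' j (Y s) else 0)
        * K i k (X s, Y s)
  /-- `K_ij(x,x) = σ_ij(x) / (λ_i(x) - λ_j(x))` for `i ≠ j` -/
  diagonal : ∀ i j, i ≠ j → ∀ x ∈ Ioc (0 : ℝ) 1,
    K i j (x, x) = S.sig x i j / (S.lam i x - S.lam j x)
  /-- the condition on `ξ = 0` for `1 ≤ i ≤ j ≤ m` -/
  bottom_neg : ∀ i j : Fin m, i ≤ j → ∀ x ∈ Ioc (0 : ℝ) 1,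
    K (Fin.castAdd p i) (Fin.castAdd p j) (x, 0) =
      - (1 / S.lam (Fin.castAdd p j) 0) *
        ∑ k : Fin p, S.lam (Fin.natAdd m k) 0 * K (Fin.castAdd p i) (Fin.natAdd m k) (x, 0)
          * S.Q k j
  /-- artificial condition on `x = 1` for `1 ≤ j < i ≤ m` -/
  right_neg : ∀ i j : Fin m, j < i → ∀ ξ ∈ Ico (0 : ℝ) 1,
    K (Fin.castAdd p i) (Fin.castAdd p j) (1, ξ) = k₁ (Fin.castAdd p i) (Fin.castAdd p j) ξ
  /-- artificial condition on `x = 1` for `m + 1 ≤ i < j ≤ n` -/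
  right_pos : ∀ i j : Fin p, i < j → ∀ ξ ∈ Ico (0 : ℝ) 1,
    K (Fin.natAdd m i) (Fin.natAdd m j) (1, ξ) = k₁ (Fin.natAdd m i) (Fin.natAdd m j) ξ
  /-- artificial condition on `ξ = 0` for `m + 1 ≤ j ≤ i ≤ n` -/
  bottom_pos : ∀ i j : Fin p, j ≤ i → ∀ x ∈ Ioc (0 : ℝ) 1,
    K (Fin.natAdd m i) (Fin.natAdd m j) (x, 0) = k₂ (Fin.natAdd m i) (Fin.natAdd m j) x

/-! ### `L²` solutions -/

/-- `(L²(0,1))ⁿ`, with the norm `√(∑ i, ∫₀¹ w_i(x)² dx)`. -/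
abbrev StateSpace (n : ℕ) : Type :=
  Lp (EuclideanSpace ℝ (Fin n)) 2 (volume.restrict (Icc (0 : ℝ) 1))

/-- Test functions `φ_i(t,x)` on `[0,T] × [0,1]`: of class `C¹`, with the boundary conditions
adjoint to those of the system, `φ₊(t,1) = 0` and `Λ₋(0) φ₋(t,0) + Qᵀ Λ₊(0) φ₊(t,0) = 0`. -/
structure IsTest (S : HypSystem m p) (T : ℝ) (φ : Fin (m + p) → ℝ → ℝ → ℝ) : Prop where
  contDiff : ∀ i, ContDiff ℝ 1 fun q : ℝ × ℝ => φ i q.1 q.2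
  right : ∀ t ∈ Icc 0 T, ∀ s : Fin p, φ (Fin.natAdd m s) t 1 = 0
  left : ∀ t ∈ Icc 0 T, ∀ r : Fin m,
    S.lam (Fin.castAdd p r) 0 * φ (Fin.castAdd p r) t 0
      + ∑ s : Fin p, S.Q s r * S.lam (Fin.natAdd m s) 0 * φ (Fin.natAdd m s) t 0 = 0

/-- `w ∈ C⁰([0,∞); (L²(0,1))ⁿ)` is a weak solution of `w_t + Λ w_x = Σ w`,
`w₊(t,0) = Q w₋(t,0)`, `w₋(t,1) = U(t)`, `w(0,·) = w₀`. -/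
structure IsL2Solution (S : HypSystem m p) (U : ℝ → Fin m → ℝ) (w₀ : StateSpace (m + p))
    (w : ℝ → StateSpace (m + p)) : Prop where
  continuousOn : ContinuousOn w (Ici 0)
  initial : w 0 = w₀
  weak : ∀ T : ℝ, 0 ≤ T → ∀ φ, S.IsTest T φ →
    ∫ x in Icc (0 : ℝ) 1, ∑ i, φ i T x * w T x i =
      (∫ x in Icc (0 : ℝ) 1, ∑ i, φ i 0 x * w₀ x i)
      + (∫ t in 0..T, ∫ x in Icc (0 : ℝ) 1,
          ∑ i, (deriv (fun t' => φ i t' x) t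
            + (S.lam i x * deriv (fun x' => φ i t x') x + S.lam' i x * φ i t x)
            + ∑ k, S.sig x k i * φ k t x) * w t x i)
      - ∫ t in 0..T, ∑ r : Fin m,
          S.lam (Fin.castAdd p r) 1 * φ (Fin.castAdd p r) t 1 * U t r

/-- The backstepping feedback `U_i(t) = ∫₀¹ ∑_j K_ij(1,ξ) w_j(t,ξ) dξ`, `i = 1, …, m`. -/
def feedback (K : Fin (m + p) → Fin (m + p) → ℝ × ℝ → ℝ) (w : ℝ → StateSpace (m + p))
    (t : ℝ) (i : Fin m) : ℝ :=
  ∫ ξ in Icc (0 : ℝ) 1, ∑ j, K (Fin.castAdd p i) j (1, ξ) * w t ξ j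

/-- `w` is an `L²` solution of the system in closed loop with the backstepping feedback. -/
def IsClosedLoopSolution (S : HypSystem m p) (K : Fin (m + p) → Fin (m + p) → ℝ × ℝ → ℝ)
    (w₀ : StateSpace (m + p)) (w : ℝ → StateSpace (m + p)) : Prop :=
  S.IsL2Solution (feedback K w) w₀ w

/-- `t_F = ∫₀¹ (1/λ_{m+1}(s) + ∑_{r ≤ m} 1/|λ_r(s)|) ds`. -/
def finalTime (S : HypSystem m p) (hp : 0 < p) : ℝ :=
  ∫ s in (0 : ℝ)..1, (1 / S.lam (Fin.natAdd m ⟨0, hp⟩) s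
    + ∑ r : Fin m, 1 / |S.lam (Fin.castAdd p r) s|)

end HypSystem

end

/-! The proof rests on the Volterra transformation `γ(x) = w(x) - ∫₀ˣ K(x,ξ) w(ξ) dξ`, which is
invertible on `L²`. The kernel equations are what is needed for `γ` to solve a transport system
without distributed coupling, `γ_t + Λ γ_x = G(x) w₋(t,0)`, and the feedback is what gives `γ₋(t,1)
= 0`. The conditions on `ξ = 0` for `i ≤ j ≤ m` make the entry `G i r` vanish unless `r < i`. Since
`w(t,0) = γ(t,0)`, the components empty one after another: `γ₁` runs out through `x = 0`, then
nothing excites `γ₂`, and so on down to `γ₊`. The travel times of this chain add up to `t_F`.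

This is made quantitative by the Lyapunov functions `∑ᵢ ∫ θⁱ exp(2μ Rᵢ(x)) |λᵢ(x)|⁻¹ γᵢ(x)² dx`,
where `Rᵢ(x) ∈ [0, t_F]` bounds the time a signal at `x` still needs to leave the chain. Transport
gives the decay rate `2μ` because `Rᵢ' = -1/λᵢ`. The excitations at `x = 0` are absorbed because
`Rᵢ(x) ≤ R_r(0)` for `r < i` and because each excitation gains a power of the small number `θ`.
Young's inequality costs a loss that does not grow with `μ`. The result, `exists_lyapunov` with
`IsClosedLoopSolution.norm_le`, is `‖w(t)‖ ≤ const · exp(μ t_F - (μ - 1/2) t) ‖w₀‖` with a constant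
independent of `μ`. A fixed `μ` gives decay at any prescribed rate, and `μ → ∞` gives extinction
after `t_F`.

A kernel is constructed row by row, by a contraction along characteristics
(`exists_rowMap_contraction`, `exists_isKernel`). A kernel may be discontinuous, so `γ` cannot be
differentiated under the integral sign. Instead, a Leibniz rule in characteristic coordinates
(`leibniz`) yields `kernel_moment` for absolutely continuous profiles, and from it
`isPrimitive_transform`.

For the solutions, the closed loop is described by the graph of its generator. In the norm `‖P ·‖`
of the Lyapunov function with `μ = 1/2` this graph is maximal dissipative, and Yosida approximation
produces trajectories, which are shown to be weak solutions. Decay has to hold for every weak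
solution, and no uniqueness theorem is used: a time average of a weak solution is differentiable in
time and lies in the domain of the generator (`average_mem_generator`), so the Lyapunov inequality
applies to averages and passes to the limit. -/

noncomputable section

/-! ### Speeds, their bounds, and travel times along characteristics -/

/-- The nearest point of `[0,1]`. -/
def unitClamp (x : ℝ) : ℝ := max 0 (min 1 x)

theorem unitClamp_mem (x : ℝ) : unitClamp x ∈ Icc (0 : ℝ) 1 :=
  ⟨le_max_left _ _, max_le zero_le_one (min_le_left _ _)⟩

theorem unitClamp_of_mem {x : ℝ} (hx : x ∈ Icc (0 : ℝ) 1) : unitClamp x = x := by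
  simp [unitClamp, hx.1, hx.2]

theorem continuous_unitClamp : Continuous unitClamp := by
  unfold unitClamp; fun_prop

theorem ContinuousOn.comp_unitClamp {f : ℝ → ℝ} (hf : ContinuousOn f (Icc 0 1)) :
    Continuous fun x => f (unitClamp x) :=
  hf.comp_continuous continuous_unitClamp unitClamp_mem

theorem ContinuousOn.exists_abs_le_unit {f : ℝ → ℝ} (hf : ContinuousOn f (Icc 0 1)) :
    ∃ C : ℝ, ∀ x ∈ Icc (0 : ℝ) 1, |f x| ≤ C := by
  obtain ⟨C, hC⟩ := isCompact_Icc.exists_bound_of_continuousOn hf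
  exact ⟨C, hC⟩

/-- Travel time of a velocity field of constant sign, and its inverse. -/
theorem exists_travel_time {a : ℝ → ℝ} (ha : Continuous a) {s c C : ℝ} (hs : s = 1 ∨ s = -1)
    (hc : 0 < c) (hca : ∀ x, c ≤ s * a x) (haC : ∀ x, |a x| ≤ C) :
    ∃ F Z : ℝ → ℝ, (∀ x, Z (F x) = x) ∧ (∀ u, F (Z u) = u) ∧
      (∀ x, HasDerivAt F (a x)⁻¹ x) ∧ (∀ u, HasDerivAt Z (a (Z u)) u) ∧ F 0 = 0 := by
  have hss : s * s = 1 := by rcases hs with rfl | rfl <;> norm_num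
  have hne : ∀ x, a x ≠ 0 := fun x h => by have := hca x; rw [h] at this; simp at this; linarith
  have hpos : ∀ x, 0 < s * a x := fun x => hc.trans_le (hca x)
  have hC : 0 < C := by
    have := haC 0
    exact (abs_pos.2 (hne 0)).trans_le this
  have hCi : ∀ x, C⁻¹ ≤ (s * a x)⁻¹ := fun x => by
    apply inv_anti₀ (hpos x)
    refine le_trans (le_abs_self _) ?_
    rw [abs_mul]
    rcases hs with rfl | rfl <;> simpa using haC x
  have hcont : Continuous fun x => (s * a x)⁻¹ :=
    (continuous_const.mul ha).inv₀ fun x => (hpos x).ne'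
  -- The sign `s` makes the integrand positive, so that `G` is increasing; the sign is put back when
  -- `F` and `Z` are defined.
  set G : ℝ → ℝ := fun x => ∫ y in (0 : ℝ)..x, (s * a y)⁻¹ with hG
  have hGd : ∀ x, HasDerivAt G (s * a x)⁻¹ x := fun x =>
    intervalIntegral.integral_hasDerivAt_right (hcont.intervalIntegrable _ _)
      (hcont.stronglyMeasurableAtFilter _ _) hcont.continuousAt
  have hmono : StrictMono G := strictMono_of_hasDerivAt_pos hGd fun x => inv_pos.2 (hpos x)
  have hGc : Continuous G := continuous_iff_continuousAt.2 fun x => (hGd x).continuousAt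
  -- `G` grows at least at the rate `C⁻¹`, so it is unbounded in both directions and therefore onto.
  have hlin : Monotone fun x => G x - C⁻¹ * x := by
    apply monotone_of_hasDerivAt_nonneg (f' := fun x => (s * a x)⁻¹ - C⁻¹ * 1)
    · intro x
      exact (hGd x).sub ((hasDerivAt_id x).const_mul _)
    · intro x
      have := hCi x
      simp only [Pi.zero_apply, mul_one]
      linarith
  have hG0 : G 0 = 0 := by simp [hG]
  have hsurj : Function.Surjective G := by
    apply hGc.surjective
    · apply Filter.tendsto_atTop_mono' _ _ (Filter.tendsto_id.const_mul_atTop (inv_pos.2 hC))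
      filter_upwards [Filter.eventually_ge_atTop 0] with x hx
      have := hlin hx
      simp only [hG0] at this
      simp only [id]
      linarith
    · apply Filter.tendsto_atBot_mono' _ _ (Filter.tendsto_id.const_mul_atBot (inv_pos.2 hC))
      filter_upwards [Filter.eventually_le_atBot 0] with x hx
      have := hlin hx
      simp only [hG0] at this
      simp only [id]
      linarith
  let e : ℝ ≃o ℝ := hmono.orderIsoOfSurjective G hsurj
  have he : ∀ x, e x = G x := fun x => rfl
  have hed : ∀ u, HasDerivAt e.symm (s * a (e.symm u)) u := fun u => by
    have h1 := hGd (e.symm u)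
    have := HasDerivAt.of_local_left_inverse (f := G) (g := e.symm) (a := u)
      e.symm.continuous.continuousAt h1 (inv_ne_zero (hpos _).ne')
      (Filter.Eventually.of_forall fun y => e.apply_symm_apply y)
    simpa using this
  refine ⟨fun x => s * G x, fun u => e.symm (s * u), ?_, ?_, ?_, ?_, by simp [hG0]⟩
  · intro x
    show e.symm (s * (s * G x)) = x
    rw [← mul_assoc, hss, one_mul, ← he, e.symm_apply_apply]
  · intro u
    show s * G (e.symm (s * u)) = u
    rw [← he, e.apply_symm_apply, ← mul_assoc, hss, one_mul]
  · intro x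
    refine ((hGd x).const_mul s).congr_deriv ?_
    have h3 : s ≠ 0 := by rintro rfl; simp at hss
    rw [mul_inv, mul_inv_cancel_left₀ h3]
  · intro u
    have := (hed (s * u)).comp u ((hasDerivAt_id u).const_mul s)
    simp only [mul_one] at this
    exact this.congr_deriv (by rw [mul_right_comm, hss, one_mul])

namespace HypSystem

variable {m p : ℕ}

/-- The speed `λ_i`, extended to the line by its end values. -/
def speed (S : HypSystem m p) (i : Fin (m + p)) (x : ℝ) : ℝ := S.lam i (unitClamp x)

/-- The derivative of the speed on `[0,1]`, extended to the line by its end values. -/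
def speedDeriv (S : HypSystem m p) (i : Fin (m + p)) (x : ℝ) : ℝ := S.lam' i (unitClamp x)

/-- The coupling coefficients `σ_ij`, extended to the line by their end values. -/
def coup (S : HypSystem m p) (i j : Fin (m + p)) (x : ℝ) : ℝ := S.sig (unitClamp x) i j

/-- The sign of the speed `λ_i`. -/
def sgn (m : ℕ) {p : ℕ} (i : Fin (m + p)) : ℝ := if (i : ℕ) < m then -1 else 1

theorem speed_of_mem (S : HypSystem m p) (i : Fin (m + p)) {x : ℝ} (hx : x ∈ Icc (0 : ℝ) 1) :
    S.speed i x = S.lam i x := by rw [speed, unitClamp_of_mem hx]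

theorem speedDeriv_of_mem (S : HypSystem m p) (i : Fin (m + p)) {x : ℝ}
    (hx : x ∈ Icc (0 : ℝ) 1) : S.speedDeriv i x = S.lam' i x := by
  rw [speedDeriv, unitClamp_of_mem hx]

theorem coup_of_mem (S : HypSystem m p) (i j : Fin (m + p)) {x : ℝ} (hx : x ∈ Icc (0 : ℝ) 1) :
    S.coup i j x = S.sig x i j := by rw [coup, unitClamp_of_mem hx]

theorem continuous_speed (S : HypSystem m p) (i : Fin (m + p)) : Continuous (S.speed i) :=
  (S.lam_contDiff i).continuousOn.comp_unitClamp

theorem continuousOn_lam' (S : HypSystem m p) (i : Fin (m + p)) :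
    ContinuousOn (S.lam' i) (Icc 0 1) :=
  (S.lam_contDiff i).continuousOn_derivWithin (uniqueDiffOn_Icc zero_lt_one) (by norm_num)

theorem continuous_speedDeriv (S : HypSystem m p) (i : Fin (m + p)) :
    Continuous (S.speedDeriv i) :=
  (S.continuousOn_lam' i).comp_unitClamp

theorem continuous_coup (S : HypSystem m p) (i j : Fin (m + p)) : Continuous (S.coup i j) :=
  (S.sig_contDiff i j).continuousOn.comp_unitClamp (f := fun x => S.sig x i j)

theorem hasDerivWithinAt_lam (S : HypSystem m p) (i : Fin (m + p)) {x : ℝ}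
    (hx : x ∈ Icc (0 : ℝ) 1) : HasDerivWithinAt (S.lam i) (S.lam' i x) (Icc 0 1) x :=
  ((S.lam_contDiff i).differentiableOn (by norm_num) x hx).hasDerivWithinAt

theorem sgn_castAdd (r : Fin m) : sgn m (Fin.castAdd p r) = -1 := by simp [sgn]

theorem sgn_natAdd (s : Fin p) : sgn m (Fin.natAdd m s) = 1 := by simp [sgn]

theorem sgn_eq (i : Fin (m + p)) : sgn m i = 1 ∨ sgn m i = -1 := by
  unfold sgn; split_ifs <;> simp

theorem sgn_mul_self (i : Fin (m + p)) : sgn m i * sgn m i = 1 := by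
  rcases sgn_eq i with h | h <;> simp [h]

theorem sgn_mul_speed_pos (S : HypSystem m p) (i : Fin (m + p)) (x : ℝ) :
    0 < sgn m i * S.speed i x := by
  refine Fin.addCases (fun r => ?_) (fun s => ?_) i
  · rw [sgn_castAdd]; have := S.lam_neg _ (unitClamp_mem x) r; simp only [speed]; linarith
  · rw [sgn_natAdd]; have := S.lam_pos _ (unitClamp_mem x) s; simp only [speed]; linarith

theorem speed_ne_zero (S : HypSystem m p) (i : Fin (m + p)) (x : ℝ) : S.speed i x ≠ 0 := by
  have := S.sgn_mul_speed_pos i x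
  intro h; simp [h] at this

theorem lam_ne_zero (S : HypSystem m p) (i : Fin (m + p)) {x : ℝ} (hx : x ∈ Icc (0 : ℝ) 1) :
    S.lam i x ≠ 0 := by
  rw [← S.speed_of_mem i hx]; exact S.speed_ne_zero i x

theorem speed_lt (S : HypSystem m p) {i j : Fin (m + p)} (h : i < j) (x : ℝ) :
    S.speed i x < S.speed j x := S.lam_strictMono _ (unitClamp_mem x) h

theorem exists_speed_lower (S : HypSystem m p) :
    ∃ c : ℝ, 0 < c ∧ ∀ i x, c ≤ sgn m i * S.speed i x := by
  have h : ∀ i : Fin (m + p), ∃ c : ℝ, 0 < c ∧ ∀ x, c ≤ sgn m i * S.speed i x := fun i => by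
    have hc : Continuous fun x => sgn m i * S.speed i x :=
      continuous_const.mul (S.continuous_speed i)
    obtain ⟨x₀, -, h0⟩ := isCompact_Icc.exists_isMinOn (s := Icc (0 : ℝ) 1)
      (nonempty_Icc.2 zero_le_one) hc.continuousOn
    refine ⟨_, S.sgn_mul_speed_pos i x₀, fun x => ?_⟩
    have := h0 (unitClamp_mem x)
    simp only [mem_ofPred_eq, speed, unitClamp_of_mem (unitClamp_mem x)] at this
    exact this
  choose c hc hcl using h
  rcases isEmpty_or_nonempty (Fin (m + p)) with he | he
  · exact ⟨1, one_pos, fun i => he.elim i⟩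
  · obtain ⟨i₀, h0⟩ := Finite.exists_min c
    exact ⟨c i₀, hc i₀, fun i x => (h0 i).trans (hcl i x)⟩

theorem exists_coeff_bound (S : HypSystem m p) :
    ∃ C : ℝ, 0 < C ∧ (∀ i x, |S.speed i x| ≤ C) ∧ (∀ i x, |S.speedDeriv i x| ≤ C) ∧
      (∀ i j x, |S.coup i j x| ≤ C) ∧ ∀ i j, |S.Q i j| ≤ C := by
  have h1 := fun i => ((S.lam_contDiff i).continuousOn).exists_abs_le_unit
  have h2 := fun i => (S.continuousOn_lam' i).exists_abs_le_unit
  have h3 := fun i j => ((S.sig_contDiff i j).continuousOn).exists_abs_le_unit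
  choose c1 h1 using h1
  choose c2 h2 using h2
  choose c3 h3 using h3
  set D : ℝ := 1 + ∑ i, |c1 i| + ∑ i, |c2 i| + ∑ i, ∑ j, |c3 i j| + ∑ i, ∑ j, |S.Q i j| with hD
  have e1 : 0 ≤ ∑ i, |c1 i| := Finset.sum_nonneg fun _ _ => abs_nonneg _
  have e2 : 0 ≤ ∑ i, |c2 i| := Finset.sum_nonneg fun _ _ => abs_nonneg _
  have e3 : 0 ≤ ∑ i, ∑ j, |c3 i j| :=
    Finset.sum_nonneg fun _ _ => Finset.sum_nonneg fun _ _ => abs_nonneg _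
  have e4 : 0 ≤ ∑ i, ∑ j, |S.Q i j| :=
    Finset.sum_nonneg fun _ _ => Finset.sum_nonneg fun _ _ => abs_nonneg _
  refine ⟨D, by positivity, fun i x => ?_, fun i x => ?_, fun i j x => ?_, fun i j => ?_⟩
  · have a1 := h1 i _ (unitClamp_mem x)
    have a2 := Finset.single_le_sum (fun i _ => abs_nonneg (c1 i)) (Finset.mem_univ i)
    have a3 := le_abs_self (c1 i)
    simp only [speed]; linarith
  · have a1 := h2 i _ (unitClamp_mem x)
    have a2 := Finset.single_le_sum (fun i _ => abs_nonneg (c2 i)) (Finset.mem_univ i)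
    have a3 := le_abs_self (c2 i)
    simp only [speedDeriv]; linarith
  · have a1 := h3 i j _ (unitClamp_mem x)
    have a2 := Finset.single_le_sum (fun j _ => abs_nonneg (c3 i j)) (Finset.mem_univ j)
    have a4 : ∑ j, |c3 i j| ≤ ∑ i, ∑ j, |c3 i j| :=
      Finset.single_le_sum (f := fun i => ∑ j, |c3 i j|) (fun i _ => Finset.sum_nonneg fun _ _ => abs_nonneg _) (Finset.mem_univ i)
    have a3 := le_abs_self (c3 i j)
    show |S.sig (unitClamp x) i j| ≤ D; linarith
  · have a2 := Finset.single_le_sum (fun j _ => abs_nonneg (S.Q i j)) (Finset.mem_univ j)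
    have a4 : ∑ j, |S.Q i j| ≤ ∑ i, ∑ j, |S.Q i j| :=
      Finset.single_le_sum (f := fun i => ∑ j, |S.Q i j|) (fun i _ => Finset.sum_nonneg fun _ _ => abs_nonneg _) (Finset.mem_univ i)
    linarith

/-- The extension of the speeds to the line keeps their sign and their bounds. Hence travel time and
position are mutually inverse on all of `ℝ`, and no characteristic has a limited interval of
existence. -/
theorem exists_travel (S : HypSystem m p) (i : Fin (m + p)) :
    ∃ F Z : ℝ → ℝ, (∀ x, Z (F x) = x) ∧ (∀ u, F (Z u) = u) ∧
      (∀ x, HasDerivAt F (S.speed i x)⁻¹ x) ∧ (∀ u, HasDerivAt Z (S.speed i (Z u)) u) ∧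
      F 0 = 0 := by
  obtain ⟨c, hc, hcl⟩ := S.exists_speed_lower
  obtain ⟨C, -, hC, -⟩ := S.exists_coeff_bound
  exact exists_travel_time (S.continuous_speed i) (sgn_eq i) hc (hcl i) (hC i)

/-- The (signed) travel time of the `i`-th characteristic from `0` to `x`. -/
def travel (S : HypSystem m p) (i : Fin (m + p)) : ℝ → ℝ := (S.exists_travel i).choose

/-- The position of the `i`-th characteristic started at `0`. -/
def position (S : HypSystem m p) (i : Fin (m + p)) : ℝ → ℝ :=
  (S.exists_travel i).choose_spec.choose

theorem position_travel (S : HypSystem m p) (i : Fin (m + p)) (x : ℝ) :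
    S.position i (S.travel i x) = x := (S.exists_travel i).choose_spec.choose_spec.1 x

theorem travel_position (S : HypSystem m p) (i : Fin (m + p)) (u : ℝ) :
    S.travel i (S.position i u) = u := (S.exists_travel i).choose_spec.choose_spec.2.1 u

theorem hasDerivAt_travel (S : HypSystem m p) (i : Fin (m + p)) (x : ℝ) :
    HasDerivAt (S.travel i) (S.speed i x)⁻¹ x :=
  (S.exists_travel i).choose_spec.choose_spec.2.2.1 x

theorem hasDerivAt_position (S : HypSystem m p) (i : Fin (m + p)) (u : ℝ) :
    HasDerivAt (S.position i) (S.speed i (S.position i u)) u :=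
  (S.exists_travel i).choose_spec.choose_spec.2.2.2.1 u

theorem continuous_travel (S : HypSystem m p) (i : Fin (m + p)) : Continuous (S.travel i) :=
  continuous_iff_continuousAt.2 fun x => (S.hasDerivAt_travel i x).continuousAt

theorem continuous_position (S : HypSystem m p) (i : Fin (m + p)) : Continuous (S.position i) :=
  continuous_iff_continuousAt.2 fun x => (S.hasDerivAt_position i x).continuousAt

/-- Along a curve moving with speed `λ_i` the travel time equals the elapsed time. -/
theorem travel_eq_add (S : HypSystem m p) {i : Fin (m + p)} {a b : ℝ} {X : ℝ → ℝ}
    (hX : ∀ s ∈ Icc a b, HasDerivWithinAt X (S.lam i (X s)) (Icc a b) s)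
    (hm : ∀ s ∈ Icc a b, X s ∈ Icc (0 : ℝ) 1) {s : ℝ} (hs : s ∈ Icc a b) :
    S.travel i (X s) = S.travel i (X a) + (s - a) := by
  have key : ∀ t ∈ Icc a b,
      HasDerivWithinAt (fun t => S.travel i (X t) - (t - a)) 0 (Icc a b) t := fun t ht => by
    have h1 := (S.hasDerivAt_travel i (X t)).comp_hasDerivWithinAt t (hX t ht)
    have h2 := h1.sub (((hasDerivWithinAt_id t (Icc a b)).sub_const a))
    rw [S.speed_of_mem i (hm t ht), inv_mul_cancel₀ (S.lam_ne_zero i (hm t ht)), sub_self] at h2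
    exact h2
  have := constant_of_has_deriv_right_zero (fun t ht => (key t ht).continuousWithinAt)
    (fun t ht => ((key t ⟨ht.1, ht.2.le⟩).mono_of_mem_nhdsWithin
      (Icc_mem_nhdsGE_of_mem ht))) s hs
  simp only [sub_self, sub_zero] at this
  linarith

end HypSystem
end
-- Characteristics in the triangle and their exit times
noncomputable section

theorem Measurable.intervalIntegrable_of_bound {f : ℝ → ℝ} (hf : Measurable f) {C : ℝ}
    (hC : ∀ x, |f x| ≤ C) (a b : ℝ) : IntervalIntegrable f volume a b :=
  (intervalIntegrable_const (c := C)).mono_fun hf.aestronglyMeasurable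
    (Filter.Eventually.of_forall fun x => by
      simpa using (hC x).trans (le_abs_self C))

namespace HypSystem

variable {m p : ℕ}

theorem isClosed_triangle : IsClosed triangle := by
  have h1 : IsClosed {q : ℝ × ℝ | 0 ≤ q.2} := isClosed_le continuous_const continuous_snd
  have h2 : IsClosed {q : ℝ × ℝ | q.2 ≤ q.1} := isClosed_le continuous_snd continuous_fst
  have h3 : IsClosed {q : ℝ × ℝ | q.1 ≤ 1} := isClosed_le continuous_fst continuous_const
  exact h1.inter (h2.inter h3)

theorem fst_mem_of_mem_triangle {q : ℝ × ℝ} (hq : q ∈ triangle) : q.1 ∈ Icc (0 : ℝ) 1 :=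
  ⟨hq.1.trans hq.2.1, hq.2.2⟩

theorem snd_mem_of_mem_triangle {q : ℝ × ℝ} (hq : q ∈ triangle) : q.2 ∈ Icc (0 : ℝ) 1 :=
  ⟨hq.1, hq.2.1.trans hq.2.2⟩

/-- The ratio `λ_j / λ_i` is at most `1`. -/
def Slow (m : ℕ) {p : ℕ} (i j : Fin (m + p)) : Prop :=
  ((i : ℕ) < m ∧ i ≤ j) ∨ (m ≤ (i : ℕ) ∧ j ≤ i)

instance (i j : Fin (m + p)) : Decidable (Slow m i j) := by unfold Slow; infer_instance

/-- The time direction in which the characteristics of `K_ij` run towards their boundary data. -/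
def dir (m : ℕ) {p : ℕ} (i j : Fin (m + p)) : ℝ := if Slow m i j then -sgn m i else sgn m i

theorem dir_mul_self (i j : Fin (m + p)) : dir m i j * dir m i j = 1 := by
  unfold dir; split_ifs <;> simp [sgn_mul_self]

theorem dir_eq (i j : Fin (m + p)) : dir m i j = 1 ∨ dir m i j = -1 :=
  mul_self_eq_one_iff.1 (dir_mul_self i j)

theorem sgn_mul_lt_of_not_slow (S : HypSystem m p) {i j : Fin (m + p)} (h : ¬ Slow m i j) (x : ℝ) :
    sgn m i * S.speed i x < sgn m i * S.speed j x := by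
  simp only [Slow, not_or, not_and, not_le] at h
  by_cases hi : (i : ℕ) < m
  · have := S.speed_lt (h.1 hi) x
    simp [sgn, hi, this]
  · have := S.speed_lt (h.2 (not_lt.1 hi)) x
    simp [sgn, hi, this]

theorem sgn_mul_le_of_slow (S : HypSystem m p) {i j : Fin (m + p)} (h : Slow m i j) (x : ℝ) :
    sgn m i * S.speed j x ≤ sgn m i * S.speed i x := by
  have hmono := (S.lam_strictMono _ (unitClamp_mem x)).monotone
  rcases h with ⟨hi, h⟩ | ⟨hi, h⟩
  · have := hmono h
    simpa [sgn, hi, speed] using this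
  · have := hmono h
    simpa [sgn, not_lt.2 hi, speed] using this

/-- On the diagonal this quantity is the rate of `x - ξ` along the path, so a path that reaches the
diagonal crosses it outwards. It follows from the ordering of the speeds: the direction of time is
chosen so that the path runs from the interior to its data. -/
theorem dir_mul_sub_neg (S : HypSystem m p) {i j : Fin (m + p)} (hij : i ≠ j) (x : ℝ) :
    dir m i j * (S.speed i x - S.speed j x) < 0 := by
  unfold dir
  split_ifs with h
  · have h1 := S.sgn_mul_le_of_slow h x
    have h2 : S.speed i x ≠ S.speed j x := (S.lam_strictMono _ (unitClamp_mem x)).injective.ne hij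
    have h3 : sgn m i ≠ 0 := by rcases sgn_eq i with h | h <;> rw [h] <;> norm_num
    have h4 : sgn m i * S.speed j x ≠ sgn m i * S.speed i x := fun h =>
      h2 (mul_left_cancel₀ h3 h).symm
    have := lt_of_le_of_ne h1 h4
    linarith
  · have h1 := S.sgn_mul_lt_of_not_slow h x
    linarith

/-- The left-hand side is the rate of `weight` along a path. In the slow case `dir * sgn = -1` and
the ratio is at most `1`, so the margin is `ε`. Otherwise `dir * sgn = 1` and the ratio exceeds `1`
by a uniform amount, by compactness, and a small `ε` does not spoil this. One weight thus decreases
along the characteristics of all columns. -/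
theorem exists_weight_rate (S : HypSystem m p) :
    ∃ ε δ : ℝ, 0 < ε ∧ ε < 1 ∧ 0 < δ ∧ ∀ i j x,
      dir m i j * sgn m i * (1 - (1 - ε) * ((S.speed i x)⁻¹ * S.speed j x)) ≤ -δ := by
  have hgap : ∀ i j : Fin (m + p), ∃ η : ℝ, 0 < η ∧ (¬ Slow m i j → ∀ x,
      1 + η ≤ (S.speed i x)⁻¹ * S.speed j x) := fun i j => by
    by_cases h : Slow m i j
    · exact ⟨1, one_pos, fun h' => (h' h).elim⟩
    · have hc : Continuous fun x => (S.speed i x)⁻¹ * S.speed j x :=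
        ((S.continuous_speed i).inv₀ (S.speed_ne_zero i)).mul (S.continuous_speed j)
      obtain ⟨x₀, -, h0⟩ := isCompact_Icc.exists_isMinOn (s := Icc (0 : ℝ) 1)
        (nonempty_Icc.2 zero_le_one) hc.continuousOn
      refine ⟨(S.speed i x₀)⁻¹ * S.speed j x₀ - 1, ?_, fun _ x => ?_⟩
      · have h1 := S.sgn_mul_lt_of_not_slow h x₀
        have h2 := S.sgn_mul_speed_pos i x₀
        have h3 : (S.speed i x₀)⁻¹ * S.speed j x₀
            = (sgn m i * S.speed j x₀) / (sgn m i * S.speed i x₀) := by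
          rw [mul_div_mul_left _ _ (by rcases sgn_eq i with h | h <;> rw [h] <;> norm_num)]
          ring
        rw [h3, sub_pos, lt_div_iff₀ h2]
        linarith
      · have := h0 (unitClamp_mem x)
        simp only [mem_ofPred_eq, speed, unitClamp_of_mem (unitClamp_mem x)] at this
        simp only [speed]
        linarith
  choose η hη hgap using hgap
  obtain ⟨η₀, h0, hmin⟩ : ∃ η₀ : ℝ, 0 < η₀ ∧ ∀ i j, η₀ ≤ η i j := by
    rcases isEmpty_or_nonempty (Fin (m + p)) with he | he
    · exact ⟨1, one_pos, fun i => he.elim i⟩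
    · obtain ⟨i₀, h0⟩ := Finite.exists_min fun k : Fin (m + p) × Fin (m + p) => η k.1 k.2
      exact ⟨_, hη _ _, fun i j => h0 (i, j)⟩
  -- Chosen so that `(1 - ε) * (1 + η₀) = 1 + η₀ / 2`: half of the gap survives in the fast case.
  set ε : ℝ := η₀ / (2 * (1 + η₀)) with hε
  have hεp : 0 < ε := by positivity
  have hε1 : ε < 1 := by rw [hε, div_lt_one (by positivity)]; linarith
  have hεη : (1 - ε) * (1 + η₀) = 1 + η₀ / 2 := by rw [hε]; field_simp; ring
  refine ⟨ε, min ε (η₀ / 2), hεp, hε1, lt_min hεp (by positivity), fun i j x => ?_⟩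
  unfold dir
  split_ifs with h
  · have h1 := S.sgn_mul_le_of_slow h x
    have h2 := S.sgn_mul_speed_pos i x
    have h3 : (S.speed i x)⁻¹ * S.speed j x ≤ 1 := by
      have : (S.speed i x)⁻¹ * S.speed j x
            = (sgn m i * S.speed j x) / (sgn m i * S.speed i x) := by
          rw [mul_div_mul_left _ _ (by rcases sgn_eq i with h | h <;> rw [h] <;> norm_num)]
          ring
      rw [this, div_le_one h2]
      exact h1
    rw [neg_mul, sgn_mul_self]
    have := min_le_left ε (η₀ / 2)
    nlinarith
  · rw [sgn_mul_self]
    have h3 := (add_le_add_right (hmin i j) 1).trans (hgap i j h x)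
    have := min_le_right ε (η₀ / 2)
    nlinarith

/-- The characteristic of `K_ij` through `q`, run towards the boundary data. -/
def path (S : HypSystem m p) (i j : Fin (m + p)) (q : ℝ × ℝ) (s : ℝ) : ℝ × ℝ :=
  (S.position i (S.travel i q.1 + dir m i j * s), S.position j (S.travel j q.2 + dir m i j * s))

theorem continuous_path (S : HypSystem m p) (i j : Fin (m + p)) :
    Continuous fun z : (ℝ × ℝ) × ℝ => S.path i j z.1 z.2 := by
  have h1 := S.continuous_position i
  have h2 := S.continuous_position j
  have h3 := S.continuous_travel i
  have h4 := S.continuous_travel j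
  unfold path
  fun_prop

theorem path_zero (S : HypSystem m p) (i j : Fin (m + p)) (q : ℝ × ℝ) : S.path i j q 0 = q := by
  simp [path, position_travel]

theorem path_path (S : HypSystem m p) (i j : Fin (m + p)) (q : ℝ × ℝ) (r s : ℝ) :
    S.path i j (S.path i j q r) s = S.path i j q (r + s) := by
  simp only [path, travel_position, mul_add, add_assoc]

theorem hasDerivAt_path_fst (S : HypSystem m p) (i j : Fin (m + p)) (q : ℝ × ℝ) (s : ℝ) :
    HasDerivAt (fun s => (S.path i j q s).1)
      (dir m i j * S.speed i (S.path i j q s).1) s := by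
  have h := (S.hasDerivAt_position i (S.travel i q.1 + dir m i j * s)).comp s
    (((hasDerivAt_id s).const_mul (dir m i j)).const_add (S.travel i q.1))
  rw [mul_one, mul_comm] at h
  exact h

theorem hasDerivAt_path_snd (S : HypSystem m p) (i j : Fin (m + p)) (q : ℝ × ℝ) (s : ℝ) :
    HasDerivAt (fun s => (S.path i j q s).2)
      (dir m i j * S.speed j (S.path i j q s).2) s := by
  have h := (S.hasDerivAt_position j (S.travel j q.2 + dir m i j * s)).comp s
    (((hasDerivAt_id s).const_mul (dir m i j)).const_add (S.travel j q.2))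
  rw [mul_one, mul_comm] at h
  exact h

theorem strictMono_or_strictAnti_position (S : HypSystem m p) (i : Fin (m + p)) :
    StrictMono (S.position i) ∨ StrictAnti (S.position i) := by
  rcases sgn_eq i with h | h
  · left
    apply strictMono_of_hasDerivAt_pos (S.hasDerivAt_position i)
    intro u
    have := S.sgn_mul_speed_pos i (S.position i u)
    rwa [h, one_mul] at this
  · right
    apply strictAnti_of_hasDerivAt_neg (S.hasDerivAt_position i)
    intro u
    have := S.sgn_mul_speed_pos i (S.position i u)
    rw [h] at this
    linarith

theorem position_mem_uIcc (S : HypSystem m p) (i : Fin (m + p)) {u v w : ℝ} (h : w ∈ uIcc u v) :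
    S.position i w ∈ uIcc (S.position i u) (S.position i v) := by
  rcases S.strictMono_or_strictAnti_position i with hm | hm
  · exact hm.monotone.mapsTo_uIcc h
  · exact hm.antitone.mapsTo_uIcc h

theorem add_mul_mem_uIcc {u d s r : ℝ} (hr : 0 ≤ r) (hrs : r ≤ s) :
    u + d * r ∈ uIcc (u + d * 0) (u + d * s) := by
  rcases le_total 0 d with hd | hd
  · apply Icc_subset_uIcc
    constructor <;> nlinarith
  · apply Icc_subset_uIcc'
    constructor <;> nlinarith

/-- A characteristic that leaves the triangle does not return. -/
theorem path_mem_of_le (S : HypSystem m p) (i j : Fin (m + p)) {q : ℝ × ℝ} (hq : q ∈ triangle)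
    {r s : ℝ} (hr : 0 ≤ r) (hrs : r ≤ s) (hs : S.path i j q s ∈ triangle) :
    S.path i j q r ∈ triangle := by
  have hx := S.position_mem_uIcc i
    (add_mul_mem_uIcc (u := S.travel i q.1) (d := dir m i j) hr hrs)
  have hy := S.position_mem_uIcc j
    (add_mul_mem_uIcc (u := S.travel j q.2) (d := dir m i j) hr hrs)
  simp only [mul_zero, add_zero, position_travel] at hx hy
  refine ⟨?_, ?_, ?_⟩
  · exact (le_min hq.1 hs.1).trans hy.1
  -- For `i = j` both coordinates follow the same monotone flow, which preserves their order. For `i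
  -- ≠ j` the direction of crossing at the diagonal is used.
  · by_cases hij : i = j
    · subst hij
      have h2 := hs.2.1
      have h3 := hq.2.1
      have hmt : ∀ r, S.path i i q r = (S.position i (S.travel i q.1 + dir m i i * r),
        S.position i (S.travel i q.2 + dir m i i * r)) := fun r => rfl
      rcases S.strictMono_or_strictAnti_position i with hm | hm
      · rw [hmt]
        apply hm.monotone
        have : S.travel i q.2 ≤ S.travel i q.1 := by
          rw [← hm.le_iff_le, position_travel, position_travel]; exact h3
        linarith
      · rw [hmt]
        apply hm.antitone
        have : S.travel i q.1 ≤ S.travel i q.2 := by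
          rw [← hm.le_iff_ge, position_travel, position_travel]; exact h3
        linarith
    -- Time is reversed from the later point, which lies in the triangle. At every zero of `ξ - x`
    -- the reversed derivative is negative, so `ξ - x` cannot become positive.
    · have hd : ∀ t, HasDerivAt (fun t => (S.path i j q (s - t)).2 - (S.path i j q (s - t)).1)
          (dir m i j * (S.speed i (S.path i j q (s - t)).1
            - S.speed j (S.path i j q (s - t)).2)) t := fun t => by
        have h1 := (S.hasDerivAt_path_snd i j q (s - t)).scomp t ((hasDerivAt_id t).const_sub s)
        have h2 := (S.hasDerivAt_path_fst i j q (s - t)).scomp t ((hasDerivAt_id t).const_sub s)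
        refine (h1.sub h2).congr_deriv ?_
        simp only [smul_eq_mul]
        ring
      have := image_le_of_deriv_right_lt_deriv_boundary (a := 0) (b := s)
        (fun t _ => (hd t).continuousAt.continuousWithinAt)
        (fun t _ => (hd t).hasDerivWithinAt) (B := fun _ => (0 : ℝ)) (B' := fun _ => 0)
        (by simpa using hs.2.1) (fun t => hasDerivAt_const _ _) (fun t _ ht => by
          have h0 : (S.path i j q (s - t)).2 = (S.path i j q (s - t)).1 := by linarith
          rw [h0]
          exact S.dir_mul_sub_neg hij _) (x := s - r) ⟨by linarith, by linarith⟩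
      simp only [sub_sub_cancel] at this
      linarith
  · exact hx.2.trans (max_le hq.2.2 hs.2.2)

/-- The exponent of the weights in which the kernel equations are contractive. -/
def weight (S : HypSystem m p) (ε : ℝ) (i : Fin (m + p)) (q : ℝ × ℝ) : ℝ :=
  sgn m i * S.travel i q.1 - (1 - ε) * (sgn m i * S.travel i q.2)

theorem continuous_weight (S : HypSystem m p) (ε : ℝ) (i : Fin (m + p)) :
    Continuous (S.weight ε i) := by
  have h3 := S.continuous_travel i
  unfold weight
  fun_prop

theorem exists_weight_bound (S : HypSystem m p) (ε : ℝ) (i : Fin (m + p)) :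
    ∃ W : ℝ, ∀ q ∈ triangle, |S.weight ε i q| ≤ W := by
  obtain ⟨W, hW⟩ := (isCompact_Icc.prod isCompact_Icc).exists_bound_of_continuousOn
    (s := Icc (0 : ℝ) 1 ×ˢ Icc (0 : ℝ) 1) (S.continuous_weight ε i).continuousOn
  exact ⟨W, fun q hq => hW q ⟨fst_mem_of_mem_triangle hq, snd_mem_of_mem_triangle hq⟩⟩

/-- The term `travel i x` changes at the constant rate `dir`, so the derivative of the weight
depends on `ξ` only and is controlled by the rate condition. This decrease bounds exit times and
also produces the contraction. -/
theorem weight_path_le (S : HypSystem m p) {ε δ : ℝ} {i j : Fin (m + p)}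
    (h : ∀ x, dir m i j * sgn m i * (1 - (1 - ε) * ((S.speed i x)⁻¹ * S.speed j x)) ≤ -δ)
    (q : ℝ × ℝ) {s : ℝ} (hs : 0 ≤ s) :
    S.weight ε i (S.path i j q s) ≤ S.weight ε i q - δ * s := by
  have hd : ∀ s, HasDerivAt (fun s => S.weight ε i (S.path i j q s) + δ * s)
      (dir m i j * sgn m i * (1 - (1 - ε) * ((S.speed i (S.path i j q s).2)⁻¹
        * S.speed j (S.path i j q s).2)) + δ) s := fun s => by
    have h1 := (S.hasDerivAt_travel i (S.path i j q s).2).comp s (S.hasDerivAt_path_snd i j q s)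
    have h2 := (S.hasDerivAt_travel i (S.path i j q s).1).comp s (S.hasDerivAt_path_fst i j q s)
    refine (((h2.const_mul (sgn m i)).sub ((h1.const_mul (sgn m i)).const_mul (1 - ε))).add
      ((hasDerivAt_id s).const_mul δ)).congr_deriv ?_
    have : (S.speed i (S.path i j q s).1)⁻¹ * (dir m i j * S.speed i (S.path i j q s).1)
        = dir m i j := by
      rw [mul_left_comm, inv_mul_cancel₀ (S.speed_ne_zero _ _), mul_one]
    rw [this]
    ring
  have := antitone_of_hasDerivAt_nonpos hd (fun s => by
    have := h (S.path i j q s).2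
    simp only [Pi.zero_apply]
    linarith) hs
  simp only [path_zero, mul_zero, add_zero] at this
  linarith

/-- The time at which the characteristic of `K_ij` through `q` reaches the boundary data. -/
def exitTime (S : HypSystem m p) (i j : Fin (m + p)) (q : ℝ × ℝ) : ℝ :=
  sSup {s | 0 ≤ s ∧ S.path i j q s ∈ triangle}

/-- The weight is bounded by some `W` on the triangle and falls at the rate `δ`, so a path spends at
most the time `2W/δ` there. -/
theorem exists_exit_bound (S : HypSystem m p) (i j : Fin (m + p)) :
    ∃ L : ℝ, ∀ q ∈ triangle, ∀ s, 0 ≤ s → S.path i j q s ∈ triangle → s ≤ L := by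
  obtain ⟨ε, δ, -, -, hδ, h⟩ := S.exists_weight_rate
  obtain ⟨W, hW⟩ := S.exists_weight_bound ε i
  refine ⟨2 * W / δ, fun q hq s hs hp => ?_⟩
  rw [le_div_iff₀ hδ]
  have h1 := S.weight_path_le (h i j) q hs
  have h2 := (abs_le.1 (hW q hq)).2
  have h3 := (abs_le.1 (hW _ hp)).1
  linarith

/-- The times in the triangle form an initial interval because there is no return, a bounded one by
the weight, and a closed one because the triangle is closed. The supremum is therefore attained. -/
theorem path_mem_iff (S : HypSystem m p) (i j : Fin (m + p)) {q : ℝ × ℝ} (hq : q ∈ triangle)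
    {s : ℝ} (hs : 0 ≤ s) : S.path i j q s ∈ triangle ↔ s ≤ S.exitTime i j q := by
  obtain ⟨L, hL⟩ := S.exists_exit_bound i j
  have hbdd : BddAbove {s | 0 ≤ s ∧ S.path i j q s ∈ triangle} :=
    ⟨L, fun s hs => hL q hq s hs.1 hs.2⟩
  have hne : {s | 0 ≤ s ∧ S.path i j q s ∈ triangle}.Nonempty :=
    ⟨0, le_rfl, by rwa [path_zero]⟩
  have hcl : IsClosed {s | 0 ≤ s ∧ S.path i j q s ∈ triangle} := by
    refine (isClosed_le continuous_const continuous_id).inter (isClosed_triangle.preimage ?_)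
    exact (S.continuous_path i j).comp (continuous_const.prodMk continuous_id)
  constructor
  · intro h
    exact le_csSup hbdd ⟨hs, h⟩
  · intro h
    exact S.path_mem_of_le i j hq hs h (hcl.csSup_mem hne hbdd).2

theorem exitTime_nonneg (S : HypSystem m p) (i j : Fin (m + p)) {q : ℝ × ℝ} (hq : q ∈ triangle) :
    0 ≤ S.exitTime i j q := by
  rw [← S.path_mem_iff i j hq le_rfl, path_zero]; exact hq

theorem exitTime_path (S : HypSystem m p) (i j : Fin (m + p)) {q : ℝ × ℝ} (hq : q ∈ triangle)
    {r : ℝ} (hr : 0 ≤ r) (h : S.path i j q r ∈ triangle) :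
    S.exitTime i j (S.path i j q r) = S.exitTime i j q - r := by
  have h1 : r ≤ S.exitTime i j q := (S.path_mem_iff i j hq hr).1 h
  have key : ∀ s, 0 ≤ s → (s ≤ S.exitTime i j (S.path i j q r) ↔ s ≤ S.exitTime i j q - r) :=
    fun s hs => by
    rw [← S.path_mem_iff i j h hs, path_path, S.path_mem_iff i j hq (add_nonneg hr hs)]
    constructor <;> intro h <;> linarith
  apply le_antisymm
  · exact (key _ (S.exitTime_nonneg i j h)).1 le_rfl
  · exact (key _ (by linarith)).2 le_rfl

/-- For `s > 0`, staying at least until time `s` means that the point and its image under the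
continuous path map at time `s` both lie in the triangle, which is a closed condition. -/
theorem measurable_exitTime (S : HypSystem m p) (i j : Fin (m + p)) :
    Measurable (triangle.indicator (S.exitTime i j)) := by
  apply measurable_of_Ici
  intro s
  have hc : Continuous fun q => S.path i j q s :=
    (S.continuous_path i j).comp (continuous_id.prodMk continuous_const)
  rcases le_or_gt s 0 with hs | hs
  · convert MeasurableSet.univ
    ext q
    simp only [mem_preimage, mem_Ici, mem_univ, iff_true]
    by_cases hq : q ∈ triangle
    · rw [indicator_of_mem hq]; exact hs.trans (S.exitTime_nonneg i j hq)
    · rw [indicator_of_notMem hq]; exact hs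
  · convert (isClosed_triangle.inter (isClosed_triangle.preimage hc)).measurableSet
    ext q
    simp only [mem_preimage, mem_Ici, mem_inter_iff]
    by_cases hq : q ∈ triangle
    · rw [indicator_of_mem hq, S.path_mem_iff i j hq hs.le]; simp [hq]
    · rw [indicator_of_notMem hq]; simp [hq, hs]

end HypSystem
end
-- The kernel equations as a fixed-point problem
noncomputable section

theorem integral_exp_neg_mul_le {c T : ℝ} (hc : 0 < c) :
    ∫ s in (0 : ℝ)..T, Real.exp (-(c * s)) ≤ 1 / c := by
  have h : ∀ s, HasDerivAt (fun s => -(Real.exp (-(c * s)) / c)) (Real.exp (-(c * s))) s :=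
    fun s => by
      have h1 := ((((hasDerivAt_id s).const_mul c).neg).exp.div_const c).neg
      refine h1.congr_deriv ?_
      simp only [id]
      field_simp
      rfl
  have := intervalIntegral.integral_eq_sub_of_hasDerivAt (a := 0) (b := T) (fun s _ => h s)
    ((Real.continuous_exp.comp (continuous_const.mul continuous_id).neg).intervalIntegrable _ _)
  rw [this]
  simp only [mul_zero, neg_zero, Real.exp_zero]
  have := div_pos (Real.exp_pos (-(c * T))) hc
  linarith

namespace HypSystem

variable {m p : ℕ}

/-- The source of the equation for `K_ij`, as a function of the `i`-th row of the kernel. -/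
def rowSource (S : HypSystem m p) (K : Fin (m + p) → ℝ × ℝ → ℝ) (j : Fin (m + p)) (q : ℝ × ℝ) : ℝ :=
  -∑ k, (S.coup k j q.2 + if k = j then S.speedDeriv j q.2 else 0) * K k q

/-- The boundary data of `K_ij`, as a function of the `i`-th row of the kernel. -/
def rowData (S : HypSystem m p) (k₁ k₂ : Fin (m + p) → Fin (m + p) → ℝ → ℝ) (i : Fin (m + p))
    (K : Fin (m + p) → ℝ × ℝ → ℝ) (j : Fin (m + p)) (q : ℝ × ℝ) : ℝ :=
  -- The diagonal takes precedence at the corners, where different sets of data meet without being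
  -- compatible.
  if q.1 = q.2 ∧ i ≠ j then S.coup i j q.1 / (S.speed i q.1 - S.speed j q.1)
  else if ¬ Slow m i j then k₁ i j (unitClamp q.2)
  else if q.2 = 0 then
    if h : (i : ℕ) < m ∧ (j : ℕ) < m then
      -(1 / S.speed j 0) *
        ∑ k : Fin p, S.speed (Fin.natAdd m k) 0 * K (Fin.natAdd m k) q * S.Q k ⟨j, h.2⟩
    else k₂ i j (unitClamp q.1)
  -- No exit point belongs here. In the slow case `x` decreases along the path, which can leave only
  -- through the diagonal or through `ξ = 0`; for `i = j` it runs parallel to the diagonal and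
  -- leaves through `ξ = 0`.
  else 0

/-- The fixed-point map of the equations for the `i`-th row of the kernel. -/
def rowMap (S : HypSystem m p) (k₁ k₂ : Fin (m + p) → Fin (m + p) → ℝ → ℝ) (i : Fin (m + p))
    (K : Fin (m + p) → ℝ × ℝ → ℝ) (j : Fin (m + p)) : ℝ × ℝ → ℝ :=
  triangle.indicator fun q => S.rowData k₁ k₂ i K j (S.path i j q (S.exitTime i j q))
    - dir m i j * ∫ s in (0 : ℝ)..S.exitTime i j q, S.rowSource K j (S.path i j q s)

theorem measurable_rowSource (S : HypSystem m p) {K : Fin (m + p) → ℝ × ℝ → ℝ}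
    (hK : ∀ j, Measurable (K j)) (j : Fin (m + p)) : Measurable (S.rowSource K j) := by
  have h1 := fun k => (S.continuous_coup k j).measurable
  have h2 := (S.continuous_speedDeriv j).measurable
  unfold rowSource
  refine Measurable.neg (Finset.measurable_sum _ fun k _ => ?_)
  refine Measurable.mul (((h1 k).comp measurable_snd).add ?_) (hK k)
  split_ifs
  · exact h2.comp measurable_snd
  · exact measurable_const

theorem measurable_rowData (S : HypSystem m p) {k₁ k₂ : Fin (m + p) → Fin (m + p) → ℝ → ℝ}
    (hk₁ : ∀ i j, ContinuousOn (k₁ i j) (Icc 0 1)) (hk₂ : ∀ i j, ContinuousOn (k₂ i j) (Icc 0 1))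
    (i : Fin (m + p)) {K : Fin (m + p) → ℝ × ℝ → ℝ}
    (hK : ∀ j, Measurable (K j)) (j : Fin (m + p)) : Measurable (S.rowData k₁ k₂ i K j) := by
  have h1 := (S.continuous_coup i j).measurable
  have h2 := (S.continuous_speed i).measurable
  have h3 := (S.continuous_speed j).measurable
  have h4 := (hk₁ i j).comp_unitClamp.measurable
  have h5 := (hk₂ i j).comp_unitClamp.measurable
  unfold rowData
  refine Measurable.ite ?_ ?_ ?_
  · exact (measurableSet_eq_fun measurable_fst measurable_snd).inter (MeasurableSet.const _)
  · exact (h1.comp measurable_fst).div ((h2.comp measurable_fst).sub (h3.comp measurable_fst))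
  refine Measurable.ite (MeasurableSet.const _) (h4.comp measurable_snd) ?_
  refine Measurable.ite (measurableSet_eq_fun measurable_snd measurable_const) ?_
    measurable_const
  split_ifs
  · exact (Finset.measurable_sum _ fun k _ => ((hK _).const_mul _).mul_const _).const_mul _
  · exact h5.comp measurable_fst

theorem measurable_rowMap (S : HypSystem m p) {k₁ k₂ : Fin (m + p) → Fin (m + p) → ℝ → ℝ}
    (hk₁ : ∀ i j, ContinuousOn (k₁ i j) (Icc 0 1)) (hk₂ : ∀ i j, ContinuousOn (k₂ i j) (Icc 0 1))
    (i : Fin (m + p)) {K : Fin (m + p) → ℝ × ℝ → ℝ}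
    (hK : ∀ j, Measurable (K j)) (j : Fin (m + p)) : Measurable (S.rowMap k₁ k₂ i K j) := by
  have hτ := S.measurable_exitTime i j
  set τ := triangle.indicator (S.exitTime i j) with hτd
  have hτ0 : ∀ q, 0 ≤ τ q := fun q => indicator_nonneg (fun q hq => S.exitTime_nonneg i j hq) q
  -- The upper limit depends on the point, so the integral is rewritten over the whole line with a
  -- jointly measurable indicator; measurability of parametric integrals then applies.
  have heq : S.rowMap k₁ k₂ i K j = triangle.indicator fun q =>
      S.rowData k₁ k₂ i K j (S.path i j q (τ q))
      - dir m i j * ∫ s, ({z : (ℝ × ℝ) × ℝ | 0 < z.2 ∧ z.2 ≤ τ z.1}.indicator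
        (fun z => S.rowSource K j (S.path i j z.1 z.2))) (q, s) := by
    ext q
    by_cases hq : q ∈ triangle
    · have h1 : S.exitTime i j q = τ q := by rw [hτd, indicator_of_mem hq]
      rw [rowMap, indicator_of_mem hq, indicator_of_mem hq, h1,
        intervalIntegral.integral_of_le (hτ0 q), ← integral_indicator measurableSet_Ioc]
      rfl
    · rw [rowMap, indicator_of_notMem hq, indicator_of_notMem hq]
  rw [heq]
  have hp := (S.continuous_path i j).measurable
  refine Measurable.indicator (Measurable.sub ?_ (Measurable.const_mul ?_ _))
    isClosed_triangle.measurableSet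
  · exact (S.measurable_rowData hk₁ hk₂ i hK j).comp (hp.comp (measurable_id.prodMk hτ))
  · refine (StronglyMeasurable.integral_prod_right' (Measurable.stronglyMeasurable ?_)).measurable
    refine ((S.measurable_rowSource hK j).comp hp).indicator ?_
    exact (measurableSet_lt measurable_const measurable_snd).inter
      (measurableSet_le measurable_snd (hτ.comp measurable_fst))

/-- Bounds on which the contraction estimates depend. -/
theorem exists_rowSource_bound (S : HypSystem m p) :
    ∃ H : ℝ, 0 < H ∧ ∀ (K : Fin (m + p) → ℝ × ℝ → ℝ) (j : Fin (m + p)) (q : ℝ × ℝ) (B : ℝ),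
      (∀ k, |K k q| ≤ B) → |S.rowSource K j q| ≤ H * B := by
  obtain ⟨C, hC, -, h2, h3, -⟩ := S.exists_coeff_bound
  refine ⟨(m + p : ℕ) * (2 * C) + 1, by positivity, fun K j q B hB => ?_⟩
  have hB0 : 0 ≤ B := (abs_nonneg _).trans (hB j)
  unfold rowSource
  rw [abs_neg]
  calc _ ≤ ∑ k, |(S.coup k j q.2 + if k = j then S.speedDeriv j q.2 else 0) * K k q| :=
        Finset.abs_sum_le_sum_abs _ _
    _ ≤ ∑ _k : Fin (m + p), 2 * C * B := by
        refine Finset.sum_le_sum fun k _ => ?_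
        rw [abs_mul]
        refine mul_le_mul ?_ (hB k) (abs_nonneg _) (by positivity)
        refine (abs_add_le _ _).trans ?_
        have a1 := h3 k j q.2
        have a2 : |if k = j then S.speedDeriv j q.2 else 0| ≤ C := by
          split_ifs
          · exact h2 _ _
          · simpa using hC.le
        linarith
    _ = (m + p : ℕ) * (2 * C) * B := by
        rw [Finset.sum_const, Finset.card_univ, Fintype.card_fin, nsmul_eq_mul]; ring
    _ ≤ _ := by linarith

theorem rowSource_sub (S : HypSystem m p) (K K' : Fin (m + p) → ℝ × ℝ → ℝ) (j : Fin (m + p))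
    (q : ℝ × ℝ) : S.rowSource K j q - S.rowSource K' j q = S.rowSource (fun k => K k - K' k) j q := by
  unfold rowSource
  rw [neg_sub_neg, ← neg_sub, ← Finset.sum_sub_distrib]
  congr 1
  refine Finset.sum_congr rfl fun k _ => ?_
  simp only [Pi.sub_apply]; ring

theorem exists_rowData_bound (S : HypSystem m p) {k₁ k₂ : Fin (m + p) → Fin (m + p) → ℝ → ℝ}
    (hk₁ : ∀ i j, ContinuousOn (k₁ i j) (Icc 0 1)) (hk₂ : ∀ i j, ContinuousOn (k₂ i j) (Icc 0 1)) :
    ∃ B : ℝ, ∀ i j q, |S.rowData k₁ k₂ i (fun _ _ => 0) j q| ≤ B := by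
  have h1 := fun i j => (hk₁ i j).exists_abs_le_unit
  have h2 := fun i j => (hk₂ i j).exists_abs_le_unit
  have h3 : ∀ i j : Fin (m + p), ∃ C : ℝ, i ≠ j → ∀ x,
      |S.coup i j x / (S.speed i x - S.speed j x)| ≤ C := fun i j => by
    by_cases hij : i = j
    · exact ⟨0, fun h => (h hij).elim⟩
    · have hc : Continuous fun x => S.coup i j x / (S.speed i x - S.speed j x) :=
        (S.continuous_coup i j).div ((S.continuous_speed i).sub (S.continuous_speed j))
          fun x => sub_ne_zero.2
            ((S.lam_strictMono _ (unitClamp_mem x)).injective.ne hij)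
      obtain ⟨C, hC⟩ := hc.continuousOn.exists_abs_le_unit
      refine ⟨C, fun _ x => ?_⟩
      have := hC _ (unitClamp_mem x)
      simpa only [coup, speed, unitClamp_of_mem (unitClamp_mem x)] using this
  choose c1 h1 using h1
  choose c2 h2 using h2
  choose c3 h3 using h3
  have key : ∀ i j : Fin (m + p), ∀ q,
      |S.rowData k₁ k₂ i (fun _ _ => 0) j q| ≤ |c1 i j| + |c2 i j| + |c3 i j| := fun i j q => by
    have e1 := abs_nonneg (c1 i j)
    have e2 := abs_nonneg (c2 i j)
    have e3 := abs_nonneg (c3 i j)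
    have f1 := le_abs_self (c1 i j)
    have f2 := le_abs_self (c2 i j)
    have f3 := le_abs_self (c3 i j)
    unfold rowData
    split_ifs with g1 g2 g3 g4
    · have := h3 i j g1.2 q.1; linarith
    · simp; linarith
    · have := h2 i j _ (unitClamp_mem q.1); linarith
    · simp; linarith
    · have := h1 i j _ (unitClamp_mem q.2); linarith
  rcases isEmpty_or_nonempty (Fin (m + p)) with he | he
  · exact ⟨1, fun i => he.elim i⟩
  · obtain ⟨i₀, h0⟩ := Finite.exists_max
      fun k : Fin (m + p) × Fin (m + p) => |c1 k.1 k.2| + |c2 k.1 k.2| + |c3 k.1 k.2|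
    exact ⟨_, fun i j q => (key i j q).trans (h0 (i, j))⟩

/-- Only columns `j < m` have data that depend on the unknown, and these data read only the columns
of positive index. This two-level structure is what allows the data to be made contractive by
weighting the columns. -/
theorem exists_rowData_sub_bound (S : HypSystem m p)
    (k₁ k₂ : Fin (m + p) → Fin (m + p) → ℝ → ℝ) :
    ∃ H : ℝ, 0 < H ∧ ∀ (i j : Fin (m + p)) (K K' : Fin (m + p) → ℝ × ℝ → ℝ) (q : ℝ × ℝ) (B : ℝ),
      0 ≤ B → (∀ k : Fin p, |K (Fin.natAdd m k) q - K' (Fin.natAdd m k) q| ≤ B) →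
      |S.rowData k₁ k₂ i K j q - S.rowData k₁ k₂ i K' j q|
        ≤ if (j : ℕ) < m then H * B else 0 := by
  obtain ⟨C, hC, h1, -, -, h4⟩ := S.exists_coeff_bound
  obtain ⟨c, hc, hcl⟩ := S.exists_speed_lower
  have hci : ∀ i x, |1 / S.speed i x| ≤ 1 / c := fun i x => by
    rw [abs_div, abs_one]
    apply one_div_le_one_div_of_le hc
    refine (hcl i x).trans ((le_abs_self _).trans ?_)
    rw [abs_mul]
    rcases sgn_eq i with h | h <;> simp [h]
  refine ⟨1 / c * (p * (C * C)) + 1, by positivity, fun i j K K' q B hB0 hB => ?_⟩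
  have hz : (0 : ℝ) ≤ if (j : ℕ) < m then (1 / c * (p * (C * C)) + 1) * B else 0 := by
    split_ifs
    · positivity
    · exact le_rfl
  unfold rowData
  by_cases g1 : q.1 = q.2 ∧ i ≠ j
  · simpa only [if_pos g1, sub_self, abs_zero] using hz
  by_cases g2 : ¬ Slow m i j
  · simpa only [if_neg g1, if_pos g2, sub_self, abs_zero] using hz
  by_cases g3 : q.2 = 0
  swap
  · simpa only [if_neg g1, if_neg g2, if_neg g3, sub_self, abs_zero] using hz
  by_cases g4 : (i : ℕ) < m ∧ (j : ℕ) < m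
  swap
  · simpa only [if_neg g1, if_neg g2, if_pos g3, dif_neg g4, sub_self, abs_zero] using hz
  simp only [if_neg g1, if_neg g2, if_pos g3, dif_pos g4, if_pos g4.2]
  rw [← mul_sub, ← Finset.sum_sub_distrib, abs_mul, abs_neg]
  calc _ ≤ 1 / c * ∑ k : Fin p, C * B * C := by
        refine mul_le_mul (hci _ _) ?_ (abs_nonneg _) (by positivity)
        refine (Finset.abs_sum_le_sum_abs _ _).trans (Finset.sum_le_sum fun k _ => ?_)
        rw [← sub_mul, ← mul_sub, abs_mul, abs_mul]
        have := h1 (Fin.natAdd m k) 0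
        have := hB k
        have := h4 k ⟨j, g4.2⟩
        gcongr
    _ = 1 / c * (p * (C * C)) * B := by
        rw [Finset.sum_const, Finset.card_univ, Fintype.card_fin, nsmul_eq_mul]; ring
    _ ≤ _ := by linarith

/-- The fixed-point map halves differences, measured with suitable weights. -/
theorem exists_rowMap_contraction (S : HypSystem m p)
    (k₁ k₂ : Fin (m + p) → Fin (m + p) → ℝ → ℝ) (i : Fin (m + p)) :
    ∃ (g : Fin (m + p) → ℝ × ℝ → ℝ) (a b : ℝ), 0 < a ∧
      (∀ j, ∀ q ∈ triangle, a ≤ g j q ∧ g j q ≤ b) ∧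
      ∀ (K K' : Fin (m + p) → ℝ × ℝ → ℝ) (D : ℝ), 0 ≤ D →
        (∀ j, Measurable (K j)) → (∀ j, Measurable (K' j)) →
        (∃ C, ∀ j q, |K j q| ≤ C) → (∃ C, ∀ j q, |K' j q| ≤ C) →
        (∀ j, ∀ q ∈ triangle, |K j q - K' j q| ≤ D * g j q) →
        ∀ j, ∀ q ∈ triangle,
          |S.rowMap k₁ k₂ i K j q - S.rowMap k₁ k₂ i K' j q| ≤ D / 2 * g j q := by
  obtain ⟨ε, δ, hε, hε1, hδ, hrate⟩ := S.exists_weight_rate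
  obtain ⟨W, hW⟩ := S.exists_weight_bound ε i
  obtain ⟨H, hH, hsrc⟩ := S.exists_rowSource_bound
  obtain ⟨H', hH', hdat⟩ := S.exists_rowData_sub_bound k₁ k₂
  -- Weight of the positive columns. The coupling through `ξ = 0` reads only these columns, so it
  -- acquires the factor `H' * A ≤ 1 / 4`.
  set A : ℝ := min 1 (1 / (4 * H')) with hA
  have hA0 : 0 < A := lt_min one_pos (by positivity)
  have hA1 : A ≤ 1 := min_le_left _ _
  have hAH : H' * A ≤ 1 / 4 := by
    calc H' * A ≤ H' * (1 / (4 * H')) := by gcongr; exact min_le_right _ _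
      _ = 1 / 4 := by field_simp
  -- Rate of the exponential weight. Along a path it falls like `exp(-M δ s)`, so the source
  -- integral contributes at most `H / (M δ) = A / 4`.
  set M : ℝ := 4 * H / (δ * A) with hM
  have hM0 : 0 < M := by positivity
  set w : Fin (m + p) → ℝ := fun j => if (j : ℕ) < m then 1 else A with hw
  have hwA : ∀ j, A ≤ w j := fun j => by simp only [hw]; split_ifs <;> simp [hA1]
  have hw1 : ∀ j, w j ≤ 1 := fun j => by simp only [hw]; split_ifs <;> simp [hA1]
  refine ⟨fun j q => w j * Real.exp (M * S.weight ε i q), A * Real.exp (-(M * W)),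
    Real.exp (M * W), by positivity, fun j q hq => ⟨?_, ?_⟩, ?_⟩
  · have := (abs_le.1 (hW q hq)).1
    refine mul_le_mul (hwA j) (Real.exp_le_exp.2 ?_) (Real.exp_pos _).le (hA0.le.trans (hwA j))
    nlinarith
  · have := (abs_le.1 (hW q hq)).2
    calc w j * Real.exp (M * S.weight ε i q)
        ≤ 1 * Real.exp (M * S.weight ε i q) := by gcongr; exact hw1 j
      _ ≤ _ := by rw [one_mul]; gcongr
  intro K K' D hD hK hK' hKb hKb' hKK j q hq
  beta_reduce at hKK ⊢
  obtain ⟨C, hC⟩ := hKb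
  obtain ⟨C', hC'⟩ := hKb'
  have hτ := S.exitTime_nonneg i j hq
  have hcp : Continuous fun s => S.path i j q s :=
    (S.continuous_path i j).comp (continuous_const.prodMk continuous_id)
  have hint : ∀ {K : Fin (m + p) → ℝ × ℝ → ℝ} {C : ℝ}, (∀ j, Measurable (K j)) →
      (∀ j q, |K j q| ≤ C) → IntervalIntegrable (fun s => S.rowSource K j (S.path i j q s))
        volume 0 (S.exitTime i j q) := fun hK hC =>
    ((S.measurable_rowSource hK j).comp hcp.measurable).intervalIntegrable_of_bound
      (fun s => hsrc _ j _ _ fun k => hC k _) _ _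
  rw [rowMap, rowMap, indicator_of_mem hq, indicator_of_mem hq]
  set τ := S.exitTime i j q
  have hmem : ∀ s ∈ Icc 0 τ, S.path i j q s ∈ triangle := fun s hs =>
    (S.path_mem_iff i j hq hs.1).2 hs.2
  have hwt := fun s (hs : 0 ≤ s) => S.weight_path_le (hrate i j) q hs
  set E := Real.exp (M * S.weight ε i q) with hE
  have hE0 : 0 < E := Real.exp_pos _
  have hexp : ∀ s, 0 ≤ s →
      Real.exp (M * S.weight ε i (S.path i j q s)) ≤ E * Real.exp (-(M * δ * s)) := fun s hs => by
    rw [hE, ← Real.exp_add]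
    apply Real.exp_le_exp.2
    have := hwt s hs
    nlinarith
  -- The data and the source each use up one quarter of `D`.
  have hB : |S.rowData k₁ k₂ i K j (S.path i j q τ) - S.rowData k₁ k₂ i K' j (S.path i j q τ)|
      ≤ D / 4 * (w j * E) := by
    have := hdat i j K K' (S.path i j q τ) (D * (A * E)) (by positivity) fun k => by
      refine (hKK _ _ (hmem τ ⟨hτ, le_rfl⟩)).trans ?_
      have h1 : w (Fin.natAdd m k) = A := by simp [hw]
      rw [h1]
      have h2 := hexp τ hτ
      have h3 : Real.exp (-(M * δ * τ)) ≤ 1 := Real.exp_le_one_iff.2 (by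
        have := mul_nonneg (mul_nonneg hM0.le hδ.le) hτ; linarith)
      have h4 : Real.exp (M * S.weight ε i (S.path i j q τ)) ≤ E := by nlinarith
      gcongr
    refine this.trans ?_
    split_ifs with hj
    · have h1 : w j = 1 := by simp [hw, hj]
      rw [h1]
      have := mul_le_mul_of_nonneg_right hAH (mul_nonneg hD hE0.le)
      linarith
    · have := hA0.le.trans (hwA j); positivity
  have hI : |∫ s in (0 : ℝ)..τ, (S.rowSource K j (S.path i j q s)
      - S.rowSource K' j (S.path i j q s))| ≤ D / 4 * (w j * E) := by
    have h1 : ∀ s ∈ Icc 0 τ, |S.rowSource K j (S.path i j q s)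
      - S.rowSource K' j (S.path i j q s)| ≤ H * (D * E) * Real.exp (-(M * δ * s)) :=
      fun s hs => by
        rw [rowSource_sub]
        refine (hsrc _ j _ (D * (E * Real.exp (-(M * δ * s)))) fun k => ?_).trans
          (le_of_eq (by ring))
        refine (hKK k _ (hmem s hs)).trans (mul_le_mul_of_nonneg_left ?_ hD)
        calc w k * Real.exp (M * S.weight ε i (S.path i j q s))
            ≤ 1 * Real.exp (M * S.weight ε i (S.path i j q s)) := by gcongr; exact hw1 k
          _ ≤ _ := by rw [one_mul]; exact hexp s hs.1
    have h2 := intervalIntegral.norm_integral_le_of_norm_le (μ := volume) hτ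
      (f := fun s => S.rowSource K j (S.path i j q s) - S.rowSource K' j (S.path i j q s))
      (g := fun s => H * (D * E) * Real.exp (-(M * δ * s)))
      (Filter.Eventually.of_forall fun s (hs : s ∈ Ioc 0 τ) => h1 s ⟨hs.1.le, hs.2⟩)
      (Continuous.intervalIntegrable (by fun_prop) _ _)
    rw [intervalIntegral.integral_const_mul] at h2
    rw [← Real.norm_eq_abs]
    refine h2.trans ?_
    have h3 := integral_exp_neg_mul_le (c := M * δ) (T := τ) (by positivity)
    calc _ ≤ H * (D * E) * (1 / (M * δ)) := by gcongr
      _ = D / 4 * (A * E) := by rw [hM]; field_simp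
      _ ≤ _ := by gcongr; exact hwA j
  rw [intervalIntegral.integral_sub (hint hK hC) (hint hK' hC')] at hI
  have hd : |dir m i j| = 1 := by rcases dir_eq i j with h | h <;> simp [h]
  calc _ = |(S.rowData k₁ k₂ i K j (S.path i j q τ) - S.rowData k₁ k₂ i K' j (S.path i j q τ))
        - dir m i j * ((∫ s in (0 : ℝ)..τ, S.rowSource K j (S.path i j q s))
          - ∫ s in (0 : ℝ)..τ, S.rowSource K' j (S.path i j q s))| := by congr 1; ring
    _ ≤ D / 4 * (w j * E) + D / 4 * (w j * E) := by
        refine (abs_sub _ _).trans (add_le_add hB ?_)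
        rw [abs_mul, hd, one_mul]; exact hI
    _ = _ := by ring

theorem rowMap_of_notMem (S : HypSystem m p) (k₁ k₂ : Fin (m + p) → Fin (m + p) → ℝ → ℝ)
    (i : Fin (m + p)) (K : Fin (m + p) → ℝ × ℝ → ℝ) (j : Fin (m + p)) {q : ℝ × ℝ}
    (hq : q ∉ triangle) : S.rowMap k₁ k₂ i K j q = 0 := indicator_of_notMem hq _

/-- The equations for one row of the kernel have a bounded measurable solution. -/
theorem exists_rowMap_fixed (S : HypSystem m p) {k₁ k₂ : Fin (m + p) → Fin (m + p) → ℝ → ℝ}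
    (hk₁ : ∀ i j, ContinuousOn (k₁ i j) (Icc 0 1)) (hk₂ : ∀ i j, ContinuousOn (k₂ i j) (Icc 0 1))
    (i : Fin (m + p)) :
    ∃ K : Fin (m + p) → ℝ × ℝ → ℝ, (∀ j, Measurable (K j)) ∧ (∃ C, ∀ j q, |K j q| ≤ C) ∧
      S.rowMap k₁ k₂ i K = K := by
  obtain ⟨g, a, b, ha, hg, hcontr⟩ := S.exists_rowMap_contraction k₁ k₂ i
  obtain ⟨B, hB⟩ := S.exists_rowData_bound hk₁ hk₂
  have hab : ∀ j : Fin (m + p), ∀ q ∈ triangle, 0 ≤ g j q := fun j q hq =>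
    ha.le.trans (hg j q hq).1
  have h00 : ((0 : ℝ), (0 : ℝ)) ∈ triangle := ⟨le_rfl, le_rfl, zero_le_one⟩
  have hb : 0 < b := ha.trans_le ((hg i _ h00).1.trans (hg i _ h00).2)
  have hB0 : 0 ≤ B := (abs_nonneg _).trans (hB i i 0)
  let T := S.rowMap k₁ k₂ i
  -- Picard iteration from zero. Pointwise limits are used, so that measurability is preserved and
  -- values at every single point, boundary points included, are meaningful.
  let u : ℕ → Fin (m + p) → ℝ × ℝ → ℝ := fun n => T^[n] fun _ _ => 0
  have hu : ∀ n, u (n + 1) = T (u n) := fun n => Function.iterate_succ_apply' _ _ _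
  have hmeas : ∀ n j, Measurable (u n j) := fun n => by
    induction n with
    | zero => exact fun j => measurable_const
    | succ n ih => rw [hu]; exact fun j => S.measurable_rowMap hk₁ hk₂ i ih j
  have huT : ∀ n j, ∀ q ∉ triangle, u n j q = 0 := fun n j q hq => by
    cases n with
    | zero => rfl
    | succ n => rw [hu]; exact S.rowMap_of_notMem _ _ _ _ _ hq
  -- The first iterate is bounded by `B` and the weights are at least `a`, so `D` measures the first
  -- increment in the weighted sense.
  set D := B / a with hD
  have hD0 : 0 ≤ D := by positivity
  have hstep : ∀ n, (∃ C, ∀ j q, |u n j q| ≤ C) ∧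
      ∀ j, ∀ q ∈ triangle, |u (n + 1) j q - u n j q| ≤ D * (1 / 2) ^ n * g j q := fun n => by
    have hbdd : ∀ n, (∃ C, ∀ j q, |u n j q| ≤ C) →
        (∀ j, ∀ q ∈ triangle, |u (n + 1) j q - u n j q| ≤ D * (1 / 2) ^ n * g j q) →
        ∃ C, ∀ j q, |u (n + 1) j q| ≤ C := fun n ⟨C, hC⟩ h => by
      refine ⟨C + D * (1 / 2) ^ n * b, fun j q => ?_⟩
      have h0 := (abs_nonneg _).trans (hC j q)
      by_cases hq : q ∈ triangle
      · have h1 := h j q hq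
        have h2 := hC j q
        have h3 : D * (1 / 2) ^ n * g j q ≤ D * (1 / 2) ^ n * b := by
          have := (hg j q hq).2
          gcongr
        have h4 := abs_sub_abs_le_abs_sub (u (n + 1) j q) (u n j q)
        linarith
      · rw [huT _ _ _ hq, abs_zero]; positivity
    induction n with
    | zero =>
      refine ⟨⟨0, fun j q => by simp [u]⟩, fun j q hq => ?_⟩
      have h1 : u 1 j q - u 0 j q
          = S.rowData k₁ k₂ i (fun _ _ => 0) j (S.path i j q (S.exitTime i j q)) := by
        rw [show u 1 j q = T (fun _ _ => 0) j q from rfl]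
        simp only [T, rowMap, indicator_of_mem hq, rowSource]
        simp [u]
      rw [h1]
      refine (hB _ _ _).trans ?_
      have := (hg j q hq).1
      calc B = D * a := by rw [hD]; field_simp
        _ ≤ _ := by simp only [pow_zero, mul_one]; gcongr
    | succ n ih =>
      have hb' := hbdd n ih.1 ih.2
      refine ⟨hb', fun j q hq => ?_⟩
      have := hcontr (u (n + 1)) (u n) (D * (1 / 2) ^ n) (by positivity) (hmeas _) (hmeas _)
        hb' ih.1 ih.2 j q hq
      rw [hu (n + 1)]
      nth_rewrite 2 [hu n]
      refine this.trans (le_of_eq ?_)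
      rw [pow_succ]; ring
  have hgeo : ∀ j q n, dist (u n j q) (u (n + 1) j q) ≤ D * b * (1 / 2) ^ n := fun j q n => by
    rw [dist_comm, Real.dist_eq]
    by_cases hq : q ∈ triangle
    · refine ((hstep n).2 j q hq).trans ?_
      have := (hg j q hq).2
      calc _ ≤ D * (1 / 2) ^ n * b := by gcongr
        _ = _ := by ring
    · rw [huT _ _ _ hq, huT _ _ _ hq]; simp; positivity
  have hcau : ∀ j q, ∃ l, Filter.Tendsto (fun n => u n j q) Filter.atTop (nhds l) := fun j q =>
    cauchySeq_tendsto_of_complete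
      (cauchySeq_of_le_geometric (1 / 2) (D * b) (by norm_num) (hgeo j q))
  choose K hK using hcau
  have hKu : ∀ j q n, |u n j q - K j q| ≤ D * b * (1 / 2) ^ n / (1 - 1 / 2) := fun j q n =>
    dist_le_of_le_geometric_of_tendsto (1 / 2) (D * b) (by norm_num) (hgeo j q) (hK j q) n
  have hKm : ∀ j, Measurable (K j) := fun j =>
    measurable_of_tendsto_metrizable (fun n => hmeas n j) (tendsto_pi_nhds.2 (hK j))
  have hKb : ∃ C, ∀ j q, |K j q| ≤ C := by
    refine ⟨D * b * (1 / 2) ^ 0 / (1 - 1 / 2), fun j q => ?_⟩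
    have := hKu j q 0
    rwa [show u 0 j q = 0 from rfl, zero_sub, abs_neg] at this
  refine ⟨K, hKm, hKb, ?_⟩
  ext j q
  by_cases hq : q ∈ triangle
  swap
  · rw [S.rowMap_of_notMem _ _ _ _ _ hq]
    refine tendsto_nhds_unique ?_ (hK j q)
    simp only [huT _ _ _ hq]
    exact tendsto_const_nhds
  refine tendsto_nhds_unique (f := fun n => u (n + 1) j q) ?_
    ((hK j q).comp (Filter.tendsto_add_atTop_nat 1))
  rw [tendsto_iff_dist_tendsto_zero]
  -- The contraction, applied to an iterate and the limit, shows that the images of the iterates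
  -- converge to the image of the limit. The factor `2` in the distance comes from summing the
  -- geometric series.
  refine squeeze_zero (fun _ => dist_nonneg) (g := fun n => D * b / a * b * (1 / 2) ^ n)
    (fun n => ?_) ?_
  · rw [Real.dist_eq, hu]
    have := hcontr (u n) K (2 * (D * b * (1 / 2) ^ n) / a) (by positivity) (hmeas n) hKm
      (hstep n).1 hKb (fun j q hq => ?_) j q hq
    · refine this.trans ?_
      have := (hg j q hq).2
      calc _ ≤ 2 * (D * b * (1 / 2) ^ n) / a / 2 * b := by gcongr
        _ = _ := by ring
    · refine (hKu j q n).trans ?_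
      have := (hg j q hq).1
      calc _ = 2 * (D * b * (1 / 2) ^ n) / a * a := by field_simp; norm_num
        _ ≤ _ := by gcongr
  · have := (tendsto_pow_atTop_nhds_zero_of_lt_one (r := (1 / 2 : ℝ)) (by norm_num)
      (by norm_num)).const_mul (D * b / a * b)
    simpa using this

end HypSystem
end
-- The fixed point is a kernel
noncomputable section

theorem HasDerivAt.nonneg_of_nonneg_right {f : ℝ → ℝ} {d τ : ℝ} (hf : HasDerivAt f d 0)
    (h0 : f 0 = 0) (hτ : 0 < τ) (h : ∀ s ∈ Ioo 0 τ, 0 ≤ f s) : 0 ≤ d := by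
  refine ge_of_tendsto hf.tendsto_slope_zero_right ?_
  filter_upwards [Ioo_mem_nhdsGT hτ] with s hs
  have := h s hs
  rw [zero_add, h0, sub_zero, smul_eq_mul]
  exact mul_nonneg (inv_nonneg.2 hs.1.le) this

namespace HypSystem

variable {m p : ℕ}

/-- The function `f` defines a side of the triangle. It is nonnegative inside and strictly
decreasing along the path from one of its zeros, so the path leaves at once. At such points a fixed
point takes its prescribed data. -/
theorem exitTime_eq_zero (S : HypSystem m p) {i j : Fin (m + p)} {q : ℝ × ℝ} (hq : q ∈ triangle)
    {f : ℝ × ℝ → ℝ} {d : ℝ} (hf : HasDerivAt (fun s => f (S.path i j q s)) d 0) (h0 : f q = 0)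
    (hT : ∀ q ∈ triangle, 0 ≤ f q) (hd : d < 0) : S.exitTime i j q = 0 := by
  refine le_antisymm (not_lt.1 fun hτ => ?_) (S.exitTime_nonneg i j hq)
  have := hf.nonneg_of_nonneg_right (by rwa [path_zero]) hτ fun s hs =>
    hT _ ((S.path_mem_iff i j hq hs.1.le).2 hs.2.le)
  linarith

theorem exitTime_diagonal (S : HypSystem m p) {i j : Fin (m + p)} (hij : i ≠ j) {x : ℝ}
    (hx : x ∈ Icc (0 : ℝ) 1) : S.exitTime i j (x, x) = 0 := by
  refine S.exitTime_eq_zero (f := fun q => q.1 - q.2) ⟨hx.1, le_rfl, hx.2⟩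
    ((S.hasDerivAt_path_fst i j (x, x) 0).sub (S.hasDerivAt_path_snd i j (x, x) 0))
    (sub_self _) (fun q hq => sub_nonneg.2 hq.2.1) ?_
  rw [path_zero, ← mul_sub]
  exact S.dir_mul_sub_neg hij x

theorem exitTime_right (S : HypSystem m p) {i j : Fin (m + p)} (hij : ¬ Slow m i j) {ξ : ℝ}
    (hξ : ξ ∈ Icc (0 : ℝ) 1) : S.exitTime i j (1, ξ) = 0 := by
  refine S.exitTime_eq_zero (f := fun q => 1 - q.1) ⟨hξ.1, hξ.2, le_rfl⟩
    ((S.hasDerivAt_path_fst i j (1, ξ) 0).const_sub 1)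
    (sub_self _) (fun q hq => sub_nonneg.2 hq.2.2) ?_
  rw [dir, if_neg hij]
  have := S.sgn_mul_speed_pos i (S.path i j (1, ξ) 0).1
  linarith

theorem exitTime_bottom (S : HypSystem m p) {i j : Fin (m + p)} (hij : Slow m i j)
    (hs : sgn m i = sgn m j) {x : ℝ} (hx : x ∈ Icc (0 : ℝ) 1) :
    S.exitTime i j (x, 0) = 0 := by
  refine S.exitTime_eq_zero (f := fun q => q.2) ⟨le_rfl, hx.1, hx.2⟩
    (S.hasDerivAt_path_snd i j (x, 0) 0) rfl (fun q hq => hq.1) ?_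
  rw [dir, if_pos hij, hs]
  have := S.sgn_mul_speed_pos j (S.path i j (x, 0) 0).2
  linarith

/-- A fixed point satisfies the kernel equation along characteristics. -/
theorem rowMap_fixed_path (S : HypSystem m p) {k₁ k₂ : Fin (m + p) → Fin (m + p) → ℝ → ℝ}
    {i : Fin (m + p)} {K : Fin (m + p) → ℝ × ℝ → ℝ} (hK : ∀ j, Measurable (K j))
    (hKb : ∃ C, ∀ j q, |K j q| ≤ C) (hfix : S.rowMap k₁ k₂ i K = K) (j : Fin (m + p))
    {q : ℝ × ℝ} (hq : q ∈ triangle) {r : ℝ} (hr : 0 ≤ r) (hqr : S.path i j q r ∈ triangle) :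
    K j (S.path i j q r) - K j q
      = dir m i j * ∫ s in (0 : ℝ)..r, S.rowSource K j (S.path i j q s) := by
  obtain ⟨C, hC⟩ := hKb
  obtain ⟨H, hH, hsrc⟩ := S.exists_rowSource_bound
  have hcp : Continuous fun s => S.path i j q s :=
    (S.continuous_path i j).comp (continuous_const.prodMk continuous_id)
  have hint : ∀ a b, IntervalIntegrable (fun s => S.rowSource K j (S.path i j q s)) volume a b :=
    fun a b => ((S.measurable_rowSource hK j).comp hcp.measurable).intervalIntegrable_of_bound
      (fun s => hsrc _ j _ _ fun k => hC k _) _ _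
  have h1 : K j q = S.rowMap k₁ k₂ i K j q := by rw [hfix]
  have h2 : K j (S.path i j q r) = S.rowMap k₁ k₂ i K j (S.path i j q r) := by rw [hfix]
  rw [h1, h2, rowMap, indicator_of_mem hq, indicator_of_mem hqr, S.exitTime_path i j hq hr hqr]
  simp only [path_path]
  rw [intervalIntegral.integral_comp_add_left (fun s => S.rowSource K j (S.path i j q s)) r,
    add_sub_cancel, add_zero, ← intervalIntegral.integral_add_adjacent_intervals (hint 0 r)
      (hint r (S.exitTime i j q))]
  ring

theorem arc_eq_position (S : HypSystem m p) {i : Fin (m + p)} {a b : ℝ} {X : ℝ → ℝ}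
    (hX : ∀ s ∈ Icc a b, HasDerivWithinAt X (S.lam i (X s)) (Icc a b) s)
    (hm : ∀ s ∈ Icc a b, X s ∈ Icc (0 : ℝ) 1) {s t : ℝ} (hs : s ∈ Icc a b) (ht : t ∈ Icc a b) :
    S.position i (S.travel i (X t) + (s - t)) = X s := by
  have h1 := S.travel_eq_add hX hm hs
  have h2 := S.travel_eq_add hX hm ht
  have : S.travel i (X t) + (s - t) = S.travel i (X s) := by linarith
  rw [this, position_travel]

/-- Travel times show that an arbitrary arc is a time translate of the standard path, so the
identity along paths applies. According to the sign of `dir`, the path is followed from the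
beginning of the arc or backwards from its end. -/
theorem rowMap_fixed_equation (S : HypSystem m p) {k₁ k₂ : Fin (m + p) → Fin (m + p) → ℝ → ℝ}
    {i : Fin (m + p)} {K : Fin (m + p) → ℝ × ℝ → ℝ} (hK : ∀ j, Measurable (K j))
    (hKb : ∃ C, ∀ j q, |K j q| ≤ C) (hfix : S.rowMap k₁ k₂ i K = K) {j : Fin (m + p)}
    {a b : ℝ} {X Y : ℝ → ℝ} (h : S.IsCharArc i j a b X Y) :
    K j (X b, Y b) - K j (X a, Y a) = ∫ s in a..b, S.rowSource K j (X s, Y s) := by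
  have hm := fun s hs => (h.mem s hs).1
  have hmX := fun s hs => fst_mem_of_mem_triangle (hm s hs)
  have hmY := fun s hs => snd_mem_of_mem_triangle (hm s hs)
  have hab := h.le
  rcases dir_eq i j with hd | hd
  · have hp : ∀ r ∈ Icc 0 (b - a), S.path i j (X a, Y a) r = (X (a + r), Y (a + r)) :=
      fun r hr => by
      have ha : a ∈ Icc a b := ⟨le_rfl, hab⟩
      have har : a + r ∈ Icc a b := ⟨by linarith [hr.1], by linarith [hr.2]⟩
      rw [path, hd, ← S.arc_eq_position h.derivX hmX har ha,
        ← S.arc_eq_position h.derivY hmY har ha]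
      simp
    have hba : b - a ∈ Icc 0 (b - a) := ⟨by linarith, le_rfl⟩
    have key := S.rowMap_fixed_path hK hKb hfix j (hm a ⟨le_rfl, hab⟩) hba.1 (by
      rw [hp _ hba, add_sub_cancel]; exact hm b ⟨hab, le_rfl⟩)
    rw [hp _ hba, add_sub_cancel, hd, one_mul] at key
    rw [key]
    rw [intervalIntegral.integral_congr (g := fun r => S.rowSource K j (X (a + r), Y (a + r)))]
    · rw [intervalIntegral.integral_comp_add_left (fun s => S.rowSource K j (X s, Y s)) a]
      simp
    · intro r hr
      rw [uIcc_of_le hba.1] at hr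
      simp only [hp r hr]
  · have hp : ∀ r ∈ Icc 0 (b - a), S.path i j (X b, Y b) r = (X (b - r), Y (b - r)) :=
      fun r hr => by
      have hb : b ∈ Icc a b := ⟨hab, le_rfl⟩
      have hbr : b - r ∈ Icc a b := ⟨by linarith [hr.2], by linarith [hr.1]⟩
      rw [path, hd, ← S.arc_eq_position h.derivX hmX hbr hb,
        ← S.arc_eq_position h.derivY hmY hbr hb]
      simp
    have hba : b - a ∈ Icc 0 (b - a) := ⟨by linarith, le_rfl⟩
    have key := S.rowMap_fixed_path hK hKb hfix j (hm b ⟨hab, le_rfl⟩) hba.1 (by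
      rw [hp _ hba, sub_sub_cancel]; exact hm a ⟨le_rfl, hab⟩)
    rw [hp _ hba, sub_sub_cancel, hd] at key
    rw [intervalIntegral.integral_congr (g := fun r => S.rowSource K j (X (b - r), Y (b - r)))]
      at key
    · rw [intervalIntegral.integral_comp_sub_left (fun s => S.rowSource K j (X s, Y s)) b] at key
      simp only [sub_sub_cancel, sub_zero] at key
      linarith
    · intro r hr
      rw [uIcc_of_le hba.1] at hr
      simp only [hp r hr]

theorem rowMap_fixed_data (S : HypSystem m p) {k₁ k₂ : Fin (m + p) → Fin (m + p) → ℝ → ℝ}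
    {i : Fin (m + p)} {K : Fin (m + p) → ℝ × ℝ → ℝ} (hfix : S.rowMap k₁ k₂ i K = K)
    {j : Fin (m + p)} {q : ℝ × ℝ} (hq : q ∈ triangle) (h : S.exitTime i j q = 0) :
    K j q = S.rowData k₁ k₂ i K j q := by
  have h1 : K j q = S.rowMap k₁ k₂ i K j q := by rw [hfix]
  rw [h1, rowMap, indicator_of_mem hq, h]
  simp [path_zero]

theorem slow_of_neg {i j : Fin m} (h : i ≤ j) :
    Slow m (Fin.castAdd p i) (Fin.castAdd p j) := by
  exact Or.inl ⟨i.2, h⟩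

theorem not_slow_of_neg {i j : Fin m} (h : j < i) :
    ¬ Slow m (Fin.castAdd p i) (Fin.castAdd p j) := by
  simp only [Slow, not_or, not_and, not_le]
  exact ⟨fun _ => h, fun h => absurd i.2 (not_lt.2 h)⟩

theorem slow_of_pos {i j : Fin p} (h : j ≤ i) :
    Slow m (Fin.natAdd m i) (Fin.natAdd m j) := by
  exact Or.inr ⟨Nat.le_add_right _ _, Nat.add_le_add_left (Fin.le_def.1 h) _⟩

theorem not_slow_of_pos {i j : Fin p} (h : i < j) :
    ¬ Slow m (Fin.natAdd m i) (Fin.natAdd m j) := by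
  simp only [Slow, not_or, not_and, not_le]
  exact ⟨fun h => absurd h (not_lt.2 (Nat.le_add_right _ _)),
    fun _ => Nat.add_lt_add_left (Fin.lt_def.1 h) _⟩

/-- The rows of a kernel do not interact, so one fixed point is taken for each row. The boundary
conditions are read off at points of exit time zero. -/
theorem exists_isKernel (S : HypSystem m p) {k₁ k₂ : Fin (m + p) → Fin (m + p) → ℝ → ℝ}
    (hk₁ : ∀ i j, ContinuousOn (k₁ i j) (Icc 0 1)) (hk₂ : ∀ i j, ContinuousOn (k₂ i j) (Icc 0 1)) :
    ∃ K, S.IsKernel k₁ k₂ K := by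
  choose K hK hKb hfix using S.exists_rowMap_fixed hk₁ hk₂
  refine ⟨K, fun i j => (hK i j).comp measurable_subtype_coe, ?_, ?_, ?_, ?_, ?_, ?_, ?_⟩
  · choose C hC using hKb
    refine ⟨∑ i, |C i|, fun i j q _ => (hC i j q).trans ((le_abs_self _).trans ?_)⟩
    exact Finset.single_le_sum (fun i _ => abs_nonneg (C i)) (Finset.mem_univ i)
  · intro i j a b X Y h
    rw [S.rowMap_fixed_equation (hK i) (hKb i) (hfix i) h]
    refine intervalIntegral.integral_congr fun s hs => ?_
    rw [uIcc_of_le h.le] at hs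
    have := snd_mem_of_mem_triangle (h.mem s hs).1
    simp only [rowSource, S.coup_of_mem _ _ this, S.speedDeriv_of_mem _ this]
  · intro i j hij x hx
    have hx' : x ∈ Icc (0 : ℝ) 1 := ⟨hx.1.le, hx.2⟩
    rw [S.rowMap_fixed_data (hfix i) ⟨hx'.1, le_rfl, hx.2⟩ (S.exitTime_diagonal hij hx'), rowData,
      if_pos ⟨rfl, hij⟩, S.coup_of_mem _ _ hx', S.speed_of_mem _ hx', S.speed_of_mem _ hx']
  · intro i j hij x hx
    have hx' : x ∈ Icc (0 : ℝ) 1 := ⟨hx.1.le, hx.2⟩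
    have h0 : (0 : ℝ) ∈ Icc (0 : ℝ) 1 := ⟨le_rfl, zero_le_one⟩
    rw [S.rowMap_fixed_data (hfix _) ⟨le_rfl, hx'.1, hx.2⟩ (S.exitTime_bottom (slow_of_neg hij)
      (by rw [sgn_castAdd, sgn_castAdd]) hx'), rowData,
      if_neg (fun h => hx.1.ne' h.1), if_neg (not_not.2 (slow_of_neg hij)), if_pos rfl,
      dif_pos (by simp)]
    simp only [S.speed_of_mem _ h0]
    rfl
  · intro i j hij ξ hξ
    have hξ' : ξ ∈ Icc (0 : ℝ) 1 := ⟨hξ.1, hξ.2.le⟩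
    rw [S.rowMap_fixed_data (hfix _) ⟨hξ'.1, hξ'.2, le_rfl⟩
      (S.exitTime_right (not_slow_of_neg hij) hξ'), rowData, if_neg (fun h => hξ.2.ne' h.1),
      if_pos (not_slow_of_neg hij), unitClamp_of_mem hξ']
  · intro i j hij ξ hξ
    have hξ' : ξ ∈ Icc (0 : ℝ) 1 := ⟨hξ.1, hξ.2.le⟩
    rw [S.rowMap_fixed_data (hfix _) ⟨hξ'.1, hξ'.2, le_rfl⟩
      (S.exitTime_right (not_slow_of_pos hij) hξ'), rowData, if_neg (fun h => hξ.2.ne' h.1),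
      if_pos (not_slow_of_pos hij), unitClamp_of_mem hξ']
  · intro i j hij x hx
    have hx' : x ∈ Icc (0 : ℝ) 1 := ⟨hx.1.le, hx.2⟩
    rw [S.rowMap_fixed_data (hfix _) ⟨le_rfl, hx'.1, hx.2⟩ (S.exitTime_bottom (slow_of_pos hij)
      (by rw [sgn_natAdd, sgn_natAdd]) hx'), rowData,
      if_neg (fun h => hx.1.ne' h.1), if_neg (not_not.2 (slow_of_pos hij)), if_pos rfl,
      dif_neg (by simp), unitClamp_of_mem hx']

end HypSystem
end
-- A Leibniz rule without continuity in the second variable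
noncomputable section

theorem Measurable.intervalIntegral_prod {f : ℝ → ℝ → ℝ} {e₁ e₂ : ℝ → ℝ}
    (hf : Measurable (Function.uncurry f)) (h₁ : Measurable e₁) (h₂ : Measurable e₂) :
    Measurable fun u => ∫ c in e₁ u..e₂ u, f u c := by
  have key : ∀ {e₁ e₂ : ℝ → ℝ}, Measurable e₁ → Measurable e₂ →
      Measurable fun u => ∫ c in Ioc (e₁ u) (e₂ u), f u c := fun {e₁ e₂} h₁ h₂ => by
    have : (fun u => ∫ c in Ioc (e₁ u) (e₂ u), f u c) = fun u =>
        ∫ c, ({z : ℝ × ℝ | e₁ z.1 < z.2 ∧ z.2 ≤ e₂ z.1}.indicator (Function.uncurry f)) (u, c) := by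
      ext u
      rw [← integral_indicator measurableSet_Ioc]
      rfl
    rw [this]
    refine (StronglyMeasurable.integral_prod_right' (Measurable.stronglyMeasurable ?_)).measurable
    exact hf.indicator ((measurableSet_lt (h₁.comp measurable_fst) measurable_snd).inter
      (measurableSet_le measurable_snd (h₂.comp measurable_fst)))
  simp only [intervalIntegral]
  exact (key h₁ h₂).sub (key h₂ h₁)

theorem abs_intervalIntegral_le {f : ℝ → ℝ} {a b C : ℝ} (h : ∀ x ∈ uIoc a b, |f x| ≤ C) :
    |∫ x in a..b, f x| ≤ C * |b - a| := by
  simpa only [Real.norm_eq_abs] using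
    intervalIntegral.norm_integral_le_of_norm_le_const (f := f) (C := C) h

/-- The error of the Leibniz rule for a receding upper limit is quadratic. -/
theorem leibniz_error_of_nonneg {P r : ℝ → ℝ → ℝ} {e e' : ℝ → ℝ} {μ u v C L : ℝ} (huv : u ≤ v)
    (he : ∀ t, HasDerivAt e (e' t) t) (hec : Continuous e') (heL : ∀ t, |e' t| ≤ L)
    (he0 : ∀ t, 0 ≤ e' t) (hμ : ∀ t ∈ Icc u v, μ ≤ e t)
    (hP : Measurable (Function.uncurry P)) (hr : Measurable (Function.uncurry r))
    (hPC : ∀ t c, |P t c| ≤ C) (hrC : ∀ t c, |r t c| ≤ C)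
    (harc : ∀ c s t, u ≤ s → s ≤ t → t ≤ v → (∀ τ ∈ Icc s t, μ ≤ c ∧ c ≤ e τ) →
      P t c - P s c = ∫ τ in s..t, r τ c) :
    |(∫ c in μ..e v, P v c) - (∫ c in μ..e u, P u c)
      - ∫ t in u..v, ((∫ c in μ..e t, r t c) + e' t * P t (e t))| ≤ 2 * C * L * (v - u) ^ 2 := by
  have hmono : Monotone e := monotone_of_hasDerivAt_nonneg he he0
  have hC : 0 ≤ C := (abs_nonneg _).trans (hPC 0 0)
  have hL : 0 ≤ L := (abs_nonneg _).trans (heL 0)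
  have hem : Measurable e := (continuous_iff_continuousAt.2 fun t => (he t).continuousAt).measurable
  have hlip : ∀ s ∈ Icc u v, |e s - e u| ≤ L * (v - u) := fun s hs => by
    have := Convex.norm_image_sub_le_of_norm_hasDerivWithin_le (f := e) (f' := e') (s := univ)
      (x := u) (y := s) (fun t _ => (he t).hasDerivWithinAt) (fun t _ => heL t) convex_univ
      (mem_univ _) (mem_univ _)
    rw [Real.norm_eq_abs, Real.norm_eq_abs, abs_of_nonneg (sub_nonneg.2 hs.1)] at this
    exact this.trans (mul_le_mul_of_nonneg_left (by linarith [hs.2]) hL)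
  have iP : ∀ t a b, IntervalIntegrable (P t) volume a b := fun t a b =>
    (hP.comp measurable_prodMk_left).intervalIntegrable_of_bound (hPC t) a b
  have ir : ∀ t a b, IntervalIntegrable (r t) volume a b := fun t a b =>
    (hr.comp measurable_prodMk_left).intervalIntegrable_of_bound (hrC t) a b
  have iPe : ∀ t, IntervalIntegrable (fun s => e' s * P t (e s)) volume u v := fun t =>
    ((hec.measurable.mul (hP.comp (measurable_const.prodMk hem)))).intervalIntegrable_of_bound
      (C := L * C) (fun s => by
        show |e' s * P t (e s)| ≤ L * C
        rw [abs_mul]; exact mul_le_mul (heL s) (hPC _ _) (abs_nonneg _) hL) _ _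
  have iPd : IntervalIntegrable (fun s => e' s * P s (e s)) volume u v :=
    ((hec.measurable.mul (hP.comp (measurable_id.prodMk hem)))).intervalIntegrable_of_bound
      (C := L * C) (fun s => by
        show |e' s * P s (e s)| ≤ L * C
        rw [abs_mul]; exact mul_le_mul (heL s) (hPC _ _) (abs_nonneg _) hL) _ _
  have hint : ∀ b, Measurable fun t => ∫ c in μ..b, r t c := fun b =>
    hr.intervalIntegral_prod measurable_const measurable_const
  have hinte : Measurable fun t => ∫ c in μ..e t, r t c :=
    hr.intervalIntegral_prod measurable_const hem
  have iI : IntervalIntegrable (fun t => ∫ c in μ..e u, r t c) volume u v :=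
    (hint _).intervalIntegrable_of_bound (fun t => abs_intervalIntegral_le fun c _ => hrC t c) _ _
  have iD : IntervalIntegrable (fun t => ∫ c in e u..e t, r t c) volume u v := by
    rw [intervalIntegrable_iff]
    refine Measure.integrableOn_of_bounded (M := C * (L * (v - u))) (by simp)
      (hr.intervalIntegral_prod measurable_const hem).aestronglyMeasurable ?_
    refine (ae_restrict_mem measurableSet_uIoc).mono fun t ht => ?_
    rw [uIoc_of_le huv] at ht
    refine (abs_intervalIntegral_le fun c _ => hrC t c).trans ?_
    exact mul_le_mul_of_nonneg_left (hlip t ⟨ht.1.le, ht.2⟩) hC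
  have h1 : (∫ c in μ..e v, P v c) = (∫ c in μ..e u, P v c) + ∫ c in e u..e v, P v c :=
    (intervalIntegral.integral_add_adjacent_intervals (iP _ _ _) (iP _ _ _)).symm
  -- Since `e` is increasing, a line `c = const` below `e u` stays within the limits throughout
  -- `[u,v]`. The arc identity holds on all of it, and Fubini exchanges the integrals.
  have h2 : (∫ c in μ..e u, P v c) - (∫ c in μ..e u, P u c)
      = ∫ t in u..v, ∫ c in μ..e u, r t c := by
    rw [← intervalIntegral.integral_sub (iP _ _ _) (iP _ _ _)]
    have hsw := intervalIntegral_intervalIntegral_swap (F := r) (a := u) (b := v) (c := μ)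
      (d := e u) (by
        refine Measure.integrableOn_of_bounded (M := C) ?_ hr.aestronglyMeasurable
          (Filter.Eventually.of_forall fun z => hrC _ _)
        rw [Measure.volume_eq_prod, Measure.prod_prod]
        exact (ENNReal.mul_lt_top (by simp) (by simp)).ne)
    rw [hsw]
    refine intervalIntegral.integral_congr fun c hc => ?_
    rw [uIcc_of_le (hμ u ⟨le_rfl, huv⟩)] at hc
    exact harc c u v le_rfl huv le_rfl fun τ hτ => ⟨hc.1, hc.2.trans (hmono hτ.1)⟩
  -- On the newly covered strip the substitution `c = e t` expresses the integral through values on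
  -- the moving boundary, still taken at the final time `v`.
  have h3 : (∫ c in e u..e v, P v c) = ∫ t in u..v, e' t * P v (e t) := by
    rw [← intervalIntegral.integral_comp_mul_deriv_of_deriv_nonneg (f := e) (f' := e')
      (fun t _ => (he t).continuousAt.continuousWithinAt) (fun t _ => he t) (fun t _ => he0 t)]
    exact intervalIntegral.integral_congr fun t _ => mul_comm _ _
  have h4 : (∫ t in u..v, ((∫ c in μ..e t, r t c) + e' t * P t (e t)))
      = (∫ t in u..v, ∫ c in μ..e u, r t c) + (∫ t in u..v, ∫ c in e u..e t, r t c)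
        + ∫ t in u..v, e' t * P t (e t) := by
    rw [← intervalIntegral.integral_add iI iD, ← intervalIntegral.integral_add (iI.add iD) iPd]
    refine intervalIntegral.integral_congr fun t _ => ?_
    rw [intervalIntegral.integral_add_adjacent_intervals (ir _ _ _) (ir _ _ _)]
  -- Two errors remain: boundary values taken at time `v` instead of `t`, and the part of the double
  -- integral beyond `e u`. Each is a length `O(v - u)` times a quantity `O(v - u)`.
  have h5 : (∫ c in μ..e v, P v c) - (∫ c in μ..e u, P u c)
      - ∫ t in u..v, ((∫ c in μ..e t, r t c) + e' t * P t (e t))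
      = (∫ t in u..v, (e' t * P v (e t) - e' t * P t (e t)))
        - ∫ t in u..v, ∫ c in e u..e t, r t c := by
    rw [h4, h1, h3, intervalIntegral.integral_sub (iPe _) iPd]
    linarith
  rw [h5]
  have h6 : |∫ t in u..v, (e' t * P v (e t) - e' t * P t (e t))| ≤ L * (C * (v - u)) * |v - u| := by
    refine abs_intervalIntegral_le fun t ht => ?_
    rw [uIoc_of_le huv] at ht
    rw [← mul_sub, abs_mul]
    refine mul_le_mul (heL t) ?_ (abs_nonneg _) hL
    rw [harc (e t) t v ht.1.le ht.2 le_rfl fun τ hτ => ⟨hμ t ⟨ht.1.le, ht.2⟩, hmono hτ.1⟩]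
    refine (abs_intervalIntegral_le fun s _ => hrC s _).trans ?_
    rw [abs_of_nonneg (by linarith [ht.2])]
    exact mul_le_mul_of_nonneg_left (by linarith [ht.1]) hC
  have h7 : |∫ t in u..v, ∫ c in e u..e t, r t c| ≤ C * (L * (v - u)) * |v - u| := by
    refine abs_intervalIntegral_le fun t ht => ?_
    rw [uIoc_of_le huv] at ht
    refine (abs_intervalIntegral_le fun c _ => hrC t c).trans ?_
    exact mul_le_mul_of_nonneg_left (hlip t ⟨ht.1.le, ht.2⟩) hC
  rw [abs_of_nonneg (sub_nonneg.2 huv)] at h6 h7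
  refine (abs_sub _ _).trans ((add_le_add h6 h7).trans (le_of_eq (by ring)))

/-- A decreasing limit becomes an increasing one under the reversal `t ↦ -t`, which replaces `r` by
`-r`. -/
theorem leibniz_error {P r : ℝ → ℝ → ℝ} {e e' : ℝ → ℝ} {μ u v C L : ℝ} (huv : u ≤ v)
    (he : ∀ t, HasDerivAt e (e' t) t) (hec : Continuous e') (heL : ∀ t, |e' t| ≤ L)
    (he0 : (∀ t, 0 ≤ e' t) ∨ ∀ t, e' t ≤ 0) (hμ : ∀ t ∈ Icc u v, μ ≤ e t)
    (hP : Measurable (Function.uncurry P)) (hr : Measurable (Function.uncurry r))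
    (hPC : ∀ t c, |P t c| ≤ C) (hrC : ∀ t c, |r t c| ≤ C)
    (harc : ∀ c s t, u ≤ s → s ≤ t → t ≤ v → (∀ τ ∈ Icc s t, μ ≤ c ∧ c ≤ e τ) →
      P t c - P s c = ∫ τ in s..t, r τ c) :
    |(∫ c in μ..e v, P v c) - (∫ c in μ..e u, P u c)
      - ∫ t in u..v, ((∫ c in μ..e t, r t c) + e' t * P t (e t))| ≤ 2 * C * L * (v - u) ^ 2 := by
  rcases he0 with he0 | he0
  · exact leibniz_error_of_nonneg huv he hec heL he0 hμ hP hr hPC hrC harc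
  have hn : Measurable fun z : ℝ × ℝ => (-z.1, z.2) := measurable_fst.neg.prodMk measurable_snd
  have := leibniz_error_of_nonneg (P := fun t c => P (-t) c) (r := fun t c => -r (-t) c)
    (e := fun t => e (-t)) (e' := fun t => -e' (-t)) (μ := μ) (C := C) (L := L)
    (neg_le_neg huv) (fun t => by
      have := (he (-t)).scomp t (hasDerivAt_neg t)
      exact this.congr_deriv (by simp))
    (hec.comp continuous_neg).neg (fun t => by rw [abs_neg]; exact heL _)
    (fun t => neg_nonneg.2 (he0 _))
    (fun t ht => hμ _ ⟨by linarith [ht.2], by linarith [ht.1]⟩)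
    (hP.comp hn) (hr.comp hn).neg (fun t c => hPC _ _) (fun t c => by rw [abs_neg]; exact hrC _ _)
    (fun c s t hs hst ht hc => by
      have := harc c (-t) (-s) (by linarith) (by linarith) (by linarith) fun τ hτ => by
        have := hc (-τ) ⟨by linarith [hτ.2], by linarith [hτ.1]⟩
        rwa [neg_neg] at this
      rw [intervalIntegral.integral_neg, intervalIntegral.integral_comp_neg (fun τ => r τ c),
        ← this]
      ring)
  simp only [neg_neg, intervalIntegral.integral_neg] at this
  have h2 : (∫ t in -v..-u, (-(∫ c in μ..e (-t), r (-t) c) + -e' (-t) * P (-t) (e (-t))))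
      = -∫ t in u..v, ((∫ c in μ..e t, r t c) + e' t * P t (e t)) := by
    have h3 := intervalIntegral.integral_comp_neg (a := -v) (b := -u)
      (fun t => (∫ c in μ..e t, r t c) + e' t * P t (e t))
    rw [neg_neg, neg_neg] at h3
    rw [← h3, ← intervalIntegral.integral_neg]
    exact intervalIntegral.integral_congr fun t _ => by ring
  rw [h2] at this
  have e1 : (-u - -v) ^ 2 = (v - u) ^ 2 := by ring
  rw [e1] at this
  rw [← abs_neg]
  refine le_trans (le_of_eq ?_) this
  congr 1
  ring

/-- A function whose increments are locally quadratically small is constant. -/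
theorem eq_of_quadratic_increment {f : ℝ → ℝ} {α β : ℝ}
    (h : ∀ x ∈ Icc α β, ∃ C, ∃ U ∈ nhds x, ∀ u ∈ U ∩ Icc α β, ∀ v ∈ U ∩ Icc α β, u ≤ v →
      |f v - f u| ≤ C * (v - u) ^ 2) {x y : ℝ} (hx : x ∈ Icc α β) (hy : y ∈ Icc α β) :
    f x = f y := by
  have hd : ∀ x ∈ Icc α β, HasDerivWithinAt f 0 (Icc α β) x := fun x hx => by
    obtain ⟨C, U, hU, hC⟩ := h x hx
    rw [hasDerivWithinAt_iff_isLittleO]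
    have h1 : (fun y => f y - f x - (y - x) • (0 : ℝ)) =O[nhdsWithin x (Icc α β)]
        fun y => (y - x) ^ 2 := by
      refine Asymptotics.IsBigO.of_bound C ?_
      filter_upwards [nhdsWithin_le_nhds hU, self_mem_nhdsWithin] with y hyU hy
      simp only [smul_zero, sub_zero, Real.norm_eq_abs, abs_pow, sq_abs]
      rcases le_total x y with hxy | hxy
      · exact hC x ⟨mem_of_mem_nhds hU, hx⟩ y ⟨hyU, hy⟩ hxy
      · rw [abs_sub_comm, ← neg_sub x y, neg_sq]
        exact hC y ⟨hyU, hy⟩ x ⟨mem_of_mem_nhds hU, hx⟩ hxy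
    refine h1.trans_isLittleO ?_
    have : (fun y => y - x) =o[nhdsWithin x (Icc α β)] fun _ => (1 : ℝ) := by
      rw [Asymptotics.isLittleO_one_iff]
      have : Filter.Tendsto (fun y => y - x) (nhds x) (nhds (x - x)) :=
        (continuous_id.sub continuous_const).continuousAt
      rw [sub_self] at this
      exact this.mono_left nhdsWithin_le_nhds
    have := this.mul_isBigO (Asymptotics.isBigO_refl (fun y => y - x) _)
    simpa [sq] using this
  have key := constant_of_has_deriv_right_zero (fun t ht => (hd t ht).continuousWithinAt)
    (fun t ht => ((hd t ⟨ht.1, ht.2.le⟩).mono_of_mem_nhdsWithin (Icc_mem_nhdsGE_of_mem ht)))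
  rw [key x hx, key y hy]

/-- Near each time a constant `μ` separates the two limits, and the integral is split there. Both
parts obey the formula up to a quadratic error, so the difference of the two sides has quadratically
small increments and is constant. -/
theorem leibniz_of_lt {P r : ℝ → ℝ → ℝ} {e₁ e₂ e₁' e₂' : ℝ → ℝ} {α β C L : ℝ}
    (he₁ : ∀ t, HasDerivAt e₁ (e₁' t) t) (hec₁ : Continuous e₁') (heL₁ : ∀ t, |e₁' t| ≤ L)
    (hes₁ : (∀ t, 0 ≤ e₁' t) ∨ ∀ t, e₁' t ≤ 0)
    (he₂ : ∀ t, HasDerivAt e₂ (e₂' t) t) (hec₂ : Continuous e₂') (heL₂ : ∀ t, |e₂' t| ≤ L)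
    (hes₂ : (∀ t, 0 ≤ e₂' t) ∨ ∀ t, e₂' t ≤ 0)
    (hlt : ∀ t ∈ Icc α β, e₁ t < e₂ t)
    (hP : Measurable (Function.uncurry P)) (hr : Measurable (Function.uncurry r))
    (hPC : ∀ t c, |P t c| ≤ C) (hrC : ∀ t c, |r t c| ≤ C)
    (harc : ∀ c s t, α ≤ s → s ≤ t → t ≤ β → (∀ τ ∈ Icc s t, e₁ τ ≤ c ∧ c ≤ e₂ τ) →
      P t c - P s c = ∫ τ in s..t, r τ c) {u v : ℝ} (hu : u ∈ Icc α β) (hv : v ∈ Icc α β) :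
    (∫ c in e₁ v..e₂ v, P v c) - (∫ c in e₁ u..e₂ u, P u c)
      = ∫ t in u..v, ((∫ c in e₁ t..e₂ t, r t c) + e₂' t * P t (e₂ t) - e₁' t * P t (e₁ t)) := by
  have hL : 0 ≤ L := (abs_nonneg _).trans (heL₁ 0)
  have hC : 0 ≤ C := (abs_nonneg _).trans (hPC 0 0)
  have c1 : Continuous e₁ := continuous_iff_continuousAt.2 fun t => (he₁ t).continuousAt
  have c2 : Continuous e₂ := continuous_iff_continuousAt.2 fun t => (he₂ t).continuousAt
  set R : ℝ → ℝ := fun t => (∫ c in e₁ t..e₂ t, r t c) + e₂' t * P t (e₂ t) - e₁' t * P t (e₁ t)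
    with hR
  have iP : ∀ t a b, IntervalIntegrable (P t) volume a b := fun t a b =>
    (hP.comp measurable_prodMk_left).intervalIntegrable_of_bound (hPC t) a b
  have ir : ∀ t a b, IntervalIntegrable (r t) volume a b := fun t a b =>
    (hr.comp measurable_prodMk_left).intervalIntegrable_of_bound (hrC t) a b
  have m2 : ∀ {e e' : ℝ → ℝ}, Continuous e → Continuous e' →
      Measurable fun t => e' t * P t (e t) := fun h h' =>
    h'.measurable.mul (hP.comp (measurable_id.prodMk h.measurable))
  have b2 : ∀ {e e' : ℝ → ℝ}, (∀ t, |e' t| ≤ L) → ∀ t, |e' t * P t (e t)| ≤ L * C := fun h t => by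
    rw [abs_mul]; exact mul_le_mul (h t) (hPC _ _) (abs_nonneg _) hL
  have i2 : ∀ {e e' : ℝ → ℝ}, Continuous e → Continuous e' → (∀ t, |e' t| ≤ L) → ∀ a b,
      IntervalIntegrable (fun t => e' t * P t (e t)) volume a b := fun h h' hl a b =>
    (m2 h h').intervalIntegrable_of_bound (b2 hl) a b
  have i1 : ∀ {a b : ℝ → ℝ}, Continuous a → Continuous b → ∀ x y,
      IntervalIntegrable (fun t => ∫ c in a t..b t, r t c) volume x y := fun {a b} ha hb x y => by
    obtain ⟨B, hB⟩ := isCompact_uIcc.exists_bound_of_continuousOn (s := uIcc x y)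
      (hb.sub ha).continuousOn
    rw [intervalIntegrable_iff]
    refine Measure.integrableOn_of_bounded (M := C * B) (by simp)
      (hr.intervalIntegral_prod ha.measurable hb.measurable).aestronglyMeasurable ?_
    refine (ae_restrict_mem measurableSet_uIoc).mono fun t ht => ?_
    refine (abs_intervalIntegral_le fun c _ => hrC t c).trans ?_
    exact mul_le_mul_of_nonneg_left (hB t (uIoc_subset_uIcc ht)) hC
  have iR : ∀ a b, IntervalIntegrable R volume a b := fun a b =>
    ((i1 c1 c2 a b).add (i2 c2 hec₂ heL₂ a b)).sub (i2 c1 hec₁ heL₁ a b)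
  have key := eq_of_quadratic_increment (α := α) (β := β)
    (f := fun t => (∫ c in e₁ t..e₂ t, P t c) - ∫ s in u..t, R s) (fun x hx => by
      set μ := (e₁ x + e₂ x) / 2 with hμ
      have hx' := hlt x hx
      have hU : {t | e₁ t < μ ∧ μ < e₂ t} ∈ nhds x := by
        refine IsOpen.mem_nhds ?_ ⟨by linarith, by linarith⟩
        exact (isOpen_lt c1 continuous_const).inter (isOpen_lt continuous_const c2)
      obtain ⟨δ, hδ, hball⟩ := Metric.mem_nhds_iff.1 hU
      refine ⟨2 * C * L + 2 * C * L, Metric.ball x δ, Metric.ball_mem_nhds x hδ, ?_⟩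
      rintro s ⟨hsU, hs⟩ t ⟨htU, ht⟩ hst
      have hconv : Icc s t ⊆ Metric.ball x δ := (convex_ball x δ).ordConnected.out hsU htU
      have hin : ∀ τ ∈ Icc s t, e₁ τ < μ ∧ μ < e₂ τ := fun τ hτ => hball (hconv hτ)
      have hn : Measurable fun z : ℝ × ℝ => (z.1, -z.2) :=
        measurable_fst.prodMk measurable_snd.neg
      have E2 := leibniz_error (μ := μ) hst he₂ hec₂ heL₂ hes₂ (fun τ hτ => (hin τ hτ).2.le)
        hP hr hPC hrC fun c a b ha hab hb hc => harc c a b (hs.1.trans ha) hab (hb.trans ht.2)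
          fun τ hτ => ⟨(hin τ ⟨ha.trans hτ.1, hτ.2.trans hb⟩).1.le.trans (hc τ hτ).1, (hc τ hτ).2⟩
      -- The lower limit is treated as an upper limit after the reflection `c ↦ -c`.
      have E1 := leibniz_error (μ := -μ) (P := fun t c => P t (-c)) (r := fun t c => r t (-c))
        (e := fun t => -e₁ t) (e' := fun t => -e₁' t) hst (fun t => (he₁ t).neg) hec₁.neg
        (fun t => by rw [abs_neg]; exact heL₁ t)
        (hes₁.symm.imp (fun h t => neg_nonneg.2 (h t)) (fun h t => neg_nonpos.2 (h t)))
        (fun τ hτ => neg_le_neg (hin τ hτ).1.le)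
        (hP.comp hn) (hr.comp hn) (fun _ _ => hPC _ _) (fun _ _ => hrC _ _)
        fun c a b ha hab hb hc => harc (-c) a b (hs.1.trans ha) hab (hb.trans ht.2)
          fun τ hτ => ⟨by linarith [(hc τ hτ).2],
            by linarith [(hc τ hτ).1, (hin τ ⟨ha.trans hτ.1, hτ.2.trans hb⟩).2]⟩
      have hPn : ∀ t a b, (∫ c in a..b, P t (-c)) = ∫ c in -b..-a, P t c := fun t a b =>
        intervalIntegral.integral_comp_neg (P t)
      have hrn : ∀ t a b, (∫ c in a..b, r t (-c)) = ∫ c in -b..-a, r t c := fun t a b =>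
        intervalIntegral.integral_comp_neg (r t)
      simp only [hPn, hrn, neg_neg] at E1
      have hsplitP : ∀ t, (∫ c in e₁ t..e₂ t, P t c)
          = (∫ c in e₁ t..μ, P t c) + ∫ c in μ..e₂ t, P t c := fun t =>
        (intervalIntegral.integral_add_adjacent_intervals (iP _ _ _) (iP _ _ _)).symm
      have hsplitR : (∫ τ in s..t, R τ)
          = (∫ τ in s..t, ((∫ c in μ..e₂ τ, r τ c) + e₂' τ * P τ (e₂ τ)))
            + ∫ τ in s..t, ((∫ c in e₁ τ..μ, r τ c) + -e₁' τ * P τ (e₁ τ)) := by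
        rw [← intervalIntegral.integral_add]
        · refine intervalIntegral.integral_congr fun τ _ => ?_
          simp only [hR]
          rw [← intervalIntegral.integral_add_adjacent_intervals (ir τ (e₁ τ) μ) (ir τ μ (e₂ τ))]
          ring
        · exact (i1 continuous_const c2 _ _).add (i2 c2 hec₂ heL₂ _ _)
        · exact (i1 c1 continuous_const _ _).add
            (i2 c1 hec₁.neg (fun t => by simpa using heL₁ t) _ _)
      have hRd : (∫ τ in u..t, R τ) - (∫ τ in u..s, R τ) = ∫ τ in s..t, R τ :=
        intervalIntegral.integral_interval_sub_left (iR _ _) (iR _ _)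
      calc _ = |((∫ c in μ..e₂ t, P t c) - (∫ c in μ..e₂ s, P s c)
            - ∫ τ in s..t, ((∫ c in μ..e₂ τ, r τ c) + e₂' τ * P τ (e₂ τ)))
          + ((∫ c in e₁ t..μ, P t c) - (∫ c in e₁ s..μ, P s c)
            - ∫ τ in s..t, ((∫ c in e₁ τ..μ, r τ c) + -e₁' τ * P τ (e₁ τ)))| := by
            congr 1
            rw [hsplitP, hsplitP]
            linarith
        _ ≤ _ := (abs_add_le _ _).trans (add_le_add E2 E1)
        _ = _ := by ring) hv hu
  simp only [intervalIntegral.integral_same, sub_zero] at key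
  linarith

/-- The Leibniz rule for a function that is absolutely continuous along one variable. -/
theorem leibniz {P r : ℝ → ℝ → ℝ} {e₁ e₂ e₁' e₂' : ℝ → ℝ} {α β C L : ℝ}
    (he₁ : ∀ t, HasDerivAt e₁ (e₁' t) t) (hec₁ : Continuous e₁') (heL₁ : ∀ t, |e₁' t| ≤ L)
    (hes₁ : (∀ t, 0 ≤ e₁' t) ∨ ∀ t, e₁' t ≤ 0)
    (he₂ : ∀ t, HasDerivAt e₂ (e₂' t) t) (hec₂ : Continuous e₂') (heL₂ : ∀ t, |e₂' t| ≤ L)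
    (hes₂ : (∀ t, 0 ≤ e₂' t) ∨ ∀ t, e₂' t ≤ 0)
    (hlt : (∀ t ∈ Icc α β, e₁ t < e₂ t) ∨ ∀ t ∈ Icc α β, e₂ t < e₁ t)
    (hP : Measurable (Function.uncurry P)) (hr : Measurable (Function.uncurry r))
    (hPC : ∀ t c, |P t c| ≤ C) (hrC : ∀ t c, |r t c| ≤ C)
    (harc : ∀ c s t, α ≤ s → s ≤ t → t ≤ β → (∀ τ ∈ Icc s t, c ∈ uIcc (e₁ τ) (e₂ τ)) →
      P t c - P s c = ∫ τ in s..t, r τ c) {u v : ℝ} (hu : u ∈ Icc α β) (hv : v ∈ Icc α β) :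
    (∫ c in e₁ v..e₂ v, P v c) - (∫ c in e₁ u..e₂ u, P u c)
      = ∫ t in u..v, ((∫ c in e₁ t..e₂ t, r t c) + e₂' t * P t (e₂ t) - e₁' t * P t (e₁ t)) := by
  rcases hlt with hlt | hlt
  · exact leibniz_of_lt he₁ hec₁ heL₁ hes₁ he₂ hec₂ heL₂ hes₂ hlt hP hr hPC hrC
      (fun c s t hs hst ht hc => harc c s t hs hst ht fun τ hτ =>
        Icc_subset_uIcc (hc τ hτ)) hu hv
  · have := leibniz_of_lt he₂ hec₂ heL₂ hes₂ he₁ hec₁ heL₁ hes₁ hlt hP hr hPC hrC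
      (fun c s t hs hst ht hc => harc c s t hs hst ht fun τ hτ =>
        Icc_subset_uIcc' (hc τ hτ)) hu hv
    rw [intervalIntegral.integral_symm, intervalIntegral.integral_symm (e₂ u), sub_neg_eq_add,
      neg_add_eq_sub, ← neg_sub, this, ← intervalIntegral.integral_neg]
    refine intervalIntegral.integral_congr fun t _ => ?_
    rw [intervalIntegral.integral_symm]
    ring

end
-- Primitives, and moments of a kernel against `C¹` functions
noncomputable section

/-- On `[a,b]` the function `f` is a primitive of the integrable function `f'`. -/
structure IsPrimitive (f f' : ℝ → ℝ) (a b : ℝ) : Prop where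
  le : a ≤ b
  integrable : IntervalIntegrable f' volume a b
  eq_add : ∀ x ∈ Icc a b, f x = f a + ∫ y in a..x, f' y

namespace IsPrimitive

variable {f f' g g' : ℝ → ℝ} {a b : ℝ}

theorem integrable_left (hf : IsPrimitive f f' a b) {x : ℝ} (hx : x ∈ Icc a b) :
    IntervalIntegrable f' volume a x :=
  hf.integrable.mono_set (uIcc_subset_uIcc left_mem_uIcc (Icc_subset_uIcc hx))

theorem integral_eq (hf : IsPrimitive f f' a b) : ∫ y in a..b, f' y = f b - f a := by
  rw [hf.eq_add b ⟨hf.le, le_rfl⟩]; ring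

theorem congr_ae (hf : IsPrimitive f f' a b) (hg : ∀ x ∈ Icc a b, g x = f x)
    (hg' : ∀ᵐ x ∂volume.restrict (Icc a b), g' x = f' x) : IsPrimitive g g' a b := by
  have h1 : f' =ᵐ[volume.restrict (uIoc a b)] g' := by
    rw [uIoc_of_le hf.le]
    exact (ae_restrict_of_ae_restrict_of_subset Ioc_subset_Icc_self hg').mono fun x hx => hx.symm
  refine ⟨hf.le, hf.integrable.congr_ae h1, fun x hx => ?_⟩
  rw [hg x hx, hg a ⟨le_rfl, hf.le⟩, hf.eq_add x hx]
  congr 1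
  refine intervalIntegral.integral_congr_ae ?_
  rw [← ae_restrict_iff' measurableSet_uIoc]
  refine ae_restrict_of_ae_restrict_of_subset ?_ h1
  rw [uIoc_of_le hx.1, uIoc_of_le hf.le]
  exact Ioc_subset_Ioc_right hx.2

theorem const_mul (hf : IsPrimitive f f' a b) (c : ℝ) :
    IsPrimitive (fun x => c * f x) (fun x => c * f' x) a b :=
  ⟨hf.le, hf.integrable.const_mul c, fun x hx => by
    rw [hf.eq_add x hx, intervalIntegral.integral_const_mul]; ring⟩

theorem add (hf : IsPrimitive f f' a b) (hg : IsPrimitive g g' a b) :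
    IsPrimitive (fun x => f x + g x) (fun x => f' x + g' x) a b :=
  ⟨hf.le, hf.integrable.add hg.integrable, fun x hx => by
    rw [hf.eq_add x hx, hg.eq_add x hx,
      intervalIntegral.integral_add (hf.integrable_left hx) (hg.integrable_left hx)]; ring⟩

theorem sub (hf : IsPrimitive f f' a b) (hg : IsPrimitive g g' a b) :
    IsPrimitive (fun x => f x - g x) (fun x => f' x - g' x) a b := by
  simpa only [neg_one_mul, ← sub_eq_add_neg] using hf.add (hg.const_mul (-1))

theorem sum {ι : Type*} (s : Finset ι) {f f' : ι → ℝ → ℝ} (hab : a ≤ b)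
    (h : ∀ i ∈ s, IsPrimitive (f i) (f' i) a b) :
    IsPrimitive (fun x => ∑ i ∈ s, f i x) (fun x => ∑ i ∈ s, f' i x) a b := by
  classical
  induction s using Finset.induction_on with
  | empty => exact ⟨hab, by simp, fun x _ => by simp⟩
  | insert i s hi ih =>
    simp only [Finset.sum_insert hi]
    exact (h i (Finset.mem_insert_self _ _)).add
      (ih fun j hj => h j (Finset.mem_insert_of_mem hj))

theorem continuousOn (hf : IsPrimitive f f' a b) : ContinuousOn f (Icc a b) := by
  have h := intervalIntegral.continuousOn_primitive_interval' hf.integrable left_mem_uIcc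
  rw [uIcc_of_le hf.le] at h
  exact (continuousOn_const.add h).congr hf.eq_add

theorem mono (hf : IsPrimitive f f' a b) {x : ℝ} (hx : x ∈ Icc a b) : IsPrimitive f f' a x :=
  ⟨hx.1, hf.integrable_left hx, fun y hy => hf.eq_add y ⟨hy.1, hy.2.trans hx.2⟩⟩

theorem of_hasDerivWithinAt (hab : a ≤ b)
    (h : ∀ x ∈ Icc a b, HasDerivWithinAt f (f' x) (Icc a b) x) (hc : ContinuousOn f' (Icc a b)) :
    IsPrimitive f f' a b := by
  have hi : IntervalIntegrable f' volume a b := (by rwa [uIcc_of_le hab] :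
    ContinuousOn f' (uIcc a b)).intervalIntegrable
  refine ⟨hab, hi, fun x hx => ?_⟩
  rw [intervalIntegral.integral_eq_sub_of_hasDerivAt_of_le hx.1
    (fun y hy => ((h y ⟨hy.1, hy.2.trans hx.2⟩).continuousWithinAt).mono
      (Icc_subset_Icc_right hx.2))
    (fun y hy => (h y ⟨hy.1.le, hy.2.le.trans hx.2⟩).hasDerivAt
      (Icc_mem_nhds hy.1 (hy.2.trans_le hx.2)))
    (hi.mono_set (uIcc_subset_uIcc left_mem_uIcc (Icc_subset_uIcc hx)))]
  ring

theorem absolutelyContinuous (hf : IntervalIntegrable f' volume a b) (c : ℝ) :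
    AbsolutelyContinuousOnInterval (fun x => c + ∫ y in a..x, f' y) a b := by
  have h1 := hf.absolutelyContinuousOnInterval_intervalIntegral (left_mem_uIcc (a := a) (b := b))
  have h2 : AbsolutelyContinuousOnInterval (fun _ : ℝ => c) a b :=
    (LipschitzWith.const c).lipschitzOnWith.absolutelyContinuousOnInterval
  exact h2.add h1

/-- Integration by parts for primitives. -/
theorem integral_mul (hf : IsPrimitive f f' a b) (hg : IsPrimitive g g' a b) :
    ∫ x in a..b, (f' x * g x + f x * g' x) = f b * g b - f a * g a := by
  have key := (absolutelyContinuous hf.integrable (f a)).integral_deriv_mul_eq_sub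
    (absolutelyContinuous hg.integrable (g a))
  rw [← hf.eq_add b ⟨hf.le, le_rfl⟩, ← hg.eq_add b ⟨hf.le, le_rfl⟩] at key
  simp only [intervalIntegral.integral_same, add_zero] at key
  rw [← key]
  refine intervalIntegral.integral_congr_ae ?_
  filter_upwards [hf.integrable.ae_hasDerivAt_integral, hg.integrable.ae_hasDerivAt_integral]
    with x hx hy hxm
  have hxm' : x ∈ uIcc a b := uIoc_subset_uIcc hxm
  have h1 := (hx hxm' a left_mem_uIcc).const_add (f a)
  have h2 := (hy hxm' a left_mem_uIcc).const_add (g a)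
  rw [uIcc_of_le hf.le] at hxm'
  rw [h1.deriv, h2.deriv, hf.eq_add x hxm', hg.eq_add x hxm']

theorem mul (hf : IsPrimitive f f' a b) (hg : IsPrimitive g g' a b) :
    IsPrimitive (fun x => f x * g x) (fun x => f' x * g x + f x * g' x) a b := by
  have hcf := hf.continuousOn
  have hcg := hg.continuousOn
  rw [← uIcc_of_le hf.le] at hcf hcg
  refine ⟨hf.le, (hf.integrable.mul_continuousOn hcg).add (hg.integrable.continuousOn_mul hcf),
    fun x hx => ?_⟩
  rw [(hf.mono hx).integral_mul (hg.mono hx)]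
  ring

end IsPrimitive

namespace HypSystem

variable {m p : ℕ}

theorem integral_travel (S : HypSystem m p) (i : Fin (m + p)) (G : ℝ → ℝ) (x y : ℝ) :
    ∫ v in S.travel i x..S.travel i y, G v
      = ∫ ξ in x..y, G (S.travel i ξ) * (S.speed i ξ)⁻¹ := by
  have hc : ContinuousOn (S.travel i) (uIcc x y) := (S.continuous_travel i).continuousOn
  rcases sgn_eq i with h | h
  · rw [← intervalIntegral.integral_comp_mul_deriv_of_deriv_nonneg hc
      (fun t _ => S.hasDerivAt_travel i t) (fun t _ => inv_nonneg.2 ?_)]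
    · rfl
    · have := S.sgn_mul_speed_pos i t
      rw [h] at this; linarith
  · rw [← intervalIntegral.integral_comp_mul_deriv_of_deriv_nonpos hc
      (fun t _ => S.hasDerivAt_travel i t) (fun t _ => inv_nonpos.2 ?_)]
    · rfl
    · have := S.sgn_mul_speed_pos i t
      rw [h] at this; linarith

theorem travel_zero (S : HypSystem m p) (i : Fin (m + p)) : S.travel i 0 = 0 :=
  (S.exists_travel i).choose_spec.choose_spec.2.2.2.2

/-- The rate of change of `∫₀ᶻ κ(z,ξ) f(ξ) dξ`, for `κ` with
`λ_i(x) ∂_x κ + λ_j(ξ) ∂_ξ κ = h`. -/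
def momentRate (S : HypSystem m p) (i j : Fin (m + p)) (κ h : ℝ × ℝ → ℝ) (f f' : ℝ → ℝ)
    (z : ℝ) : ℝ :=
  (S.speed i z)⁻¹ * ((S.speed i z - S.speed j z) * κ (z, z) * f z
    + S.speed j 0 * κ (z, 0) * f 0
    + ∫ ξ in (0 : ℝ)..z, (h (z, ξ) * f ξ
      + κ (z, ξ) * (S.speedDeriv j ξ * f ξ + S.speed j ξ * f' ξ)))

/-- In characteristic coordinates this product, taken at `t = s`, is the velocity of the diagonal.
The Leibniz rule needs it to have a constant sign, which follows from the strict ordering of the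
speeds. -/
theorem sgn_sub_speed (S : HypSystem m p) (i j : Fin (m + p)) :
    (∀ t s, 0 ≤ (S.speed j t)⁻¹ * (S.speed i s - S.speed j s))
      ∨ ∀ t s, (S.speed j t)⁻¹ * (S.speed i s - S.speed j s) ≤ 0 := by
  have hsub : (∀ s, 0 ≤ S.speed i s - S.speed j s) ∨ ∀ s, S.speed i s - S.speed j s ≤ 0 := by
    rcases le_total i j with h | h
    · exact Or.inr fun s => sub_nonpos.2 ((S.lam_strictMono _ (unitClamp_mem s)).monotone h)
    · exact Or.inl fun s => sub_nonneg.2 ((S.lam_strictMono _ (unitClamp_mem s)).monotone h)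
  have hinv : (∀ t, 0 ≤ (S.speed j t)⁻¹) ∨ ∀ t, (S.speed j t)⁻¹ ≤ 0 := by
    rcases sgn_eq j with h | h
    · exact Or.inl fun t => inv_nonneg.2 (by
        have := S.sgn_mul_speed_pos j t; rw [h] at this; linarith)
    · exact Or.inr fun t => inv_nonpos.2 (by
        have := S.sgn_mul_speed_pos j t; rw [h] at this; linarith)
  rcases hsub with h1 | h1 <;> rcases hinv with h2 | h2
  · exact Or.inl fun t s => mul_nonneg (h2 t) (h1 s)
  · exact Or.inr fun t s => mul_nonpos_of_nonpos_of_nonneg (h2 t) (h1 s)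
  · exact Or.inr fun t s => mul_nonpos_of_nonneg_of_nonpos (h2 t) (h1 s)
  · exact Or.inl fun t s => mul_nonneg_of_nonpos_of_nonpos (h2 t) (h1 s)

theorem exists_inv_speed_bound (S : HypSystem m p) :
    ∃ C : ℝ, 0 < C ∧ ∀ i x, |(S.speed i x)⁻¹| ≤ C := by
  obtain ⟨c, hc, hcl⟩ := S.exists_speed_lower
  refine ⟨c⁻¹, inv_pos.2 hc, fun i x => ?_⟩
  rw [abs_inv]
  refine inv_anti₀ hc ((hcl i x).trans ((le_abs_self _).trans ?_))
  rw [abs_mul]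
  rcases sgn_eq i with h | h <;> simp [h]

/-- Evolution of the moments of a kernel against a continuously differentiable function. -/
theorem kernel_moment_of_contDiff (S : HypSystem m p) {i j : Fin (m + p)} {κ h : ℝ × ℝ → ℝ}
    (hκ : Measurable κ) (hh : Measurable h) {C : ℝ} (hκC : ∀ q, |κ q| ≤ C) (hhC : ∀ q, |h q| ≤ C)
    (harc : ∀ a b X Y, S.IsCharArc i j a b X Y →
      κ (X b, Y b) - κ (X a, Y a) = ∫ s in a..b, h (X s, Y s))
    {f f' : ℝ → ℝ} (hf : ∀ x ∈ Icc (0 : ℝ) 1, HasDerivWithinAt f (f' x) (Icc 0 1) x)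
    (hf' : ContinuousOn f' (Icc 0 1)) {x y : ℝ} (hx : x ∈ Ioc (0 : ℝ) 1) (hy : y ∈ Ioc (0 : ℝ) 1) :
    (∫ ξ in (0 : ℝ)..y, κ (y, ξ) * f ξ) - (∫ ξ in (0 : ℝ)..x, κ (x, ξ) * f ξ)
      = ∫ z in x..y, S.momentRate i j κ h f f' z := by
  have hfc : ContinuousOn f (Icc 0 1) := fun x hx => (hf x hx).continuousWithinAt
  obtain ⟨Cs, hCs, hsp, hspd, -, -⟩ := S.exists_coeff_bound
  obtain ⟨Ci, hCi, hinv⟩ := S.exists_inv_speed_bound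
  obtain ⟨F, hF⟩ := hfc.exists_abs_le_unit
  obtain ⟨F', hF'⟩ := hf'.exists_abs_le_unit
  have hC : 0 ≤ C := (abs_nonneg _).trans (hκC 0)
  have hF0 : 0 ≤ F := (abs_nonneg _).trans (hF 0 ⟨le_rfl, zero_le_one⟩)
  have hF0' : 0 ≤ F' := (abs_nonneg _).trans (hF' 0 ⟨le_rfl, zero_le_one⟩)
  -- The factor `λ_j` is the Jacobian of `ξ` with respect to its travel time.
  set g : ℝ → ℝ := fun ξ => S.speed j ξ * f (unitClamp ξ) with hg
  set g' : ℝ → ℝ := fun ξ => S.speedDeriv j ξ * f (unitClamp ξ) + S.speed j ξ * f' (unitClamp ξ)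
    with hg'
  have hgc : Continuous g := (S.continuous_speed j).mul hfc.comp_unitClamp
  have hgc' : Continuous g' := ((S.continuous_speedDeriv j).mul hfc.comp_unitClamp).add
    ((S.continuous_speed j).mul hf'.comp_unitClamp)
  have hgd : ∀ ξ ∈ Icc (0 : ℝ) 1, HasDerivWithinAt g (g' ξ) (Icc 0 1) ξ := fun ξ hξ => by
    have h1 := (S.hasDerivWithinAt_lam j hξ).mul (hf ξ hξ)
    refine (h1.congr (fun t ht => ?_) ?_).congr_deriv ?_
    · simp only [hg, unitClamp_of_mem ht, S.speed_of_mem j ht, Pi.mul_apply]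
    · simp only [hg, unitClamp_of_mem hξ, S.speed_of_mem j hξ, Pi.mul_apply]
    · simp only [hg', unitClamp_of_mem hξ, S.speed_of_mem j hξ, S.speedDeriv_of_mem j hξ]
  have hgb : ∀ ξ, |g ξ| ≤ Cs * F := fun ξ => by
    rw [hg, abs_mul]
    exact mul_le_mul (hsp _ _) (hF _ (unitClamp_mem _)) (abs_nonneg _) hCs.le
  have hgb' : ∀ ξ, |g' ξ| ≤ Cs * F + Cs * F' := fun ξ => by
    refine (abs_add_le _ _).trans (add_le_add ?_ ?_)
    · rw [abs_mul]; exact mul_le_mul (hspd _ _) (hF _ (unitClamp_mem _)) (abs_nonneg _) hCs.le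
    · rw [abs_mul]; exact mul_le_mul (hsp _ _) (hF' _ (unitClamp_mem _)) (abs_nonneg _) hCs.le
  set Z := S.position i with hZ
  set Y := S.position j with hY
  have hZc : Continuous Z := S.continuous_position i
  have hYc : Continuous Y := S.continuous_position j
  -- Characteristic coordinates: `u` is the travel time of `x` along the family `i`, and `c` is the
  -- travel time of `ξ` along the family `j` minus `u`. Characteristics are the lines `c = const`,
  -- and `r` is the derivative of `P` along them.
  set P : ℝ → ℝ → ℝ := fun u c => κ (Z u, Y (u + c)) * g (Y (u + c)) with hP
  set r : ℝ → ℝ → ℝ := fun u c => h (Z u, Y (u + c)) * g (Y (u + c))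
    + κ (Z u, Y (u + c)) * (g' (Y (u + c)) * S.speed j (Y (u + c))) with hr
  have hsum : Measurable fun z : ℝ × ℝ => Y (z.1 + z.2) :=
    (hYc.comp (continuous_fst.add continuous_snd)).measurable
  have hq : Measurable fun z : ℝ × ℝ => (Z z.1, Y (z.1 + z.2)) :=
    (hZc.measurable.comp measurable_fst).prodMk hsum
  have hPm : Measurable (Function.uncurry P) :=
    (hκ.comp hq).mul (hgc.measurable.comp hsum)
  have hrm : Measurable (Function.uncurry r) :=
    ((hh.comp hq).mul (hgc.measurable.comp hsum)).add ((hκ.comp hq).mul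
      ((hgc'.measurable.comp hsum).mul ((S.continuous_speed j).measurable.comp hsum)))
  set B : ℝ := C * (Cs * F) + C * ((Cs * F + Cs * F') * Cs) with hB
  have hPB : ∀ u c, |P u c| ≤ B := fun u c => by
    have h1 : |P u c| ≤ C * (Cs * F) := by
      simp only [hP]; rw [abs_mul]
      exact mul_le_mul (hκC _) (hgb _) (abs_nonneg _) hC
    have h2 : 0 ≤ C * ((Cs * F + Cs * F') * Cs) := by positivity
    linarith
  have hrB : ∀ u c, |r u c| ≤ B := fun u c => by
    refine (abs_add_le _ _).trans (add_le_add ?_ ?_)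
    · rw [abs_mul]; exact mul_le_mul (hhC _) (hgb _) (abs_nonneg _) hC
    · rw [abs_mul, abs_mul]
      refine mul_le_mul (hκC _) ?_ (by positivity) hC
      exact mul_le_mul (hgb' _) (hsp _ _) (abs_nonneg _) (by positivity)
  -- The diagonal `ξ = x` becomes `c = e₂ u`, and the side `ξ = 0` becomes `c = -u`.
  set e₂ : ℝ → ℝ := fun u => S.travel j (Z u) - u with he₂
  have hd₂ : ∀ u, HasDerivAt e₂ ((S.speed j (Z u))⁻¹ * (S.speed i (Z u) - S.speed j (Z u))) u :=
    fun u => by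
    refine (((S.hasDerivAt_travel j (Z u)).comp u (S.hasDerivAt_position i u)).sub
      (hasDerivAt_id u)).congr_deriv ?_
    rw [mul_sub, inv_mul_cancel₀ (S.speed_ne_zero _ _)]
  have hc₂ : Continuous fun u => (S.speed j (Z u))⁻¹ * (S.speed i (Z u) - S.speed j (Z u)) :=
    (((S.continuous_speed j).comp hZc).inv₀ fun u => S.speed_ne_zero _ _).mul
      (((S.continuous_speed i).comp hZc).sub ((S.continuous_speed j).comp hZc))
  set α := min (S.travel i x) (S.travel i y) with hα
  set β := max (S.travel i x) (S.travel i y) with hβ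
  have hZm : ∀ u ∈ Icc α β, Z u ∈ Ioc (0 : ℝ) 1 := fun u hu => by
    have := S.position_mem_uIcc i (u := S.travel i x) (v := S.travel i y) (w := u) hu
    rw [position_travel, position_travel] at this
    exact ⟨(lt_min hx.1 hy.1).trans_le this.1, this.2.trans (max_le hx.2 hy.2)⟩
  have hchange : ∀ {z : ℝ} (φ : ℝ → ℝ), (∫ c in -(S.travel i z)..e₂ (S.travel i z),
      φ (Y (S.travel i z + c))) = ∫ ξ in (0 : ℝ)..z, φ ξ * (S.speed j ξ)⁻¹ := fun {z} φ => by
    rw [intervalIntegral.integral_comp_add_left (fun v => φ (Y v))]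
    simp only [he₂, hZ, position_travel, add_neg_cancel, add_sub_cancel]
    have := S.integral_travel j (fun v => φ (Y v)) 0 z
    rw [travel_zero] at this
    rw [this]
    simp only [hY, position_travel]
  have key := leibniz (P := P) (r := r) (e₁ := fun u => -u) (e₂ := e₂) (e₁' := fun _ => -1)
    (e₂' := fun u => (S.speed j (Z u))⁻¹ * (S.speed i (Z u) - S.speed j (Z u)))
    (α := α) (β := β) (C := B) (L := 1 + Ci * (Cs + Cs)) (fun t => hasDerivAt_neg t)
    continuous_const (fun t => by
      have : 0 ≤ Ci * (Cs + Cs) := by positivity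
      simpa using this) (Or.inr fun t => by norm_num) hd₂ hc₂
    (fun t => by
      have h1 : |(S.speed j (Z t))⁻¹ * (S.speed i (Z t) - S.speed j (Z t))| ≤ Ci * (Cs + Cs) := by
        rw [abs_mul]
        exact mul_le_mul (hinv _ _) ((abs_sub _ _).trans (add_le_add (hsp _ _) (hsp _ _)))
          (abs_nonneg _) hCi.le
      linarith)
    ((S.sgn_sub_speed i j).imp (fun h t => h _ _) fun h t => h _ _)
    (by
      -- The position of `e₂` relative to `-u` depends on the sign of `λ_j`. The two limits never
      -- meet, because `x` stays positive.
      have h0 : ∀ t ∈ Icc α β, Y 0 < Y (S.travel j (Z t)) := fun t ht => by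
        have e0 : Y 0 = 0 := by
          have := S.position_travel j 0
          rwa [travel_zero] at this
        rw [e0, hY, position_travel]
        exact (hZm t ht).1
      rcases S.strictMono_or_strictAnti_position j with hm | hm
      · left
        intro t ht
        have := hm.lt_iff_lt.1 (h0 t ht)
        simp only [he₂]; linarith
      · right
        intro t ht
        have := hm.lt_iff_gt.1 (h0 t ht)
        simp only [he₂]; linarith)
    hPm hrm hPB hrB
    (fun c s t hs hst ht hc => by
      have hmem : ∀ τ ∈ Icc s t, (Z τ, Y (τ + c)) ∈ triangle \ {((0 : ℝ), (0 : ℝ))} :=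
        fun τ hτ => by
        have hz := hZm τ ⟨hs.trans hτ.1, hτ.2.trans ht⟩
        have h1 : τ + c ∈ uIcc (S.travel j 0) (S.travel j (Z τ)) := by
          have := hc τ hτ
          rw [travel_zero]
          simp only [he₂, mem_uIcc] at this ⊢
          rcases this with h | h
          · left; constructor <;> linarith [h.1, h.2]
          · right; constructor <;> linarith [h.1, h.2]
        have h2 := S.position_mem_uIcc j h1
        rw [position_travel, position_travel, uIcc_of_le hz.1.le] at h2
        refine ⟨⟨h2.1, h2.2, hz.2⟩, fun h => ?_⟩
        have h3 : Z τ = 0 := (Prod.ext_iff.1 h).1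
        exact hz.1.ne' h3
      have hYd : ∀ τ, HasDerivAt (fun τ => Y (τ + c)) (S.speed j (Y (τ + c))) τ := fun τ => by
        have := (S.hasDerivAt_position j (τ + c)).comp τ ((hasDerivAt_id τ).add_const c)
        rw [mul_one] at this
        exact this
      have harcs : ∀ τ ∈ Icc s t, S.IsCharArc i j s τ Z fun τ => Y (τ + c) := fun τ hτ =>
        ⟨hτ.1, fun u hu => by
          have hu' : u ∈ Icc s t := ⟨hu.1, hu.2.trans hτ.2⟩
          have := (S.hasDerivAt_position i u).hasDerivWithinAt (s := Icc s τ)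
          rwa [S.speed_of_mem i (fst_mem_of_mem_triangle (hmem u hu').1)] at this,
         fun u hu => by
          have hu' : u ∈ Icc s t := ⟨hu.1, hu.2.trans hτ.2⟩
          have := (hYd u).hasDerivWithinAt (s := Icc s τ)
          rwa [S.speed_of_mem j (snd_mem_of_mem_triangle (hmem u hu').1)] at this,
         fun u hu => hmem u ⟨hu.1, hu.2.trans hτ.2⟩⟩
      have hYcc : Continuous fun τ => Y (τ + c) := hYc.comp (continuous_id.add continuous_const)
      have p1 : IsPrimitive (fun τ => κ (Z τ, Y (τ + c))) (fun τ => h (Z τ, Y (τ + c))) s t :=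
        ⟨hst, (hh.comp (hZc.measurable.prodMk hYcc.measurable)).intervalIntegrable_of_bound
          (fun _ => hhC _) _ _, fun τ hτ => by
            have := harc _ _ _ _ (harcs τ hτ)
            linarith⟩
      have p2 : IsPrimitive (fun τ => g (Y (τ + c)))
          (fun τ => g' (Y (τ + c)) * S.speed j (Y (τ + c))) s t :=
        IsPrimitive.of_hasDerivWithinAt hst (fun τ hτ =>
          HasDerivWithinAt.comp (h₂ := g) (h := fun τ => Y (τ + c)) τ
            (hgd _ (snd_mem_of_mem_triangle (hmem τ hτ).1)) (hYd τ).hasDerivWithinAt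
            fun u hu => snd_mem_of_mem_triangle (hmem u hu).1)
          ((hgc'.comp hYcc).mul ((S.continuous_speed j).comp hYcc)).continuousOn
      have := (p1.mul p2).integral_eq
      exact this.symm)
    (u := S.travel i x) (v := S.travel i y) ⟨min_le_left _ _, le_max_left _ _⟩
    ⟨min_le_right _ _, le_max_right _ _⟩
  have hL : ∀ z ∈ Ioc (0 : ℝ) 1, (∫ c in -(S.travel i z)..e₂ (S.travel i z),
      P (S.travel i z) c) = ∫ ξ in (0 : ℝ)..z, κ (z, ξ) * f ξ := fun z hz => by
    simp only [hP, hZ, position_travel]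
    rw [hchange (fun ξ => κ (z, ξ) * g ξ)]
    refine intervalIntegral.integral_congr fun ξ hξ => ?_
    rw [uIcc_of_le hz.1.le] at hξ
    have hξ' : ξ ∈ Icc (0 : ℝ) 1 := ⟨hξ.1, hξ.2.trans hz.2⟩
    have := S.speed_ne_zero j ξ
    simp only [hg, unitClamp_of_mem hξ']
    field_simp
  rw [hL y hy, hL x hx] at key
  rw [key, S.integral_travel i]
  refine intervalIntegral.integral_congr fun z hz => ?_
  have hz' : z ∈ Ioc (0 : ℝ) 1 :=
    ⟨(lt_min hx.1 hy.1).trans_le hz.1, hz.2.trans (max_le hx.2 hy.2)⟩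
  have hzI : z ∈ Icc (0 : ℝ) 1 := ⟨hz'.1.le, hz'.2⟩
  have h0I : (0 : ℝ) ∈ Icc (0 : ℝ) 1 := ⟨le_rfl, zero_le_one⟩
  have hR : (∫ c in -(S.travel i z)..e₂ (S.travel i z), r (S.travel i z) c)
      = ∫ ξ in (0 : ℝ)..z, (h (z, ξ) * f ξ
        + κ (z, ξ) * (S.speedDeriv j ξ * f ξ + S.speed j ξ * f' ξ)) := by
    simp only [hr, hZ, position_travel]
    rw [hchange (fun ξ => h (z, ξ) * g ξ + κ (z, ξ) * (g' ξ * S.speed j ξ))]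
    refine intervalIntegral.integral_congr fun ξ hξ => ?_
    rw [uIcc_of_le hz'.1.le] at hξ
    have hξ' : ξ ∈ Icc (0 : ℝ) 1 := ⟨hξ.1, hξ.2.trans hz'.2⟩
    have := S.speed_ne_zero j ξ
    simp only [hg, hg', unitClamp_of_mem hξ']
    field_simp
  have hY0 : Y 0 = 0 := by
    have := S.position_travel j 0
    rwa [travel_zero] at this
  rw [hR]
  simp only [hP, he₂, hZ, hY, position_travel, add_sub_cancel, add_neg_cancel, momentRate]
  rw [← hY, hY0]
  simp only [hg, unitClamp_of_mem hzI, unitClamp_of_mem h0I]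
  have := S.speed_ne_zero j z
  have := S.speed_ne_zero i z
  field_simp
  ring

end HypSystem
end
-- Moments against absolutely continuous functions
noncomputable section

namespace HypSystem

variable {m p : ℕ}

theorem measurable_momentRate (S : HypSystem m p) (i j : Fin (m + p)) {κ h : ℝ × ℝ → ℝ}
    (hκ : Measurable κ) (hh : Measurable h) {f f' : ℝ → ℝ} (hf : Measurable f)
    (hf' : Measurable f') : Measurable (S.momentRate i j κ h f f') := by
  have h1 := (S.continuous_speed i).measurable
  have h2 := (S.continuous_speed j).measurable
  have h3 := (S.continuous_speedDeriv j).measurable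
  have hd : Measurable fun z : ℝ => κ (z, z) := hκ.comp (measurable_id.prodMk measurable_id)
  have h0 : Measurable fun z : ℝ => κ (z, 0) := hκ.comp (measurable_id.prodMk measurable_const)
  have hi : Measurable fun z => ∫ ξ in (0 : ℝ)..z, (h (z, ξ) * f ξ
      + κ (z, ξ) * (S.speedDeriv j ξ * f ξ + S.speed j ξ * f' ξ)) := by
    refine Measurable.intervalIntegral_prod (f := fun z ξ => h (z, ξ) * f ξ
      + κ (z, ξ) * (S.speedDeriv j ξ * f ξ + S.speed j ξ * f' ξ)) ?_ measurable_const measurable_id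
    refine (hh.mul (hf.comp measurable_snd)).add (hκ.mul ?_)
    exact (((h3.mul hf).add (h2.mul hf')).comp measurable_snd)
  exact h1.inv.mul (((((h1.sub h2).mul hd).mul hf).add ((h0.const_mul _).mul_const _)).add hi)

theorem integrable_momentIntegrand (S : HypSystem m p) (j : Fin (m + p)) {κ h : ℝ × ℝ → ℝ}
    (hκ : Measurable κ) (hh : Measurable h) {C : ℝ} (hκC : ∀ q, |κ q| ≤ C) (hhC : ∀ q, |h q| ≤ C)
    {f f' : ℝ → ℝ} (hf : Continuous f) (hf' : IntervalIntegrable f' volume 0 1) {z : ℝ}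
    (hz : z ∈ Icc (0 : ℝ) 1) :
    IntervalIntegrable (fun ξ => h (z, ξ) * f ξ
      + κ (z, ξ) * (S.speedDeriv j ξ * f ξ + S.speed j ξ * f' ξ)) volume 0 z := by
  have hz' : uIcc (0 : ℝ) z ⊆ uIcc 0 1 :=
    uIcc_subset_uIcc left_mem_uIcc (Icc_subset_uIcc hz)
  have i1 : IntervalIntegrable (fun ξ => h (z, ξ)) volume 0 z :=
    (hh.comp measurable_prodMk_left).intervalIntegrable_of_bound (fun _ => hhC _) _ _
  have i2 : IntervalIntegrable (fun ξ => S.speedDeriv j ξ * f ξ + S.speed j ξ * f' ξ) volume 0 z :=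
    ((((S.continuous_speedDeriv j).mul hf).intervalIntegrable 0 1).add
      (hf'.continuousOn_mul (S.continuous_speed j).continuousOn)).mono_set hz'
  refine (i1.mul_continuousOn hf.continuousOn).add ?_
  rw [intervalIntegrable_iff] at i2 ⊢
  exact Integrable.bdd_mul (c := C) i2
    ((hκ.comp measurable_prodMk_left).aestronglyMeasurable)
    (Filter.Eventually.of_forall fun ξ => hκC _)

/-- The bound involves only the sup norm of `f` and the `L¹` norm of `f'`. In this topology `C¹`
functions approximate absolutely continuous ones, which is how the moment formula is extended. -/
theorem exists_momentRate_bound (S : HypSystem m p) {C : ℝ} (hC : 0 ≤ C) :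
    ∃ M : ℝ, 0 ≤ M ∧ ∀ (i j : Fin (m + p)) (κ h : ℝ × ℝ → ℝ), Measurable κ → Measurable h →
      (∀ q, |κ q| ≤ C) → (∀ q, |h q| ≤ C) → ∀ (f f' : ℝ → ℝ), Continuous f →
      IntervalIntegrable f' volume 0 1 → ∀ A B : ℝ, (∀ x ∈ Icc (0 : ℝ) 1, |f x| ≤ A) →
      (∫ x in (0 : ℝ)..1, |f' x|) ≤ B → ∀ z ∈ Icc (0 : ℝ) 1,
        |S.momentRate i j κ h f f' z| ≤ M * (A + B) := by
  obtain ⟨Cs, hCs, hsp, hspd, -, -⟩ := S.exists_coeff_bound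
  obtain ⟨Ci, hCi, hinv⟩ := S.exists_inv_speed_bound
  refine ⟨Ci * ((Cs + Cs) * C + Cs * C + (C + C * Cs)), by positivity, ?_⟩
  intro i j κ h hκ hh hκC hhC f f' hf hf' A B hA hB z hz
  have hA0 : 0 ≤ A := (abs_nonneg _).trans (hA 0 ⟨le_rfl, zero_le_one⟩)
  have hB0 : 0 ≤ B :=
    (intervalIntegral.integral_nonneg zero_le_one fun x _ => abs_nonneg (f' x)).trans hB
  have hz' : uIcc (0 : ℝ) z ⊆ uIcc 0 1 :=
    uIcc_subset_uIcc left_mem_uIcc (Icc_subset_uIcc hz)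
  have hI : |∫ ξ in (0 : ℝ)..z, (h (z, ξ) * f ξ
      + κ (z, ξ) * (S.speedDeriv j ξ * f ξ + S.speed j ξ * f' ξ))|
      ≤ (C + C * Cs) * (A + B) := by
    have h1 := intervalIntegral.norm_integral_le_of_norm_le (μ := volume) hz.1
      (f := fun ξ => h (z, ξ) * f ξ
        + κ (z, ξ) * (S.speedDeriv j ξ * f ξ + S.speed j ξ * f' ξ))
      (g := fun ξ => C * A + C * (Cs * A) + C * Cs * |f' ξ|)
      (Filter.Eventually.of_forall fun ξ hξ => by
        have hf1 := hA ξ ⟨hξ.1.le, hξ.2.trans hz.2⟩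
        rw [Real.norm_eq_abs]
        have e1 : |h (z, ξ) * f ξ| ≤ C * A := by
          rw [abs_mul]; exact mul_le_mul (hhC _) hf1 (abs_nonneg _) hC
        have e2 : |S.speedDeriv j ξ * f ξ| ≤ Cs * A := by
          rw [abs_mul]; exact mul_le_mul (hspd _ _) hf1 (abs_nonneg _) hCs.le
        have e3 : |S.speed j ξ * f' ξ| ≤ Cs * |f' ξ| := by
          rw [abs_mul]; exact mul_le_mul_of_nonneg_right (hsp _ _) (abs_nonneg _)
        have e4 : |κ (z, ξ) * (S.speedDeriv j ξ * f ξ + S.speed j ξ * f' ξ)|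
            ≤ C * (Cs * A + Cs * |f' ξ|) := by
          rw [abs_mul]
          exact mul_le_mul (hκC _) ((abs_add_le _ _).trans (add_le_add e2 e3)) (abs_nonneg _) hC
        refine (abs_add_le _ _).trans ((add_le_add e1 e4).trans (le_of_eq (by ring))))
      (((intervalIntegrable_const).add (hf'.abs.const_mul _)).mono_set hz')
    rw [Real.norm_eq_abs] at h1
    refine h1.trans ?_
    rw [intervalIntegral.integral_add intervalIntegrable_const
      ((hf'.abs.const_mul _).mono_set hz'), intervalIntegral.integral_const,
      intervalIntegral.integral_const_mul, sub_zero, smul_eq_mul]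
    have h2 : (∫ x in (0 : ℝ)..z, |f' x|) ≤ B :=
      (intervalIntegral.integral_mono_interval le_rfl hz.1 hz.2
        (Filter.Eventually.of_forall fun x => abs_nonneg (f' x)) hf'.abs).trans hB
    have h3 : z * (C * A + C * (Cs * A)) ≤ 1 * (C * A + C * (Cs * A)) := by
      gcongr; exact hz.2
    have h4 : C * Cs * (∫ x in (0 : ℝ)..z, |f' x|) ≤ C * Cs * B := by gcongr
    have h5 : 0 ≤ C * B := by positivity
    nlinarith
  have hAB : A ≤ A + B := by linarith
  unfold momentRate
  rw [abs_mul, mul_assoc Ci]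
  refine mul_le_mul (hinv _ _) ?_ (abs_nonneg _) hCi.le
  have e1 : |(S.speed i z - S.speed j z) * κ (z, z) * f z| ≤ (Cs + Cs) * C * (A + B) := by
    rw [abs_mul, abs_mul]
    refine mul_le_mul (mul_le_mul ((abs_sub _ _).trans (add_le_add (hsp _ _) (hsp _ _))) (hκC _)
      (abs_nonneg _) (by positivity)) ((hA z hz).trans hAB) (abs_nonneg _) (by positivity)
  have e2 : |S.speed j 0 * κ (z, 0) * f 0| ≤ Cs * C * (A + B) := by
    rw [abs_mul, abs_mul]
    exact mul_le_mul (mul_le_mul (hsp _ _) (hκC _) (abs_nonneg _) (by positivity))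
      ((hA 0 ⟨le_rfl, zero_le_one⟩).trans hAB) (abs_nonneg _) (by positivity)
  refine (abs_add_le _ _).trans ((add_le_add ((abs_add_le _ _).trans (add_le_add e1 e2)) hI).trans
    (le_of_eq (by ring)))

theorem momentRate_sub (S : HypSystem m p) (i j : Fin (m + p)) {κ h : ℝ × ℝ → ℝ}
    (hκ : Measurable κ) (hh : Measurable h) {C : ℝ} (hκC : ∀ q, |κ q| ≤ C) (hhC : ∀ q, |h q| ≤ C)
    {f f' g g' : ℝ → ℝ} (hf : Continuous f) (hf' : IntervalIntegrable f' volume 0 1)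
    (hg : Continuous g) (hg' : IntervalIntegrable g' volume 0 1) {z : ℝ}
    (hz : z ∈ Icc (0 : ℝ) 1) :
    S.momentRate i j κ h (fun x => f x - g x) (fun x => f' x - g' x) z
      = S.momentRate i j κ h f f' z - S.momentRate i j κ h g g' z := by
  unfold momentRate
  rw [← mul_sub]
  congr 1
  have := intervalIntegral.integral_sub
    (S.integrable_momentIntegrand j hκ hh hκC hhC hf hf' hz)
    (S.integrable_momentIntegrand j hκ hh hκC hhC hg hg' hz)
  rw [intervalIntegral.integral_congr (g := fun ξ => (h (z, ξ) * f ξ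
      + κ (z, ξ) * (S.speedDeriv j ξ * f ξ + S.speed j ξ * f' ξ)) - (h (z, ξ) * g ξ
      + κ (z, ξ) * (S.speedDeriv j ξ * g ξ + S.speed j ξ * g' ξ))) (fun ξ _ => by ring), this]
  ring

/-- Evolution of the moments of a kernel against an absolutely continuous function. -/
theorem kernel_moment (S : HypSystem m p) {i j : Fin (m + p)} {κ h : ℝ × ℝ → ℝ}
    (hκ : Measurable κ) (hh : Measurable h) {C : ℝ} (hκC : ∀ q, |κ q| ≤ C) (hhC : ∀ q, |h q| ≤ C)
    (harc : ∀ a b X Y, S.IsCharArc i j a b X Y →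
      κ (X b, Y b) - κ (X a, Y a) = ∫ s in a..b, h (X s, Y s))
    {f f' : ℝ → ℝ} (hfc : Continuous f) (hfm : Measurable f') (hf : IsPrimitive f f' 0 1) :
    IsPrimitive (fun y => ∫ ξ in (0 : ℝ)..y, κ (y, ξ) * f ξ) (S.momentRate i j κ h f f') 0 1 := by
  have hC : 0 ≤ C := (abs_nonneg _).trans (hκC 0)
  obtain ⟨M, hM, hbound⟩ := S.exists_momentRate_bound hC
  have hint : ∀ {f f' : ℝ → ℝ}, Continuous f → Measurable f' → IntervalIntegrable f' volume 0 1 →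
      IntervalIntegrable (S.momentRate i j κ h f f') volume 0 1 := fun {f f'} hf hfm hf' => by
    obtain ⟨A, hA⟩ := hf.continuousOn.exists_abs_le_unit
    rw [intervalIntegrable_iff, uIoc_of_le zero_le_one]
    refine Measure.integrableOn_of_bounded (M := M * (A + ∫ x in (0 : ℝ)..1, |f' x|)) (by simp)
      (S.measurable_momentRate i j hκ hh hf.measurable hfm).aestronglyMeasurable ?_
    refine (ae_restrict_mem measurableSet_Ioc).mono fun z hz => ?_
    exact hbound i j κ h hκ hh hκC hhC f f' hf hf' A _ hA le_rfl z ⟨hz.1.le, hz.2⟩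
  have hsub : ∀ {z : ℝ}, z ∈ Icc (0 : ℝ) 1 → uIcc (0 : ℝ) z ⊆ uIcc 0 1 := fun hz =>
    uIcc_subset_uIcc left_mem_uIcc (Icc_subset_uIcc hz)
  have hmom : ∀ {f : ℝ → ℝ} {A : ℝ}, (∀ x ∈ Icc (0 : ℝ) 1, |f x| ≤ A) → ∀ {z : ℝ},
      z ∈ Icc (0 : ℝ) 1 → |∫ ξ in (0 : ℝ)..z, κ (z, ξ) * f ξ| ≤ C * A * z := fun {f A} hA {z} hz => by
    have := abs_intervalIntegral_le (a := 0) (b := z) (f := fun ξ => κ (z, ξ) * f ξ) (C := C * A)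
      fun ξ hξ => by
        rw [uIoc_of_le hz.1] at hξ
        rw [abs_mul]
        exact mul_le_mul (hκC _) (hA ξ ⟨hξ.1.le, hξ.2.trans hz.2⟩) (abs_nonneg _) hC
    rwa [sub_zero, abs_of_nonneg hz.1] at this
  -- The `C¹` formula holds away from the corner. Letting the lower point tend to `0` includes the
  -- corner, since the moment over `[0,x]` and the integral of the rate are both `O(x)`.
  have hC1 : ∀ {f f' : ℝ → ℝ}, (∀ x, HasDerivAt f (f' x) x) → Continuous f' →
      ∀ y ∈ Ioc (0 : ℝ) 1, (∫ ξ in (0 : ℝ)..y, κ (y, ξ) * f ξ)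
        = ∫ z in (0 : ℝ)..y, S.momentRate i j κ h f f' z := fun {f f'} hd hc y hy => by
    have hfc : Continuous f := continuous_iff_continuousAt.2 fun x => (hd x).continuousAt
    obtain ⟨A, hA⟩ := hfc.continuousOn.exists_abs_le_unit
    have hi := hint hfc hc.measurable (hc.intervalIntegrable _ _)
    set B := A + ∫ x in (0 : ℝ)..1, |f' x| with hB
    have hA0 : 0 ≤ A := (abs_nonneg _).trans (hA 0 ⟨le_rfl, zero_le_one⟩)
    have hB0 : 0 ≤ B := add_nonneg hA0
      (intervalIntegral.integral_nonneg zero_le_one fun x _ => abs_nonneg (f' x))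
    have hbd : ∀ x ∈ Ioo 0 y, |(∫ ξ in (0 : ℝ)..y, κ (y, ξ) * f ξ)
        - ∫ z in (0 : ℝ)..y, S.momentRate i j κ h f f' z| ≤ (C * A + M * B) * x := fun x hx => by
      have hx1 : x ∈ Ioc (0 : ℝ) 1 := ⟨hx.1, hx.2.le.trans hy.2⟩
      have key := S.kernel_moment_of_contDiff hκ hh hκC hhC harc
        (fun t _ => (hd t).hasDerivWithinAt) hc.continuousOn hx1 hy
      have h1 := intervalIntegral.integral_add_adjacent_intervals
        (hi.mono_set (hsub ⟨hx1.1.le, hx1.2⟩)) (hi.mono_set (uIcc_subset_uIcc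
          (Icc_subset_uIcc ⟨hx1.1.le, hx1.2⟩) (Icc_subset_uIcc ⟨hy.1.le, hy.2⟩)))
      have h2 := hmom hA ⟨hx1.1.le, hx1.2⟩
      have h3 : |∫ z in (0 : ℝ)..x, S.momentRate i j κ h f f' z| ≤ M * B * |x - 0| :=
        abs_intervalIntegral_le fun z hz => by
          rw [uIoc_of_le hx1.1.le] at hz
          exact hbound i j κ h hκ hh hκC hhC f f' hfc (hc.intervalIntegrable _ _) A _ hA le_rfl z
            ⟨hz.1.le, hz.2.trans hx1.2⟩
      rw [sub_zero, abs_of_nonneg hx1.1.le] at h3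
      calc _ = |(∫ ξ in (0 : ℝ)..x, κ (x, ξ) * f ξ)
            - ∫ z in (0 : ℝ)..x, S.momentRate i j κ h f f' z| := by
            congr 1; rw [← h1, ← key]; ring
        _ ≤ C * A * x + M * B * x := (abs_sub _ _).trans (add_le_add h2 h3)
        _ = _ := by ring
    have hlim : Filter.Tendsto (fun x => (C * A + M * B) * x) (nhdsWithin 0 (Ioi 0)) (nhds 0) := by
      have : Continuous fun x : ℝ => (C * A + M * B) * x := by fun_prop
      have := this.tendsto 0
      rw [mul_zero] at this
      exact this.mono_left nhdsWithin_le_nhds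
    have := ge_of_tendsto hlim (Filter.mem_of_superset (Ioo_mem_nhdsGT hy.1) hbd)
    exact sub_eq_zero.1 (abs_eq_zero.1 (le_antisymm this (abs_nonneg _)))
  refine ⟨zero_le_one, hint hfc hfm hf.integrable, fun y hy => ?_⟩
  simp only [intervalIntegral.integral_same, zero_add]
  rcases hy.1.eq_or_lt with rfl | hy0
  · simp
  have hf1 : Integrable f' (volume.restrict (Ioc 0 1)) := by
    have := hf.integrable
    rwa [intervalIntegrable_iff, uIoc_of_le zero_le_one] at this
  refine eq_of_forall_dist_le fun ε hε => ?_
  -- Continuous functions are dense in `L¹`. The tolerance is divided by `C + 2M + 1` because the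
  -- error is `C η` in the moment and at most `M (η + η)` in the integral of the rate.
  obtain ⟨g', hg', hgi⟩ := hf1.exists_boundedContinuous_integral_sub_le
    (ε := ε / (C + M * 2 + 1)) (by positivity)
  set η := ε / (C + M * 2 + 1) with hη
  have hη0 : 0 < η := by positivity
  -- The same initial value as `f`, so that `f - g` is bounded by the `L¹` distance of the
  -- derivatives.
  set g : ℝ → ℝ := fun x => f 0 + ∫ t in (0 : ℝ)..x, g' t with hg
  have hgd : ∀ x, HasDerivAt g (g' x) x := fun x =>
    (intervalIntegral.integral_hasDerivAt_right (g'.continuous.intervalIntegrable _ _)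
      (g'.continuous.stronglyMeasurableAtFilter _ _) g'.continuous.continuousAt).const_add _
  have hgc : Continuous g := continuous_iff_continuousAt.2 fun x => (hgd x).continuousAt
  have hg'i : IntervalIntegrable g' volume 0 1 := g'.continuous.intervalIntegrable _ _
  have hL1 : (∫ x in (0 : ℝ)..1, |f' x - g' x|) ≤ η := by
    rw [intervalIntegral.integral_of_le zero_le_one]
    exact hg'
  have hsup : ∀ x ∈ Icc (0 : ℝ) 1, |f x - g x| ≤ η := fun x hx => by
    have h1 : f x - g x = ∫ t in (0 : ℝ)..x, (f' t - g' t) := by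
      rw [intervalIntegral.integral_sub (hf.integrable.mono_set (hsub hx))
        (hg'i.mono_set (hsub hx)), hf.eq_add x hx, hg]
      ring
    rw [h1]
    refine (intervalIntegral.abs_integral_le_integral_abs hx.1).trans (le_trans ?_ hL1)
    exact intervalIntegral.integral_mono_interval le_rfl hx.1 hx.2
      (Filter.Eventually.of_forall fun x => abs_nonneg _) (hf.integrable.sub hg'i).abs
  have e0 := hC1 hgd g'.continuous y ⟨hy0, hy.2⟩
  have iκ : ∀ {f : ℝ → ℝ}, Continuous f →
      IntervalIntegrable (fun ξ => κ (y, ξ) * f ξ) volume 0 y := fun hf =>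
    ((hκ.comp measurable_prodMk_left).intervalIntegrable_of_bound
      (fun _ => hκC _) _ _).mul_continuousOn hf.continuousOn
  have e1 : |(∫ ξ in (0 : ℝ)..y, κ (y, ξ) * f ξ) - ∫ ξ in (0 : ℝ)..y, κ (y, ξ) * g ξ| ≤ C * η := by
    rw [← intervalIntegral.integral_sub (iκ hfc) (iκ hgc)]
    simp only [← mul_sub]
    refine (hmom hsup hy).trans ?_
    have : 0 ≤ C * η := by positivity
    nlinarith [hy.2]
  have e2 : |(∫ z in (0 : ℝ)..y, S.momentRate i j κ h f f' z)
      - ∫ z in (0 : ℝ)..y, S.momentRate i j κ h g g' z| ≤ M * (η + η) := by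
    rw [← intervalIntegral.integral_sub ((hint hfc hfm hf.integrable).mono_set (hsub hy))
      ((hint hgc g'.continuous.measurable hg'i).mono_set (hsub hy))]
    have := abs_intervalIntegral_le (a := 0) (b := y) (C := M * (η + η))
      (f := fun z => S.momentRate i j κ h f f' z - S.momentRate i j κ h g g' z) fun z hz => by
        rw [uIoc_of_le hy.1] at hz
        have hz' : z ∈ Icc (0 : ℝ) 1 := ⟨hz.1.le, hz.2.trans hy.2⟩
        rw [← S.momentRate_sub i j hκ hh hκC hhC hfc hf.integrable hgc hg'i hz']
        exact hbound i j κ h hκ hh hκC hhC _ _ (hfc.sub hgc) (hf.integrable.sub hg'i) _ _ hsup hL1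
          z hz'
    refine this.trans ?_
    rw [sub_zero, abs_of_nonneg hy.1]
    have : 0 ≤ M * (η + η) := by positivity
    nlinarith [hy.2]
  rw [Real.dist_eq]
  have e3 : (C + M * 2 + 1) * η = ε := by rw [hη]; field_simp
  rw [e0] at e1
  have := abs_sub_le (∫ ξ in (0 : ℝ)..y, κ (y, ξ) * f ξ)
    (∫ z in (0 : ℝ)..y, S.momentRate i j κ h g g' z)
    (∫ z in (0 : ℝ)..y, S.momentRate i j κ h f f' z)
  rw [abs_sub_comm (∫ z in (0 : ℝ)..y, S.momentRate i j κ h g g' z)] at this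
  nlinarith

end HypSystem
end
-- The state space and Volterra operators on it
noncomputable section

namespace HypSystem

/-- Lebesgue measure on the unit interval. -/
abbrev unitVolume : Measure ℝ := volume.restrict (Icc (0 : ℝ) 1)

instance : IsProbabilityMeasure unitVolume := ⟨by simp [unitVolume]⟩

namespace StateSpace

variable {n : ℕ}

theorem memLp_coord (W : StateSpace n) (i : Fin n) : MemLp (fun x => W x i) 2 unitVolume :=
  (Lp.memLp W).eval_piLp i

theorem measurable_coord (W : StateSpace n) (i : Fin n) : Measurable fun x => W x i :=
  (EuclideanSpace.proj (𝕜 := ℝ) i).continuous.measurable.comp (Lp.stronglyMeasurable W).measurable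

theorem integrable_coord (W : StateSpace n) (i : Fin n) :
    Integrable (fun x => W x i) unitVolume :=
  (memLp_coord W i).integrable one_le_two

theorem intervalIntegrable_coord (W : StateSpace n) (i : Fin n) :
    IntervalIntegrable (fun x => W x i) volume 0 1 := by
  rw [intervalIntegrable_iff_integrableOn_Ioc_of_le zero_le_one]
  exact (integrable_coord W i).mono_measure (Measure.restrict_mono_set _ Ioc_subset_Icc_self)

theorem ext_ae {W U : StateSpace n} (h : ∀ᵐ x ∂unitVolume, ∀ i, W x i = U x i) : W = U :=
  Lp.ext (h.mono fun x hx => by ext i; exact hx i)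

theorem inner_eq (U W : StateSpace n) :
    inner ℝ U W = ∫ x in Icc (0 : ℝ) 1, ∑ i, U x i * W x i := by
  rw [L2.inner_def]
  simp [PiLp.inner_apply, mul_comm]

theorem norm_sq_eq (W : StateSpace n) : ‖W‖ ^ 2 = ∫ x in Icc (0 : ℝ) 1, ∑ i, W x i ^ 2 := by
  rw [← real_inner_self_eq_norm_sq, inner_eq]
  simp only [sq]

theorem integrable_sq_coord (W : StateSpace n) (i : Fin n) :
    Integrable (fun x => W x i ^ 2) unitVolume :=
  (memLp_coord W i).integrable_sq

theorem add_ae (W U : StateSpace n) :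
    ∀ᵐ x ∂unitVolume, ∀ i, (W + U : StateSpace n) x i = W x i + U x i :=
  (Lp.coeFn_add W U).mono fun x hx i => by rw [hx]; rfl

theorem sub_ae (W U : StateSpace n) :
    ∀ᵐ x ∂unitVolume, ∀ i, (W - U : StateSpace n) x i = W x i - U x i :=
  (Lp.coeFn_sub W U).mono fun x hx i => by rw [hx]; rfl

theorem smul_ae (c : ℝ) (W : StateSpace n) :
    ∀ᵐ x ∂unitVolume, ∀ i, (c • W : StateSpace n) x i = c * W x i :=
  (Lp.coeFn_smul c W).mono fun x hx i => by rw [hx]; rfl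

/-- The state with given components. -/
def ofFun (f : Fin n → ℝ → ℝ) (hf : ∀ i, MemLp (f i) 2 unitVolume) : StateSpace n :=
  (MemLp.of_eval_piLp (f := fun x => WithLp.toLp 2 fun i => f i x) hf).toLp

theorem ofFun_ae (f : Fin n → ℝ → ℝ) (hf : ∀ i, MemLp (f i) 2 unitVolume) :
    ∀ᵐ x ∂unitVolume, ∀ i, ofFun f hf x i = f i x :=
  (MemLp.coeFn_toLp (MemLp.of_eval_piLp (f := fun x => WithLp.toLp 2 fun i => f i x) hf)).mono
    fun x hx i => by rw [ofFun, hx]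

theorem memLp_of_bound {f : ℝ → ℝ} (hf : Measurable f) {C : ℝ}
    (hC : ∀ x ∈ Icc (0 : ℝ) 1, |f x| ≤ C) : MemLp f 2 unitVolume :=
  MemLp.of_bound hf.aestronglyMeasurable C
    ((ae_restrict_mem measurableSet_Icc).mono fun x hx => hC x hx)

theorem integral_abs_coord_le (W : StateSpace n) (i : Fin n) :
    ∫ x in Icc (0 : ℝ) 1, |W x i| ≤ ‖W‖ := by
  set a := ∫ x in Icc (0 : ℝ) 1, |W x i| with ha
  have hi := (integrable_coord W i).abs
  -- The Cauchy–Schwarz inequality in the form that a variance is nonnegative; the interval has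
  -- measure one.
  have h1 : (∫ x in Icc (0 : ℝ) 1, (|W x i| - a) ^ 2)
      = (∫ x in Icc (0 : ℝ) 1, W x i ^ 2) - a ^ 2 := by
    have : ∀ x, (|W x i| - a) ^ 2 = W x i ^ 2 - 2 * a * |W x i| + a ^ 2 := fun x => by
      rw [sub_sq, sq_abs]; ring
    simp only [this]
    have h2 : Integrable (fun x => W x i ^ 2 - 2 * a * |W x i|) unitVolume :=
      (integrable_sq_coord W i).sub (hi.const_mul _)
    rw [integral_add h2 (integrable_const _),
      integral_sub (integrable_sq_coord W i) (hi.const_mul _), integral_const_mul, ← ha]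
    simp; ring
  have h2 : 0 ≤ ∫ x in Icc (0 : ℝ) 1, (|W x i| - a) ^ 2 :=
    integral_nonneg fun x => sq_nonneg _
  have h3 : (∫ x in Icc (0 : ℝ) 1, W x i ^ 2) ≤ ‖W‖ ^ 2 := by
    rw [norm_sq_eq]
    refine integral_mono (integrable_sq_coord W i)
      (integrable_finsetSum _ fun j _ => integrable_sq_coord W j) fun x => ?_
    exact Finset.single_le_sum (f := fun j => W x j ^ 2) (fun j _ => sq_nonneg _)
      (Finset.mem_univ i)
  exact le_of_sq_le_sq (by linarith) (norm_nonneg _)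

theorem integral_sum_abs_le (W : StateSpace n) :
    ∫ x in Icc (0 : ℝ) 1, ∑ i, |W x i| ≤ n * ‖W‖ := by
  rw [integral_finsetSum _ fun i _ => (integrable_coord W i).abs]
  calc _ ≤ ∑ _i : Fin n, ‖W‖ := Finset.sum_le_sum fun i _ => integral_abs_coord_le W i
    _ = _ := by simp

theorem norm_le_of_ae {W : StateSpace n} {C : ℝ} (hC0 : 0 ≤ C)
    (hC : ∀ᵐ x ∂unitVolume, ∀ i, |W x i| ≤ C) : ‖W‖ ≤ n * C := by
  refine le_of_sq_le_sq ?_ (by positivity)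
  rw [norm_sq_eq]
  calc _ ≤ ∫ _x in Icc (0 : ℝ) 1, ∑ _i : Fin n, C ^ 2 := by
        refine integral_mono_ae (integrable_finsetSum _ fun j _ => integrable_sq_coord W j)
          (integrable_const _) (hC.mono fun x hx => Finset.sum_le_sum fun i _ => ?_)
        rw [← sq_abs]
        exact pow_le_pow_left₀ (abs_nonneg _) (hx i) 2
    _ = n * C ^ 2 := by simp
    _ ≤ (n * C) ^ 2 := by
        rw [mul_pow]
        refine mul_le_mul_of_nonneg_right ?_ (sq_nonneg _)
        rcases Nat.eq_zero_or_pos n with h | h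
        · simp [h]
        · have : (1 : ℝ) ≤ n := by exact_mod_cast h
          nlinarith

/-- A linear map given by a formula for the components is continuous if it is dominated pointwise
by the norm and the component. -/
theorem exists_operator (F : StateSpace n → Fin n → ℝ → ℝ) (hF : ∀ W i, Measurable (F W i))
    (hadd : ∀ W U, ∀ᵐ x ∂unitVolume, ∀ i, F (W + U) i x = F W i x + F U i x)
    (hsmul : ∀ (c : ℝ) W, ∀ᵐ x ∂unitVolume, ∀ i, F (c • W) i x = c * F W i x)
    {C : ℝ} (hC0 : 0 ≤ C)
    (hC : ∀ W, ∀ᵐ x ∂unitVolume, ∀ i, |F W i x| ≤ C * (‖W‖ + |W x i|)) :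
    ∃ T : StateSpace n →L[ℝ] StateSpace n, ∀ W, ∀ᵐ x ∂unitVolume, ∀ i, T W x i = F W i x := by
  have hmem : ∀ W i, MemLp (F W i) 2 unitVolume := fun W i =>
    MemLp.mono' (((memLp_const ‖W‖).add (memLp_coord W i).abs).const_mul C)
      (hF W i).aestronglyMeasurable ((hC W).mono fun x hx => hx i)
  let L : StateSpace n →ₗ[ℝ] StateSpace n :=
    { toFun := fun W => ofFun (F W) (hmem W)
      map_add' := fun W U => ext_ae <| by
        filter_upwards [ofFun_ae (F (W + U)) (hmem _), ofFun_ae (F W) (hmem _),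
          ofFun_ae (F U) (hmem _), hadd W U,
          add_ae (ofFun (F W) (hmem _)) (ofFun (F U) (hmem _))] with x h1 h2 h3 h4 h5 i
        rw [h1, h5, h2, h3, h4]
      map_smul' := fun c W => ext_ae <| by
        filter_upwards [ofFun_ae (F (c • W)) (hmem _), ofFun_ae (F W) (hmem _), hsmul c W,
          smul_ae c (ofFun (F W) (hmem _))] with x h1 h2 h3 h4 i
        rw [h1, RingHom.id_apply, h4, h2, h3] }
  refine ⟨L.mkContinuous (2 * C * (n + 1)) fun W => ?_, fun W => ofFun_ae (F W) (hmem W)⟩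
  refine le_of_sq_le_sq ?_ (by positivity)
  rw [norm_sq_eq]
  calc (∫ x in Icc (0 : ℝ) 1, ∑ i, (L W) x i ^ 2)
      ≤ ∫ x in Icc (0 : ℝ) 1, (2 * C ^ 2 * n * ‖W‖ ^ 2 + 2 * C ^ 2 * ∑ i, W x i ^ 2) := by
        refine integral_mono_ae (integrable_finsetSum _ fun j _ => integrable_sq_coord (L W) j)
          ((integrable_const _).add ((integrable_finsetSum _ fun j _ =>
            integrable_sq_coord W j).const_mul _)) ?_
        filter_upwards [ofFun_ae (F W) (hmem W), hC W] with x h1 h2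
        have : ∀ i, (L W) x i ^ 2 ≤ 2 * C ^ 2 * ‖W‖ ^ 2 + 2 * C ^ 2 * W x i ^ 2 := fun i => by
          show ofFun (F W) (hmem W) x i ^ 2 ≤ _
          rw [h1 i, ← sq_abs]
          refine (pow_le_pow_left₀ (abs_nonneg _) (h2 i) 2).trans ?_
          rw [← sq_abs (W x i)]
          nlinarith [mul_nonneg (sq_nonneg C) (sq_nonneg (‖W‖ - |W x i|))]
        refine (Finset.sum_le_sum fun i _ => this i).trans (le_of_eq ?_)
        rw [Finset.sum_add_distrib, ← Finset.mul_sum Finset.univ (fun i => W x i ^ 2),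
          Finset.sum_const, Finset.card_univ, Fintype.card_fin, nsmul_eq_mul]
        ring
    _ = 2 * C ^ 2 * (n + 1) * ‖W‖ ^ 2 := by
        rw [integral_add (integrable_const _) ((integrable_finsetSum _ fun j _ =>
            integrable_sq_coord W j).const_mul _), integral_const_mul (2 * C ^ 2)
            (fun x => ∑ i, W x i ^ 2), ← norm_sq_eq]
        simp; ring
    _ ≤ (2 * C * (n + 1) * ‖W‖) ^ 2 := by
        have hn : (0 : ℝ) ≤ n := Nat.cast_nonneg n
        have : 0 ≤ C ^ 2 * ‖W‖ ^ 2 := by positivity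
        nlinarith [mul_nonneg this hn, mul_nonneg this (mul_nonneg hn hn)]

theorem ae_mem : ∀ᵐ x ∂unitVolume, x ∈ Icc (0 : ℝ) 1 := ae_restrict_mem measurableSet_Icc

theorem ae_volume {P : ℝ → Prop} (h : ∀ᵐ x ∂unitVolume, P x) :
    ∀ᵐ x, x ∈ Icc (0 : ℝ) 1 → P x := (ae_restrict_iff' measurableSet_Icc).1 h

theorem integral_congr_unit {f g : ℝ → ℝ} (h : ∀ᵐ x ∂unitVolume, f x = g x) {x : ℝ}
    (hx : x ∈ Icc (0 : ℝ) 1) : ∫ ξ in (0 : ℝ)..x, f ξ = ∫ ξ in (0 : ℝ)..x, g ξ := by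
  refine intervalIntegral.integral_congr_ae ?_
  filter_upwards [ae_volume h] with ξ h1 h2
  rw [uIoc_of_le hx.1] at h2
  exact h1 ⟨h2.1.le, h2.2.trans hx.2⟩

section Volterra

variable {κ : Fin n → Fin n → ℝ × ℝ → ℝ} {C : ℝ}

theorem intervalIntegrable_volterra (hκ : ∀ i j, Measurable (κ i j))
    (hC : ∀ i j q, |κ i j q| ≤ C) (W : StateSpace n) (i : Fin n) {x : ℝ}
    (hx : x ∈ Icc (0 : ℝ) 1) :
    IntervalIntegrable (fun ξ => ∑ j, κ i j (x, ξ) * W ξ j) volume 0 x := by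
  have : IntervalIntegrable (∑ j, fun ξ => κ i j (x, ξ) * W ξ j) volume 0 x :=
    IntervalIntegrable.sum _ fun j _ => by
      have h1 := (intervalIntegrable_coord W j).mono_set
        (uIcc_subset_uIcc left_mem_uIcc (Icc_subset_uIcc hx))
      rw [intervalIntegrable_iff] at h1 ⊢
      exact h1.bdd_mul ((hκ i j).comp measurable_prodMk_left).aestronglyMeasurable
        (Filter.Eventually.of_forall fun ξ => hC i j (x, ξ))
  exact this.congr fun ξ _ => by simp

theorem measurable_volterra (hκ : ∀ i j, Measurable (κ i j)) (W : StateSpace n) (i : Fin n) :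
    Measurable fun x => ∫ ξ in (0 : ℝ)..x, ∑ j, κ i j (x, ξ) * W ξ j := by
  refine Measurable.intervalIntegral_prod (f := fun x ξ => ∑ j, κ i j (x, ξ) * W ξ j) ?_
    measurable_const measurable_id
  exact Finset.measurable_sum _ fun j _ =>
    (hκ i j).mul ((measurable_coord W j).comp measurable_snd)

theorem abs_volterra_le (hC0 : 0 ≤ C) (hC : ∀ i j q, |κ i j q| ≤ C) (W : StateSpace n)
    (i : Fin n) {x : ℝ} (hx : x ∈ Icc (0 : ℝ) 1) {g : ℝ → ℝ} (hg : Continuous g)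
    (hW : ∀ᵐ ξ ∂unitVolume, ∀ j, |W ξ j| ≤ g ξ) :
    |∫ ξ in (0 : ℝ)..x, ∑ j, κ i j (x, ξ) * W ξ j| ≤ ∫ ξ in (0 : ℝ)..x, n * C * g ξ := by
  rw [← Real.norm_eq_abs]
  refine intervalIntegral.norm_integral_le_of_norm_le (μ := volume) (g := fun ξ => n * C * g ξ)
    hx.1 ?_ ?_
  swap
  · have : Continuous fun ξ => n * C * g ξ := by fun_prop
    exact this.intervalIntegrable 0 x
  filter_upwards [ae_volume hW] with ξ h1 h2
  have h3 := h1 ⟨h2.1.le, h2.2.trans hx.2⟩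
  refine (Finset.abs_sum_le_sum_abs _ _).trans ?_
  calc _ ≤ ∑ _j : Fin n, C * g ξ := Finset.sum_le_sum fun j _ => by
        rw [abs_mul]
        exact mul_le_mul (hC _ _ _) (h3 j) (abs_nonneg _) hC0
    _ = _ := by simp; ring

theorem abs_volterra_le_norm (hC0 : 0 ≤ C) (hC : ∀ i j q, |κ i j q| ≤ C)
    (W : StateSpace n) (i : Fin n) {x : ℝ} (hx : x ∈ Icc (0 : ℝ) 1) :
    |∫ ξ in (0 : ℝ)..x, ∑ j, κ i j (x, ξ) * W ξ j| ≤ n * C * ‖W‖ := by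
  have hint : Integrable (fun ξ => ∑ j, |W ξ j|) unitVolume :=
    integrable_finsetSum _ fun j _ => (integrable_coord W j).abs
  rw [intervalIntegral.integral_of_le hx.1]
  have hsub : Ioc 0 x ⊆ Icc (0 : ℝ) 1 := fun ξ hξ => ⟨hξ.1.le, hξ.2.trans hx.2⟩
  calc _ ≤ ∫ ξ in Ioc 0 x, C * ∑ j, |W ξ j| := by
        refine norm_integral_le_of_norm_le (f := fun ξ => ∑ j, κ i j (x, ξ) * W ξ j)
          (g := fun ξ => C * ∑ j, |W ξ j|) ((hint.const_mul C).mono_measure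
            (Measure.restrict_mono_set _ hsub)) (Filter.Eventually.of_forall fun ξ => ?_)
        refine (Finset.abs_sum_le_sum_abs _ _).trans ?_
        rw [Finset.mul_sum]
        exact Finset.sum_le_sum fun j _ => by
          rw [abs_mul]; exact mul_le_mul_of_nonneg_right (hC _ _ _) (abs_nonneg _)
    _ ≤ ∫ ξ in Icc (0 : ℝ) 1, C * ∑ j, |W ξ j| :=
        setIntegral_mono_set (hint.const_mul C) (Filter.Eventually.of_forall fun ξ => by positivity)
          hsub.eventuallyLE
    _ ≤ C * (n * ‖W‖) := by
        rw [integral_const_mul]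
        exact mul_le_mul_of_nonneg_left (integral_sum_abs_le W) hC0
    _ = _ := by ring

/-- Volterra integral operators with bounded kernels are bounded on `(L²(0,1))ⁿ`, and `1 - T` is
invertible for such an operator `T`. -/
theorem exists_volterra (hκ : ∀ i j, Measurable (κ i j)) (hC : ∀ i j q, |κ i j q| ≤ C) :
    ∃ T : StateSpace n →L[ℝ] StateSpace n,
      (∀ W, ∀ᵐ x ∂unitVolume, ∀ i, T W x i = ∫ ξ in (0 : ℝ)..x, ∑ j, κ i j (x, ξ) * W ξ j) ∧
      IsUnit (1 - T) := by
  wlog hC0 : 0 ≤ C generalizing C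
  · exact this (C := max C 0) (fun i j q => (hC i j q).trans (le_max_left _ _)) (le_max_right _ _)
  obtain ⟨T, hT⟩ := exists_operator
    (fun W i x => ∫ ξ in (0 : ℝ)..x, ∑ j, κ i j (x, ξ) * W ξ j)
    (fun W i => measurable_volterra hκ W i)
    (fun W U => by
      filter_upwards [ae_mem] with x hx i
      rw [← intervalIntegral.integral_add (intervalIntegrable_volterra hκ hC W i hx)
        (intervalIntegrable_volterra hκ hC U i hx)]
      refine integral_congr_unit ?_ hx
      filter_upwards [add_ae W U] with ξ hξ
      rw [← Finset.sum_add_distrib]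
      exact Finset.sum_congr rfl fun j _ => by rw [hξ]; ring)
    (fun c W => by
      filter_upwards [ae_mem] with x hx i
      rw [← intervalIntegral.integral_const_mul]
      refine integral_congr_unit ?_ hx
      filter_upwards [smul_ae c W] with ξ hξ
      rw [Finset.mul_sum]
      exact Finset.sum_congr rfl fun j _ => by rw [hξ]; ring)
    (C := n * C) (by positivity)
    (fun W => by
      filter_upwards [ae_mem] with x hx i
      have := abs_volterra_le_norm hC0 hC W i hx
      refine this.trans (mul_le_mul_of_nonneg_left ?_ (by positivity))
      linarith [abs_nonneg (W x i)])
  refine ⟨T, hT, ?_⟩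
  set M : ℝ := n * C with hM
  have hM0 : 0 ≤ M := by positivity
  -- Each application of `T` integrates the pointwise bound once more from `0` to `x`, which
  -- produces the factorial. The first application turns an `L²` bound into a pointwise one, hence
  -- the exponent `N + 1`.
  have hpow : ∀ N : ℕ, ∀ W, ∀ᵐ x ∂unitVolume, ∀ i,
      |(T ^ (N + 1)) W x i| ≤ M ^ (N + 1) * ‖W‖ * (x ^ N / N.factorial) := by
    intro N
    induction N with
    | zero =>
      intro W
      filter_upwards [hT W, ae_mem] with x h1 hx i
      rw [zero_add, pow_one, h1 i]
      simpa using abs_volterra_le_norm hC0 hC W i hx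
    | succ N ih =>
      intro W
      filter_upwards [hT ((T ^ (N + 1)) W), ae_mem] with x h1 hx i
      rw [pow_succ' T, mul_apply_eq_comp, h1 i]
      refine (abs_volterra_le hC0 hC _ i hx (by fun_prop) (ih W)).trans (le_of_eq ?_)
      have : ∀ ξ : ℝ, n * C * (M ^ (N + 1) * ‖W‖ * (ξ ^ N / N.factorial))
          = M ^ (N + 2) * ‖W‖ / N.factorial * ξ ^ N := fun ξ => by rw [← hM]; ring
      simp only [this]
      rw [intervalIntegral.integral_const_mul, integral_pow, Nat.factorial_succ]
      push_cast
      field_simp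
      ring
  have hlim : Filter.Tendsto (fun N : ℕ => (n * M) * (M ^ N / N.factorial)) Filter.atTop
      (nhds 0) := by
    simpa using (FloorSemiring.tendsto_pow_div_factorial_atTop M).const_mul (n * M)
  obtain ⟨N, hN⟩ := (hlim.eventually (gt_mem_nhds one_pos)).exists
  have hnorm : ‖T ^ (N + 1)‖ < 1 := by
    refine lt_of_le_of_lt (ContinuousLinearMap.opNorm_le_bound _ (by positivity) fun W => ?_) hN
    have := norm_le_of_ae (W := (T ^ (N + 1)) W) (C := M ^ (N + 1) * ‖W‖ / N.factorial)
      (by positivity) (by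
        filter_upwards [hpow N W, ae_mem] with x h1 hx i
        refine (h1 i).trans ?_
        rw [mul_div_assoc _ ‖W‖, mul_assoc, div_eq_mul_one_div ‖W‖]
        have := pow_le_one₀ (n := N) hx.1 hx.2
        gcongr)
    refine this.trans (le_of_eq ?_)
    ring
  have hunit : IsUnit (1 - T ^ (N + 1)) := isUnit_one_sub_of_norm_lt_one hnorm
  -- `1 - T ^ (N + 1)` is `1 - T` times a polynomial in `T`. The factors commute, so each of them is
  -- invertible.
  rw [← mul_neg_geom_sum] at hunit
  refine ((Commute.isUnit_mul_iff ?_).1 hunit).1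
  exact (Commute.sum_right _ _ _ fun k _ =>
    ((Commute.one_left _).sub_left (Commute.refl T)).pow_right k)

end Volterra

end StateSpace
end HypSystem
end
-- Dissipative relations and Yosida approximation
noncomputable section

namespace Dissipative

open Filter Topology
open scoped InnerProductSpace

variable {H : Type*} [NormedAddCommGroup H] [InnerProductSpace ℝ H]

theorem norm_sq_antitoneOn {u u' : ℝ → H} (hu : ∀ t, 0 ≤ t → HasDerivAt u (u' t) t)
    (h : ∀ t, 0 ≤ t → ⟪u t, u' t⟫_ℝ ≤ 0) {t : ℝ} (ht : 0 ≤ t) : ‖u t‖ ≤ ‖u 0‖ := by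
  have hd : ∀ t, 0 ≤ t → HasDerivAt (fun t => ‖u t‖ ^ 2) (2 * ⟪u t, u' t⟫_ℝ) t :=
    fun t ht => (hu t ht).norm_sq
  have := antitoneOn_of_deriv_nonpos (convex_Ici (0 : ℝ))
    (fun t ht => (hd t ht).continuousAt.continuousWithinAt)
    (fun t ht => (hd t (interior_subset ht)).differentiableAt.differentiableWithinAt)
    (fun t ht => by
      rw [(hd t (interior_subset ht)).deriv]
      linarith [h t (interior_subset ht)])
  exact le_of_sq_le_sq (this (mem_Ici.2 le_rfl) ht ht) (norm_nonneg _)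

/-- The trajectory `exp(tA) x`. -/
def flow (A : H →L[ℝ] H) (x : H) (t : ℝ) : H := NormedSpace.exp (t • A) x

theorem flow_zero (A : H →L[ℝ] H) (x : H) : flow A x 0 = x := by
  simp [flow]

theorem flow_sub (A : H →L[ℝ] H) (x y : H) (t : ℝ) : flow A (x - y) t = flow A x t - flow A y t :=
  map_sub _ _ _

variable {G : Submodule ℝ (H × H)}

/-- For `(u, c • (u - g))` in `G`, dissipativity says `⟪u, u - g⟫ ≤ 0`, hence `‖u‖ ≤ ‖g‖`. Applied
to differences, this gives uniqueness, and uniqueness gives linearity of the solution map. -/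
theorem exists_resolvent (hdiss : ∀ p ∈ G, ⟪p.1, p.2⟫_ℝ ≤ 0)
    (hrange : ∀ c : ℝ, 0 < c → ∀ g, ∃ p ∈ G, c • p.1 - p.2 = g) {c : ℝ} (hc : 0 < c) :
    ∃ J : H →L[ℝ] H, (∀ g, ‖J g‖ ≤ ‖g‖) ∧ ∀ g, (J g, c • (J g - g)) ∈ G := by
  have hex : ∀ g, ∃ u, (u, c • (u - g)) ∈ G := fun g => by
    obtain ⟨⟨u, v⟩, hp, he⟩ := hrange c hc (c • g)
    refine ⟨u, ?_⟩
    have : c • (u - g) = v := by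
      rw [smul_sub, ← he]; simp
    rwa [this]
  choose J hJ using hex
  have hbound : ∀ g u, (u, c • (u - g)) ∈ G → ‖u‖ ≤ ‖g‖ := fun g u h => by
    have h1 := hdiss _ h
    simp only [inner_smul_right, inner_sub_right, real_inner_self_eq_norm_sq] at h1
    have h2 : ‖u‖ ^ 2 - ⟪u, g⟫_ℝ ≤ 0 := by
      by_contra! h3
      exact absurd h1 (not_le.2 (mul_pos hc h3))
    have h3 := real_inner_le_norm u g
    by_contra! h4
    nlinarith [norm_nonneg u, norm_nonneg g]
  have huniq : ∀ g u, (u, c • (u - g)) ∈ G → u = J g := fun g u h => by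
    have h1 := G.sub_mem h (hJ g)
    have h2 := hbound 0 (u - J g) (by
      convert h1 using 1
      simp only [Prod.mk_sub_mk, ← smul_sub]
      congr 2; abel)
    rw [norm_zero, norm_le_zero_iff, sub_eq_zero] at h2
    exact h2
  let L : H →ₗ[ℝ] H :=
    { toFun := J
      map_add' := fun g g' => (huniq _ _ (by
        have := G.add_mem (hJ g) (hJ g')
        convert this using 1
        simp only [Prod.mk_add_mk, ← smul_add]
        congr 2; abel)).symm
      map_smul' := fun a g => (huniq _ _ (by
        have := G.smul_mem a (hJ g)
        convert this using 1
        simp only [Prod.smul_mk, smul_comm a c, smul_sub, RingHom.id_apply])).symm }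
  exact ⟨L.mkContinuous 1 fun g => by
    rw [one_mul]; exact hbound g (J g) (hJ g),
    fun g => hbound g (J g) (hJ g), hJ⟩

variable [CompleteSpace H]

theorem hasDerivAt_flow (A : H →L[ℝ] H) (x : H) (t : ℝ) :
    HasDerivAt (flow A x) (A (flow A x t)) t := by
  have h := (hasDerivAt_exp_smul_const' (𝕂 := ℝ) A t)
  exact (ContinuousLinearMap.apply ℝ H x).hasFDerivAt.comp_hasDerivAt t h

theorem hasDerivAt_apply_flow (A : H →L[ℝ] H) (x : H) (t : ℝ) :
    HasDerivAt (fun t => A (flow A x t)) (A (A (flow A x t))) t :=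
  A.hasFDerivAt.comp_hasDerivAt t (hasDerivAt_flow A x t)

theorem norm_flow_le {A : H →L[ℝ] H} (hA : ∀ x, ⟪x, A x⟫_ℝ ≤ 0) (x : H) {t : ℝ} (ht : 0 ≤ t) :
    ‖flow A x t‖ ≤ ‖x‖ := by
  simpa only [flow_zero] using
    norm_sq_antitoneOn (fun t _ => hasDerivAt_flow A x t) (fun t _ => hA _) ht

theorem norm_apply_flow_le {A : H →L[ℝ] H} (hA : ∀ x, ⟪x, A x⟫_ℝ ≤ 0) (x : H) {t : ℝ}
    (ht : 0 ≤ t) : ‖A (flow A x t)‖ ≤ ‖A x‖ := by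
  simpa only [flow_zero] using
    norm_sq_antitoneOn (fun t _ => hasDerivAt_apply_flow A x t) (fun t _ => hA _) ht

/-- Trajectories of a maximal dissipative linear relation on a Hilbert space, with their Yosida
approximations. -/
theorem exists_trajectory (hdiss : ∀ p ∈ G, ⟪p.1, p.2⟫_ℝ ≤ 0)
    (hrange : ∀ c : ℝ, 0 < c → ∀ g, ∃ p ∈ G, c • p.1 - p.2 = g)
    (hfun : ∀ v, ((0 : H), v) ∈ G → v = 0) (x : H) :
    ∃ u : ℝ → H, ContinuousOn u (Ici 0) ∧ u 0 = x ∧ ∃ un vn dn : ℕ → ℝ → H,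
      ∀ t, 0 ≤ t → (∀ n, un n 0 = x) ∧ (∀ n, HasDerivAt (un n) (dn n t) t) ∧
        (∀ n, (vn n t, dn n t) ∈ G) ∧ (∀ n, Continuous (dn n) ∧ Continuous (vn n)) ∧
        (∀ n, ‖un n t‖ ≤ ‖x‖) ∧ (∀ n, ‖vn n t‖ ≤ ‖x‖) ∧
        Tendsto (fun n => un n t) atTop (𝓝 (u t)) ∧ Tendsto (fun n => vn n t) atTop (𝓝 (u t)) := by
  have hpos : ∀ n : ℕ, (0 : ℝ) < n + 1 := fun n => Nat.cast_add_one_pos n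
  choose J hJ hJG using fun n : ℕ => exists_resolvent hdiss hrange (hpos n)
  -- The Yosida approximations: bounded, dissipative, and with `(J n g, A n g) ∈ G`.
  let A : ℕ → H →L[ℝ] H := fun n => ((n : ℝ) + 1) • (J n - 1)
  have hA : ∀ n g, A n g = ((n : ℝ) + 1) • (J n g - g) := fun n g => rfl
  have hJA : ∀ n g, J n g = g + ((n : ℝ) + 1)⁻¹ • A n g := fun n g => by
    rw [hA, smul_smul, inv_mul_cancel₀ (hpos n).ne', one_smul]; abel
  have hAG : ∀ n g, (J n g, A n g) ∈ G := fun n g => hJG n g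
  have hAdiss : ∀ n g, ⟪g, A n g⟫_ℝ ≤ 0 := fun n g => by
    have h1 := hdiss _ (hAG n g)
    simp only [hJA n g, inner_add_left, real_inner_smul_left, real_inner_self_eq_norm_sq] at h1
    have : 0 ≤ ((n : ℝ) + 1)⁻¹ * ‖A n g‖ ^ 2 := by have := hpos n; positivity
    linarith
  -- Dissipativity of `(J n a, A n a) - (a, b)`, whose first component is a positive multiple of `A
  -- n a`. On the domain of `G` the approximations are thus bounded uniformly in `n`.
  have hAle : ∀ n {a b}, (a, b) ∈ G → ‖A n a‖ ≤ ‖b‖ := fun n {a b} h => by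
    have h1 := hdiss _ (G.sub_mem (hAG n a) h)
    simp only [hJA n a, Prod.mk_sub_mk, add_sub_cancel_left, real_inner_smul_left, inner_sub_right,
      real_inner_self_eq_norm_sq, ← mul_sub] at h1
    have h2 : ‖A n a‖ ^ 2 - ⟪A n a, b⟫_ℝ ≤ 0 := by
      by_contra! h3
      exact absurd h1 (not_le.2 (mul_pos (inv_pos.2 (hpos n)) h3))
    have h3 := real_inner_le_norm (A n a) b
    by_contra! h4
    nlinarith [norm_nonneg b, norm_nonneg (A n a)]
  have hcauchy : ∀ n k {a b}, (a, b) ∈ G → ∀ t, 0 ≤ t →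
      ‖flow (A n) a t - flow (A k) a t‖ ^ 2
        ≤ t * (4 * (((n : ℝ) + 1)⁻¹ + ((k : ℝ) + 1)⁻¹) * ‖b‖ ^ 2) := by
    intro n k a b hab t ht
    set M := 4 * (((n : ℝ) + 1)⁻¹ + ((k : ℝ) + 1)⁻¹) * ‖b‖ ^ 2 with hM
    have hd : ∀ s, HasDerivAt (fun s => ‖flow (A n) a s - flow (A k) a s‖ ^ 2)
        (2 * ⟪flow (A n) a s - flow (A k) a s, A n (flow (A n) a s) - A k (flow (A k) a s)⟫_ℝ) s :=
      fun s => ((hasDerivAt_flow (A n) a s).sub (hasDerivAt_flow (A k) a s)).norm_sq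
    have hle : ∀ s, 0 ≤ s →
        2 * ⟪flow (A n) a s - flow (A k) a s, A n (flow (A n) a s) - A k (flow (A k) a s)⟫_ℝ ≤ M := by
      intro s hs
      set y := flow (A n) a s
      set z := flow (A k) a s
      have h1 := hdiss _ (G.sub_mem (hAG n y) (hAG k z))
      simp only [Prod.mk_sub_mk, hJA n y, hJA k z] at h1
      have hy : ‖A n y‖ ≤ ‖b‖ := (norm_apply_flow_le (hAdiss n) a hs).trans (hAle n hab)
      have hz : ‖A k z‖ ≤ ‖b‖ := (norm_apply_flow_le (hAdiss k) a hs).trans (hAle k hab)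
      -- The difference of the flows is rewritten through the resolvents. Their part of the inner
      -- product is nonpositive by dissipativity of `G`, and the remainder is of order `1/(n+1) +
      -- 1/(k+1)`.
      have e : y - z = (y + ((n : ℝ) + 1)⁻¹ • A n y - (z + ((k : ℝ) + 1)⁻¹ • A k z))
          - ((n : ℝ) + 1)⁻¹ • A n y + ((k : ℝ) + 1)⁻¹ • A k z := by abel
      rw [e, inner_add_left, inner_sub_left, real_inner_smul_left, real_inner_smul_left]
      have hdiff : ‖A n y - A k z‖ ≤ 2 * ‖b‖ := (norm_sub_le _ _).trans (by linarith)
      have h2 : |⟪A n y, A n y - A k z⟫_ℝ| ≤ ‖b‖ * (2 * ‖b‖) := (abs_real_inner_le_norm _ _).trans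
        (mul_le_mul hy hdiff (norm_nonneg _) (norm_nonneg _))
      have h3 : |⟪A k z, A n y - A k z⟫_ℝ| ≤ ‖b‖ * (2 * ‖b‖) := (abs_real_inner_le_norm _ _).trans
        (mul_le_mul hz hdiff (norm_nonneg _) (norm_nonneg _))
      have h4 := mul_le_mul_of_nonneg_left (abs_le.1 h2).1 (inv_pos.2 (hpos n)).le
      have h5 := mul_le_mul_of_nonneg_left (abs_le.1 h3).2 (inv_pos.2 (hpos k)).le
      rw [hM]
      linarith
    have := image_le_of_deriv_right_le_deriv_boundary (a := 0) (b := t)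
      (f := fun s => ‖flow (A n) a s - flow (A k) a s‖ ^ 2) (B := fun s => s * M)
      (B' := fun _ => M)
      (fun s _ => (hd s).continuousAt.continuousWithinAt)
      (fun s _ => (hd s).hasDerivWithinAt) (by simp [flow_zero])
      (by fun_prop) (fun s _ => by simpa using ((hasDerivAt_id s).mul_const M).hasDerivWithinAt)
      (fun s hs => hle s hs.1) (x := t) ⟨ht, le_rfl⟩
    exact this
  have hdense : ∀ g : H, ∀ ε : ℝ, 0 < ε → ∃ p ∈ G, ‖g - p.1‖ < ε := by
    -- If `z = u - v` with `(u,v) ∈ G` is orthogonal to the domain, then `‖u‖² = ⟪u,v⟫ ≤ 0`. So `u =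
    -- 0`, and `v = 0` because the relation is single-valued at zero.
    have : (G.map (LinearMap.fst ℝ H H)).topologicalClosure = ⊤ := by
      rw [Submodule.topologicalClosure_eq_top_iff, Submodule.eq_bot_iff]
      intro z hz
      obtain ⟨⟨u, v⟩, hp, he⟩ := hrange 1 one_pos z
      have h1 := (Submodule.mem_orthogonal _ z).1 hz u ⟨_, hp, rfl⟩
      have h2 := hdiss _ hp
      simp only [one_smul] at he h2
      rw [← he, inner_sub_right, real_inner_self_eq_norm_sq] at h1
      have h3 : u = 0 := by
        rw [← norm_eq_zero, ← sq_eq_zero_iff]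
        nlinarith [sq_nonneg ‖u‖]
      subst h3
      rw [← he, hfun v hp, sub_zero]
    intro g ε hε
    have hg : g ∈ closure ((G.map (LinearMap.fst ℝ H H) : Submodule ℝ H) : Set H) := by
      rw [← Submodule.topologicalClosure_coe, this]; trivial
    obtain ⟨y, ⟨p, hp, rfl⟩, hy⟩ := Metric.mem_closure_iff.1 hg ε hε
    exact ⟨p, hp, by rwa [dist_eq_norm] at hy⟩
  have hlim0 : Tendsto (fun n : ℕ => ((n : ℝ) + 1)⁻¹) atTop (𝓝 0) := by
    simpa only [one_div] using tendsto_one_div_add_atTop_nhds_zero_nat (𝕜 := ℝ)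
  have hunif : ∀ T : ℝ, 0 ≤ T → UniformCauchySeqOn (fun n => flow (A n) x) atTop (Icc 0 T) := by
    intro T hT
    rw [Metric.uniformCauchySeqOn_iff]
    intro ε hε
    -- The Cauchy estimate holds for initial data in the domain. General data are approximated by
    -- such data, the approximate flows being contractions.
    obtain ⟨⟨a, b⟩, hab, ha⟩ := hdense x (ε / 3) (by positivity)
    have h1 : Tendsto (fun n : ℕ => T * (4 * (2 * ((n : ℝ) + 1)⁻¹) * ‖b‖ ^ 2)) atTop (𝓝 0) := by
      simpa using (((hlim0.const_mul 2).const_mul 4).mul_const (‖b‖ ^ 2)).const_mul T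
    obtain ⟨N, hN⟩ := (h1.eventually (gt_mem_nhds (show 0 < (ε / 3) ^ 2 by positivity))).exists
    have hinv : ∀ n ≥ N, ((n : ℝ) + 1)⁻¹ ≤ ((N : ℝ) + 1)⁻¹ := fun n hn =>
      inv_anti₀ (hpos N) (by have : (N : ℝ) ≤ n := by exact_mod_cast hn
                             linarith)
    refine ⟨N, fun n hn k hk t ht => ?_⟩
    have h2 : ‖flow (A n) a t - flow (A k) a t‖ < ε / 3 := by
      refine lt_of_pow_lt_pow_left₀ 2 (by positivity) (((hcauchy n k hab t ht.1).trans ?_).trans_lt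
        hN)
      have := hinv n hn
      have := hinv k hk
      have h0 : 0 ≤ ((n : ℝ) + 1)⁻¹ + ((k : ℝ) + 1)⁻¹ := by
        have := hpos n; have := hpos k; positivity
      refine mul_le_mul ht.2 ?_ (by positivity) hT
      gcongr
      linarith
    have h3 : ‖flow (A n) x t - flow (A n) a t‖ < ε / 3 := by
      rw [← flow_sub]; exact (norm_flow_le (hAdiss n) _ ht.1).trans_lt ha
    have h4 : ‖flow (A k) x t - flow (A k) a t‖ < ε / 3 := by
      rw [← flow_sub]; exact (norm_flow_le (hAdiss k) _ ht.1).trans_lt ha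
    rw [dist_eq_norm]
    have e : flow (A n) x t - flow (A k) x t = (flow (A n) x t - flow (A n) a t)
        + (flow (A n) a t - flow (A k) a t) - (flow (A k) x t - flow (A k) a t) := by abel
    rw [e]
    refine (norm_sub_le _ _).trans_lt ?_
    linarith [norm_add_le (flow (A n) x t - flow (A n) a t) (flow (A n) a t - flow (A k) a t)]
  have hex : ∀ t, ∃ y, 0 ≤ t → Tendsto (fun n => flow (A n) x t) atTop (𝓝 y) := by
    intro t
    by_cases ht : 0 ≤ t
    · obtain ⟨y, hy⟩ := cauchySeq_tendsto_of_complete ((hunif t ht).cauchySeq ⟨ht, le_rfl⟩)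
      exact ⟨y, fun _ => hy⟩
    · exact ⟨0, fun h => absurd h ht⟩
  choose u hu using hex
  have hJlim : ∀ g, Tendsto (fun n => J n g) atTop (𝓝 g) := by
    intro g
    rw [Metric.tendsto_atTop]
    intro ε hε
    obtain ⟨⟨a, b⟩, hab, ha⟩ := hdense g (ε / 3) (by positivity)
    have h1 : Tendsto (fun n : ℕ => ((n : ℝ) + 1)⁻¹ * ‖b‖) atTop (𝓝 0) := by
      simpa using hlim0.mul_const ‖b‖
    obtain ⟨N, hN⟩ := eventually_atTop.1
      (h1.eventually (gt_mem_nhds (show 0 < ε / 3 by positivity)))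
    refine ⟨N, fun n hn => ?_⟩
    rw [dist_eq_norm]
    have e : J n g - g = J n (g - a) + ((n : ℝ) + 1)⁻¹ • A n a - (g - a) := by
      rw [map_sub, hJA n a]; abel
    have h2 : ‖((n : ℝ) + 1)⁻¹ • A n a‖ < ε / 3 := by
      rw [norm_smul, Real.norm_of_nonneg (inv_pos.2 (hpos n)).le]
      exact (mul_le_mul_of_nonneg_left (hAle n hab) (inv_pos.2 (hpos n)).le).trans_lt (hN n hn)
    rw [e]
    refine (norm_sub_le _ _).trans_lt ?_
    have h3 := norm_add_le (J n (g - a)) (((n : ℝ) + 1)⁻¹ • A n a)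
    have h4 := hJ n (g - a)
    simp only at ha
    linarith
  refine ⟨u, fun t ht => ?_, ?_, fun n => flow (A n) x, fun n t => J n (flow (A n) x t),
    fun n t => A n (flow (A n) x t), fun t ht => ⟨fun n => flow_zero _ _,
      fun n => hasDerivAt_flow _ _ _, fun n => hAG n _, fun n => ?_,
      fun n => norm_flow_le (hAdiss n) _ ht,
      fun n => (hJ n _).trans (norm_flow_le (hAdiss n) _ ht), hu t ht, ?_⟩⟩
  · have ht0 : (0 : ℝ) ≤ t := ht
    have h1 := (hunif (t + 1) (by linarith)).tendstoUniformlyOn_of_tendsto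
      fun s hs => hu s hs.1
    have h2 : ContinuousOn u (Icc 0 (t + 1)) := h1.continuousOn <| Frequently.of_forall fun n s _ =>
      (hasDerivAt_flow (A n) x s).continuousAt.continuousWithinAt
    refine (h2 t ⟨ht0, by linarith⟩).mono_of_mem_nhdsWithin ?_
    filter_upwards [self_mem_nhdsWithin, mem_nhdsWithin_of_mem_nhds (Iio_mem_nhds (lt_add_one t))]
      with s h3 h4 using ⟨h3, h4.le⟩
  · have := hu 0 le_rfl
    simp only [flow_zero] at this
    exact tendsto_nhds_unique this tendsto_const_nhds
  · have hc : Continuous (flow (A n) x) := continuous_iff_continuousAt.2 fun s =>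
      (hasDerivAt_flow (A n) x s).continuousAt
    exact ⟨(A n).continuous.comp hc, (J n).continuous.comp hc⟩
  · have h1 : Tendsto (fun n => J n (flow (A n) x t - u t)) atTop (𝓝 0) := by
      refine squeeze_zero_norm (fun n => hJ n _) ?_
      have := ((hu t ht).sub_const (u t)).norm
      simpa using this
    have h2 := h1.add (hJlim (u t))
    simp only [map_sub, sub_add_cancel, zero_add] at h2
    exact h2

end Dissipative
end
-- The backstepping transformation
noncomputable section

namespace HypSystem

variable {m p : ℕ}

/-- The spatial derivative of `W` prescribed by `V = -Λ W' + Σ W`. -/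
def slope (S : HypSystem m p) (W V : StateSpace (m + p)) (i : Fin (m + p)) (x : ℝ) : ℝ :=
  (S.speed i x)⁻¹ * (∑ k, S.coup i k x * W x k - V x i)

theorem measurable_slope (S : HypSystem m p) (W V : StateSpace (m + p)) (i : Fin (m + p)) :
    Measurable (S.slope W V i) :=
  (S.continuous_speed i).measurable.inv.mul ((Finset.measurable_sum _ fun k _ =>
    (S.continuous_coup i k).measurable.mul (StateSpace.measurable_coord W k)).sub
      (StateSpace.measurable_coord V i))

theorem speed_mul_slope (S : HypSystem m p) (W V : StateSpace (m + p)) (i : Fin (m + p)) (x : ℝ) :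
    S.speed i x * S.slope W V i x = ∑ k, S.coup i k x * W x k - V x i := by
  rw [slope, mul_inv_cancel_left₀ (S.speed_ne_zero i x)]

/-- The right-hand side of the equation for `K_ij` along characteristics. -/
def kernelRhs (S : HypSystem m p) (K : Fin (m + p) → Fin (m + p) → ℝ × ℝ → ℝ)
    (i j : Fin (m + p)) (q : ℝ × ℝ) : ℝ :=
  -∑ k, (S.coup k j q.2 + if k = j then S.speedDeriv j q.2 else 0) * K i k q

/-- Summed over the columns, the right-hand side is arranged so as to cancel, inside `momentRate`,
the terms with `λ_j'` and the coupling contained in `λ_j f_j'`. Only the moment of `V` is left. -/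
theorem sum_kernelRhs_mul (S : HypSystem m p) (K : Fin (m + p) → Fin (m + p) → ℝ × ℝ → ℝ)
    (i : Fin (m + p)) (q : ℝ × ℝ) (f : Fin (m + p) → ℝ) :
    ∑ j, S.kernelRhs K i j q * f j
      = -∑ k, K i k q * ∑ j, S.coup k j q.2 * f j - ∑ j, K i j q * (S.speedDeriv j q.2 * f j) := by
  have h1 : ∀ j, S.kernelRhs K i j q * f j
      = -(∑ k, K i k q * (S.coup k j q.2 * f j)) - K i j q * (S.speedDeriv j q.2 * f j) := by
    intro j
    have : ∑ k, (S.coup k j q.2 + if k = j then S.speedDeriv j q.2 else 0) * K i k q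
        = ∑ k, S.coup k j q.2 * K i k q + S.speedDeriv j q.2 * K i j q := by
      simp only [add_mul, Finset.sum_add_distrib, ite_mul, zero_mul, Finset.sum_ite_eq',
        Finset.mem_univ, if_true]
    rw [kernelRhs, this, neg_mul, add_mul, Finset.sum_mul, neg_add, sub_eq_add_neg]
    congr 2
    · exact Finset.sum_congr rfl fun k _ => by ring
    · ring
  simp only [h1, Finset.sum_sub_distrib, Finset.sum_neg_distrib, Finset.mul_sum]
  rw [Finset.sum_comm]

/-- A kernel carries information on the triangle only. Extension by zero makes it measurable and
bounded on the plane, and the equation is unaffected because characteristic arcs lie in the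
triangle. -/
theorem exists_kernel_extension (S : HypSystem m p) {k₁ k₂ : Fin (m + p) → Fin (m + p) → ℝ → ℝ}
    {K : Fin (m + p) → Fin (m + p) → ℝ × ℝ → ℝ} (hK : S.IsKernel k₁ k₂ K) :
    ∃ (κ : Fin (m + p) → Fin (m + p) → ℝ × ℝ → ℝ) (C : ℝ), 0 ≤ C ∧
      (∀ i j, Measurable (κ i j)) ∧ (∀ i j q, |κ i j q| ≤ C) ∧
      (∀ i j, ∀ q ∈ triangle, κ i j q = K i j q) ∧
      (∀ i j, Measurable (S.kernelRhs κ i j)) ∧ (∀ i j q, |S.kernelRhs κ i j q| ≤ C) ∧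
      ∀ i j a b X Y, S.IsCharArc i j a b X Y →
        κ i j (X b, Y b) - κ i j (X a, Y a) = ∫ s in a..b, S.kernelRhs κ i j (X s, Y s) := by
  obtain ⟨M, hM⟩ := hK.bounded
  obtain ⟨Cs, hCs, -, hspd, hcoup, -⟩ := S.exists_coeff_bound
  set κ : Fin (m + p) → Fin (m + p) → ℝ × ℝ → ℝ := fun i j => triangle.indicator (K i j) with hκ
  have hκm : ∀ i j, Measurable (κ i j) := fun i j => by
    refine measurable_of_restrict_of_restrict_compl isClosed_triangle.measurableSet ?_ ?_
    · have : triangle.domRestrict (κ i j) = triangle.domRestrict (K i j) := by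
        ext q; exact indicator_of_mem q.2 _
      rw [this]; exact hK.measurable i j
    · have : triangleᶜ.domRestrict (κ i j) = fun _ => 0 := by
        ext q; exact indicator_of_notMem q.2 _
      rw [this]; exact measurable_const
  have hκe : ∀ i j, ∀ q ∈ triangle, κ i j q = K i j q := fun i j q hq => indicator_of_mem hq _
  have hκC : ∀ i j q, |κ i j q| ≤ |M| := fun i j q => by
    by_cases hq : q ∈ triangle
    · rw [hκe i j q hq]; exact (hM i j q hq).trans (le_abs_self _)
    · rw [hκ]; simp only [indicator_of_notMem hq, abs_zero]; exact abs_nonneg _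
  refine ⟨κ, |M| + (m + p : ℕ) * ((Cs + Cs) * |M|), by positivity, hκm,
    fun i j q => (hκC i j q).trans (le_add_of_nonneg_right (by positivity)), hκe,
    fun i j => ?_, fun i j q => ?_, fun i j a b X Y hXY => ?_⟩
  · refine (Finset.measurable_sum _ fun k _ => ?_).neg
    refine Measurable.mul (((S.continuous_coup k j).measurable.comp measurable_snd).add ?_)
      (hκm i k)
    split_ifs
    · exact (S.continuous_speedDeriv j).measurable.comp measurable_snd
    · exact measurable_const
  · rw [kernelRhs, abs_neg]
    refine (Finset.abs_sum_le_sum_abs _ _).trans (le_trans ?_ (le_add_of_nonneg_left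
      (abs_nonneg M)))
    calc _ ≤ ∑ _k : Fin (m + p), (Cs + Cs) * |M| := Finset.sum_le_sum fun k _ => by
          rw [abs_mul]
          refine mul_le_mul ((abs_add_le _ _).trans (add_le_add (hcoup _ _ _) ?_)) (hκC _ _ _)
            (abs_nonneg _) (by positivity)
          split_ifs
          · exact hspd _ _
          · rw [abs_zero]; exact hCs.le
      _ = _ := by simp
  · have hmem : ∀ s ∈ Icc a b, (X s, Y s) ∈ triangle := fun s hs => (hXY.mem s hs).1
    rw [hκe i j _ (hmem b ⟨hXY.le, le_rfl⟩), hκe i j _ (hmem a ⟨le_rfl, hXY.le⟩),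
      hK.equation i j a b X Y hXY]
    refine intervalIntegral.integral_congr fun s hs => ?_
    rw [uIcc_of_le hXY.le] at hs
    have hY : Y s ∈ Icc (0 : ℝ) 1 := snd_mem_of_mem_triangle (hmem s hs)
    simp only [kernelRhs, S.coup_of_mem _ _ hY, S.speedDeriv_of_mem _ hY, hκe _ _ _ (hmem s hs)]

/-- The boundary coefficients of the target system. -/
def traceCoeff (S : HypSystem m p) (κ : Fin (m + p) → Fin (m + p) → ℝ × ℝ → ℝ)
    (i : Fin (m + p)) (r : Fin m) (x : ℝ) : ℝ :=
  -(S.speed (Fin.castAdd p r) 0 * κ i (Fin.castAdd p r) (x, 0)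
    + ∑ s, S.speed (Fin.natAdd m s) 0 * κ i (Fin.natAdd m s) (x, 0) * S.Q s r)

/-- The boundary condition at `x = 0` expresses the values of `f₊` through those of `f₋`, so the
trace term depends on `f₋(0)` alone. -/
theorem sum_speed_mul_kernel (S : HypSystem m p)
    (κ : Fin (m + p) → Fin (m + p) → ℝ × ℝ → ℝ) (i : Fin (m + p)) (x : ℝ)
    {f : Fin (m + p) → ℝ} (hf : ∀ s, f (Fin.natAdd m s) = ∑ r, S.Q s r * f (Fin.castAdd p r)) :
    ∑ j, S.speed j 0 * κ i j (x, 0) * f j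
      = -∑ r, S.traceCoeff κ i r x * f (Fin.castAdd p r) := by
  rw [Fin.sum_univ_add]
  simp only [hf, traceCoeff, neg_mul, Finset.sum_neg_distrib, neg_neg, add_mul,
    Finset.sum_add_distrib, Finset.mul_sum, Finset.sum_mul]
  rw [Finset.sum_comm]
  congr 1
  exact Finset.sum_congr rfl fun r _ => Finset.sum_congr rfl fun s _ => by ring

theorem exists_traceCoeff_bound (S : HypSystem m p) {κ : Fin (m + p) → Fin (m + p) → ℝ × ℝ → ℝ}
    {C : ℝ} (hC : 0 ≤ C) (hκC : ∀ i j q, |κ i j q| ≤ C) :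
    ∃ M : ℝ, 0 < M ∧ ∀ i r x, |S.traceCoeff κ i r x| ≤ M := by
  obtain ⟨Cs, hCs, hsp, -, -, hQ⟩ := S.exists_coeff_bound
  refine ⟨Cs * C + p * (Cs * C * Cs) + 1, by positivity, fun i r x => ?_⟩
  rw [traceCoeff, abs_neg]
  have h1 : ∀ j, |S.speed j 0 * κ i j (x, 0)| ≤ Cs * C := fun j => by
    rw [abs_mul]
    exact mul_le_mul (hsp _ _) (hκC _ _ _) (abs_nonneg _) hCs.le
  have h2 : |∑ s, S.speed (Fin.natAdd m s) 0 * κ i (Fin.natAdd m s) (x, 0) * S.Q s r|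
      ≤ p * (Cs * C * Cs) := by
    refine (Finset.abs_sum_le_sum_abs _ _).trans ?_
    calc _ ≤ ∑ _s : Fin p, Cs * C * Cs := Finset.sum_le_sum fun s _ => by
          rw [abs_mul]
          exact mul_le_mul (h1 _) (hQ _ _) (abs_nonneg _) (by positivity)
      _ = _ := by simp
  have := abs_add_le (S.speed (Fin.castAdd p r) 0 * κ i (Fin.castAdd p r) (x, 0))
    (∑ s, S.speed (Fin.natAdd m s) 0 * κ i (Fin.natAdd m s) (x, 0) * S.Q s r)
  linarith [h1 (Fin.castAdd p r)]

theorem measurable_traceCoeff (S : HypSystem m p)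
    {κ : Fin (m + p) → Fin (m + p) → ℝ × ℝ → ℝ} (hκ : ∀ i j, Measurable (κ i j))
    (i : Fin (m + p)) (r : Fin m) : Measurable (S.traceCoeff κ i r) := by
  have h0 : ∀ j, Measurable fun x : ℝ => κ i j (x, 0) := fun j =>
    (hκ i j).comp (measurable_id.prodMk measurable_const)
  exact (((h0 _).const_mul _).add (Finset.measurable_sum _ fun s _ =>
    ((h0 _).const_mul _).mul_const _)).neg

theorem mem_triangle_diag {x : ℝ} (hx : x ∈ Icc (0 : ℝ) 1) : (x, x) ∈ triangle :=
  ⟨hx.1, le_rfl, hx.2⟩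

theorem mem_triangle_bottom {x : ℝ} (hx : x ∈ Icc (0 : ℝ) 1) : (x, (0 : ℝ)) ∈ triangle :=
  ⟨le_rfl, hx.1, hx.2⟩

/-- This is the purpose of the kernel condition on `ξ = 0`. The trace matrix of the target system is
strictly lower triangular in its first `m` rows, so an outgoing component excites only components of
larger index. -/
theorem traceCoeff_eq_zero (S : HypSystem m p) {k₁ k₂ : Fin (m + p) → Fin (m + p) → ℝ → ℝ}
    {K κ : Fin (m + p) → Fin (m + p) → ℝ × ℝ → ℝ} (hK : S.IsKernel k₁ k₂ K)
    (hκ : ∀ i j, ∀ q ∈ triangle, κ i j q = K i j q) {i : Fin (m + p)} {r : Fin m}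
    (hir : (i : ℕ) ≤ r) {x : ℝ} (hx : x ∈ Ioc (0 : ℝ) 1) : S.traceCoeff κ i r x = 0 := by
  have hi : i = Fin.castAdd p ⟨i, hir.trans_lt r.2⟩ := by ext; rfl
  have h0 : (0 : ℝ) ∈ Icc (0 : ℝ) 1 := ⟨le_rfl, zero_le_one⟩
  have hb := hK.bottom_neg ⟨i, hir.trans_lt r.2⟩ r hir x hx
  rw [← hi] at hb
  simp only [traceCoeff, hκ _ _ _ (mem_triangle_bottom ⟨hx.1.le, hx.2⟩), hb, S.speed_of_mem _ h0]
  have := S.lam_ne_zero (Fin.castAdd p r) h0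
  field_simp
  ring

/-- The diagonal condition on the kernel makes the trace on `ξ = x` reproduce the coupling `Σ f`,
which then cancels the coupling in the equation. At `j = i`, where no condition is imposed, both
sides vanish because `σ_ii = 0`. -/
theorem sum_diag (S : HypSystem m p) {k₁ k₂ : Fin (m + p) → Fin (m + p) → ℝ → ℝ}
    {K κ : Fin (m + p) → Fin (m + p) → ℝ × ℝ → ℝ} (hK : S.IsKernel k₁ k₂ K)
    (hκ : ∀ i j, ∀ q ∈ triangle, κ i j q = K i j q) (i : Fin (m + p)) {x : ℝ}
    (hx : x ∈ Ioc (0 : ℝ) 1) (f : Fin (m + p) → ℝ) :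
    ∑ j, (S.speed i x - S.speed j x) * κ i j (x, x) * f j = ∑ j, S.coup i j x * f j := by
  have hx' : x ∈ Icc (0 : ℝ) 1 := ⟨hx.1.le, hx.2⟩
  refine Finset.sum_congr rfl fun j _ => ?_
  rw [S.coup_of_mem _ _ hx']
  by_cases h : i = j
  · subst h; simp [S.sig_diag x hx' i]
  · rw [hκ _ _ _ (mem_triangle_diag hx'), hK.diagonal i j h x hx, S.speed_of_mem _ hx',
      S.speed_of_mem _ hx']
    have : S.lam i x - S.lam j x ≠ 0 := sub_ne_zero.2 fun h' =>
      h ((S.lam_strictMono x hx').injective h')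
    field_simp

/-- The backstepping transformation removes the coupling of the system. -/
theorem isPrimitive_transform (S : HypSystem m p) {k₁ k₂ : Fin (m + p) → Fin (m + p) → ℝ → ℝ}
    {K κ : Fin (m + p) → Fin (m + p) → ℝ × ℝ → ℝ} (hK : S.IsKernel k₁ k₂ K)
    (hκe : ∀ i j, ∀ q ∈ triangle, κ i j q = K i j q) {C : ℝ}
    (hκ : ∀ i j, Measurable (κ i j)) (hκC : ∀ i j q, |κ i j q| ≤ C)
    (hh : ∀ i j, Measurable (S.kernelRhs κ i j)) (hhC : ∀ i j q, |S.kernelRhs κ i j q| ≤ C)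
    (harc : ∀ i j a b X Y, S.IsCharArc i j a b X Y →
        κ i j (X b, Y b) - κ i j (X a, Y a) = ∫ s in a..b, S.kernelRhs κ i j (X s, Y s))
    {W V : StateSpace (m + p)} {f : Fin (m + p) → ℝ → ℝ} (hfc : ∀ i, Continuous (f i))
    (hWf : ∀ᵐ x ∂unitVolume, ∀ i, W x i = f i x)
    (hf : ∀ i, IsPrimitive (f i) (S.slope W V i) 0 1)
    (hf0 : ∀ s, f (Fin.natAdd m s) 0 = ∑ r, S.Q s r * f (Fin.castAdd p r) 0)
    (i : Fin (m + p)) :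
    IsPrimitive (fun x => f i x - ∫ ξ in (0 : ℝ)..x, ∑ j, κ i j (x, ξ) * f j ξ)
      (fun x => (S.speed i x)⁻¹ * (-(V x i - ∫ ξ in (0 : ℝ)..x, ∑ j, κ i j (x, ξ) * V ξ j)
        + ∑ r, S.traceCoeff κ i r x * f (Fin.castAdd p r) 0)) 0 1 := by
  have hmom := fun j => S.kernel_moment (hκ i j) (hh i j) (hκC i j) (hhC i j) (harc i j) (hfc j)
    (S.measurable_slope W V j) (hf j)
  have key := (hf i).sub (IsPrimitive.sum Finset.univ zero_le_one fun j _ => hmom j)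
  refine key.congr_ae (fun x hx => ?_) ?_
  · congr 1
    refine intervalIntegral.integral_finsetSum fun j _ => ?_
    exact ((hκ i j).comp measurable_prodMk_left).intervalIntegrable_of_bound
      (fun _ => hκC i j _) _ _ |>.mul_continuousOn (hfc j).continuousOn
  · have h0 : ∀ᵐ x ∂unitVolume, x ≠ 0 :=
      ae_restrict_of_ae (Measure.ae_ne volume 0)
    filter_upwards [StateSpace.ae_mem, h0, hWf] with x hx hx0 hWx
    have hx1 : x ∈ Ioc (0 : ℝ) 1 := ⟨lt_of_le_of_ne hx.1 (Ne.symm hx0), hx.2⟩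
    -- The diagonal trace contributes `Σ f`, the trace on `ξ = 0` contributes minus the boundary
    -- excitation, and the integral reduces to minus the moment of `V`.
    have e1 : ∑ j, S.momentRate i j (κ i j) (S.kernelRhs κ i j) (f j) (S.slope W V j) x
        = (S.speed i x)⁻¹ * (∑ j, S.coup i j x * f j x
          - ∑ r, S.traceCoeff κ i r x * f (Fin.castAdd p r) 0
          - ∫ ξ in (0 : ℝ)..x, ∑ j, κ i j (x, ξ) * V ξ j) := by
      simp only [momentRate]
      rw [← Finset.mul_sum, Finset.sum_add_distrib, Finset.sum_add_distrib,
        S.sum_diag hK hκe i hx1 fun j => f j x,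
        S.sum_speed_mul_kernel κ i x (f := fun j => f j 0) hf0,
        ← intervalIntegral.integral_finsetSum fun j _ => S.integrable_momentIntegrand j (hκ i j)
          (hh i j) (hκC i j) (hhC i j) (hfc j) (hf j).integrable hx]
      congr 1
      rw [sub_eq_add_neg, ← intervalIntegral.integral_neg, sub_eq_add_neg]
      congr 1
      refine StateSpace.integral_congr_unit ?_ hx
      filter_upwards [hWf] with ξ hξ
      rw [Finset.sum_add_distrib, S.sum_kernelRhs_mul κ i (x, ξ) fun j => f j ξ]
      simp only [S.speed_mul_slope, hξ, mul_add, mul_sub, Finset.sum_add_distrib,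
        Finset.sum_sub_distrib]
      ring
    rw [e1, slope]
    simp only [hWx]
    ring

end HypSystem
end
-- The generator of the closed loop, and the phases of the target system
noncomputable section

namespace HypSystem

variable {m p : ℕ}

/-- `f` is a continuous representative of `W` satisfying the boundary condition at `x = 0`, and
`V = -Λ f' + Σ f`. -/
structure IsPreProfile (S : HypSystem m p) (W V : StateSpace (m + p))
    (f : Fin (m + p) → ℝ → ℝ) : Prop where
  continuous : ∀ i, Continuous (f i)
  ae_eq : ∀ᵐ x ∂unitVolume, ∀ i, W x i = f i x
  isPrimitive : ∀ i, IsPrimitive (f i) (S.slope W V i) 0 1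
  left : ∀ s, f (Fin.natAdd m s) 0 = ∑ r, S.Q s r * f (Fin.castAdd p r) 0

/-- `f` is the continuous representative of `W` in the domain of the closed-loop generator, and
`V` the image of `W`; `F` is the feedback. -/
structure IsProfile (S : HypSystem m p) (F : Fin m → StateSpace (m + p) →L[ℝ] ℝ)
    (W V : StateSpace (m + p)) (f : Fin (m + p) → ℝ → ℝ) : Prop extends S.IsPreProfile W V f where
  right : ∀ r, f (Fin.castAdd p r) 1 = F r W

theorem slope_add_ae (S : HypSystem m p) (W V W' V' : StateSpace (m + p)) :
    ∀ᵐ x ∂unitVolume, ∀ i, S.slope (W + W') (V + V') i x = S.slope W V i x + S.slope W' V' i x := by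
  filter_upwards [StateSpace.add_ae W W', StateSpace.add_ae V V'] with x h1 h2 i
  simp only [slope, h1, h2, mul_add, Finset.sum_add_distrib]
  ring

theorem slope_smul_ae (S : HypSystem m p) (c : ℝ) (W V : StateSpace (m + p)) :
    ∀ᵐ x ∂unitVolume, ∀ i, S.slope (c • W) (c • V) i x = c * S.slope W V i x := by
  filter_upwards [StateSpace.smul_ae c W, StateSpace.smul_ae c V] with x h1 h2 i
  simp only [slope, h1, h2]
  have : ∑ k, S.coup i k x * (c * W x k) = c * ∑ k, S.coup i k x * W x k := by
    rw [Finset.mul_sum]; exact Finset.sum_congr rfl fun k _ => by ring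
  rw [this]; ring

/-- Pairs `(W, V)` together with profiles of `W`. -/
def profiles (S : HypSystem m p) : Submodule ℝ
    (StateSpace (m + p) × StateSpace (m + p) × (Fin (m + p) → ℝ → ℝ)) where
  carrier := {t | S.IsPreProfile t.1 t.2.1 t.2.2}
  add_mem' := by
    rintro ⟨W, V, f⟩ ⟨W', V', g⟩ hf hg
    refine ⟨fun i => (hf.continuous i).add (hg.continuous i), ?_, fun i => ?_, fun s => ?_⟩
    · filter_upwards [hf.ae_eq, hg.ae_eq, StateSpace.add_ae W W'] with x h1 h2 h3 i
      exact (h3 i).trans (congrArg₂ (· + ·) (h1 i) (h2 i))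
    · exact ((hf.isPrimitive i).add (hg.isPrimitive i)).congr_ae (fun _ _ => rfl)
        ((S.slope_add_ae W V W' V').mono fun x hx => hx i)
    · have h1 := hf.left s
      have h2 := hg.left s
      simp only [Prod.mk_add_mk, Pi.add_apply, mul_add, Finset.sum_add_distrib] at *
      rw [h1, h2]
  zero_mem' := by
    have h0 : ∀ᵐ x ∂unitVolume, ∀ i, (0 : StateSpace (m + p)) x i = 0 :=
      (Lp.coeFn_zero _ 2 unitVolume).mono fun x hx i => by rw [hx]; rfl
    refine ⟨fun i => continuous_const, h0, fun i => ?_, fun s => by simp⟩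
    have : IsPrimitive (fun _ => (0 : ℝ)) (fun _ => 0) 0 1 :=
      ⟨zero_le_one, by simp, fun x _ => by simp⟩
    refine this.congr_ae (fun _ _ => rfl) (h0.mono fun x hx => ?_)
    simp [slope]
  smul_mem' := by
    rintro c ⟨W, V, f⟩ hf
    refine ⟨fun i => (hf.continuous i).const_mul c, ?_, fun i => ?_, fun s => ?_⟩
    · filter_upwards [hf.ae_eq, StateSpace.smul_ae c W] with x h1 h2 i
      exact (h2 i).trans (congrArg (c * ·) (h1 i))
    · exact ((hf.isPrimitive i).const_mul c).congr_ae (fun _ _ => rfl)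
        ((S.slope_smul_ae c W V).mono fun x hx => hx i)
    · have h1 := hf.left s
      simp only [Prod.smul_mk, Pi.smul_apply, smul_eq_mul] at *
      rw [h1, Finset.mul_sum]
      exact Finset.sum_congr rfl fun r _ => by ring

/-- The values of a profile on the controlled boundary, relative to the feedback. -/
def boundaryDefect (F : Fin m → StateSpace (m + p) →L[ℝ] ℝ) :
    (StateSpace (m + p) × StateSpace (m + p) × (Fin (m + p) → ℝ → ℝ)) →ₗ[ℝ] (Fin m → ℝ) where
  toFun t r := t.2.2 (Fin.castAdd p r) 1 - F r t.1
  map_add' t t' := by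
    ext r
    simp only [Prod.snd_add, Prod.fst_add, Pi.add_apply, map_add]
    ring
  map_smul' c t := by
    ext r
    simp only [Prod.smul_snd, Prod.smul_fst, Pi.smul_apply, map_smul, smul_eq_mul,
      RingHom.id_apply]
    ring

/-- The graph of the generator of the closed loop. -/
def generator (S : HypSystem m p) (F : Fin m → StateSpace (m + p) →L[ℝ] ℝ) :
    Submodule ℝ (StateSpace (m + p) × StateSpace (m + p)) :=
  (S.profiles ⊓ LinearMap.ker (boundaryDefect F)).map
    ((LinearMap.fst ℝ _ _).prod ((LinearMap.fst ℝ _ _).comp (LinearMap.snd ℝ _ _)))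

theorem mem_generator {S : HypSystem m p} {F : Fin m → StateSpace (m + p) →L[ℝ] ℝ}
    {W V : StateSpace (m + p)} : (W, V) ∈ S.generator F ↔ ∃ f, S.IsProfile F W V f := by
  constructor
  · rintro ⟨⟨W', V', f⟩, ⟨h1, h2⟩, h3⟩
    obtain ⟨rfl, rfl⟩ := Prod.mk.inj h3
    exact ⟨f, h1, fun r => sub_eq_zero.1 (congrFun (LinearMap.mem_ker.1 h2) r)⟩
  · rintro ⟨f, hf⟩
    exact ⟨(W, V, f), ⟨hf.toIsPreProfile, LinearMap.mem_ker.2 (funext fun r =>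
      sub_eq_zero.2 (hf.right r))⟩, rfl⟩

/-- The continuous representative of `0` vanishes identically on `[0,1]`. Its slope then vanishes
almost everywhere by Lebesgue differentiation, and the slope of `0` determines `V`. -/
theorem generator_zero {S : HypSystem m p} {F : Fin m → StateSpace (m + p) →L[ℝ] ℝ}
    {V : StateSpace (m + p)} (h : ((0 : StateSpace (m + p)), V) ∈ S.generator F) : V = 0 := by
  obtain ⟨f, hf⟩ := mem_generator.1 h
  have h0 : ∀ᵐ x ∂unitVolume, ∀ i, (0 : StateSpace (m + p)) x i = 0 :=
    (Lp.coeFn_zero _ 2 unitVolume).mono fun x hx i => by rw [hx]; rfl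
  have hcont : ∀ i, ∀ x ∈ Icc (0 : ℝ) 1, f i x = 0 := fun i => by
    have h1 : f i =ᵐ[volume.restrict (Icc (0 : ℝ) 1)] fun _ => 0 := by
      filter_upwards [hf.ae_eq, h0] with x h1 h2
      rw [← h1 i]; exact h2 i
    exact Measure.eqOn_Icc_of_ae_eq (μ := volume) zero_ne_one h1 (hf.continuous i).continuousOn
      continuousOn_const
  have hslope : ∀ i, S.slope 0 V i =ᵐ[unitVolume] fun _ => 0 := fun i => by
    have h2 := (hf.isPrimitive i).integrable.ae_hasDerivAt_integral
    refine (ae_restrict_iff' measurableSet_Icc).2 ?_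
    filter_upwards [h2, Measure.ae_ne volume 0, Measure.ae_ne volume 1] with x h3 hx0 hx1 hx
    have h4 := h3 (by rwa [uIcc_of_le zero_le_one]) 0 left_mem_uIcc
    have h5 : (fun y => ∫ z in (0 : ℝ)..y, S.slope 0 V i z) =ᶠ[nhds x] fun _ => 0 := by
      filter_upwards [Icc_mem_nhds (lt_of_le_of_ne hx.1 (Ne.symm hx0)) (lt_of_le_of_ne hx.2 hx1)]
        with y hy
      have := (hf.isPrimitive i).eq_add y hy
      rw [hcont i y hy, hcont i 0 ⟨le_rfl, zero_le_one⟩] at this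
      linarith
    exact h4.unique ((hasDerivAt_const x (0 : ℝ)).congr_of_eventuallyEq h5)
  refine StateSpace.ext_ae ?_
  filter_upwards [ae_all_iff.2 hslope, h0] with x h1 h2 i
  have h3 := S.speed_mul_slope 0 V i x
  rw [h1 i] at h3
  simp only [h2, mul_zero, Finset.sum_const_zero] at h3
  rw [h2]; linarith

theorem travel_one_eq (S : HypSystem m p) (i : Fin (m + p)) :
    S.travel i 1 = ∫ x in (0 : ℝ)..1, (S.speed i x)⁻¹ := by
  rw [intervalIntegral.integral_eq_sub_of_hasDerivAt (fun x _ => S.hasDerivAt_travel i x)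
    (((S.continuous_speed i).inv₀ (S.speed_ne_zero i)).intervalIntegrable _ _), S.travel_zero,
    sub_zero]

theorem monotone_sgn_mul_travel (S : HypSystem m p) (i : Fin (m + p)) :
    Monotone fun x => sgn m i * S.travel i x := by
  refine monotone_of_hasDerivAt_nonneg (fun x => (S.hasDerivAt_travel i x).const_mul (sgn m i))
    fun x => ?_
  have h := S.sgn_mul_speed_pos i x
  rcases sgn_eq i with h1 | h1
  · rw [h1, one_mul] at h ⊢; exact (inv_pos.2 h).le
  · rw [h1] at h ⊢
    have : S.speed i x < 0 := by linarith
    have := inv_lt_zero.2 this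
    simp only [Pi.zero_apply]
    linarith

theorem speed_natAdd_pos (S : HypSystem m p) (s : Fin p) (x : ℝ) :
    0 < S.speed (Fin.natAdd m s) x := S.lam_pos _ (unitClamp_mem x) s

theorem finalTime_eq (S : HypSystem m p) (hp : 0 < p) :
    S.finalTime hp = S.travel (Fin.natAdd m ⟨0, hp⟩) 1
      + ∑ r : Fin m, -S.travel (Fin.castAdd p r) 1 := by
  have hi : ∀ i, IntervalIntegrable (fun x => (S.speed i x)⁻¹) volume 0 1 := fun i =>
    ((S.continuous_speed i).inv₀ (S.speed_ne_zero i)).intervalIntegrable _ _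
  have : S.finalTime hp = ∫ x in (0 : ℝ)..1, ((S.speed (Fin.natAdd m ⟨0, hp⟩) x)⁻¹
      + ∑ r : Fin m, -(S.speed (Fin.castAdd p r) x)⁻¹) := by
    refine intervalIntegral.integral_congr fun x hx => ?_
    rw [uIcc_of_le zero_le_one] at hx
    simp only [S.speed_of_mem _ hx, one_div]
    congr 1
    refine Finset.sum_congr rfl fun r _ => ?_
    rw [abs_of_neg (S.lam_neg x hx r), inv_neg]
  have hn : ∀ r ∈ Finset.univ, IntervalIntegrable (fun x => -(S.speed (Fin.castAdd p r) x)⁻¹)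
      volume 0 1 := fun r _ => (hi _).neg
  rw [this, intervalIntegral.integral_add (hi _)
    ((IntervalIntegrable.sum Finset.univ hn).congr fun x _ => by simp),
    intervalIntegral.integral_finsetSum hn, travel_one_eq]
  simp only [intervalIntegral.integral_neg, travel_one_eq]

/-- Remaining travel times along the chain of reflections of the target system. -/
theorem exists_phase (S : HypSystem m p) (hp : 0 < p) :
    ∃ R : Fin (m + p) → ℝ → ℝ, (∀ i x, HasDerivAt (R i) (-(S.speed i x)⁻¹) x) ∧
      (∀ i, ∀ x ∈ Icc (0 : ℝ) 1, 0 ≤ R i x ∧ R i x ≤ S.finalTime hp) ∧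
      ∀ (i : Fin (m + p)) (r : Fin m), (r : ℕ) < i → ∀ x ∈ Icc (0 : ℝ) 1, R i x ≤ R (Fin.castAdd p r) 0 := by
  set τ : Fin m → ℝ := fun r => -S.travel (Fin.castAdd p r) 1 with hτ
  set τ₀ := S.travel (Fin.natAdd m ⟨0, hp⟩) 1 with hτ₀
  have hmn : ∀ r, ∀ x ∈ Icc (0 : ℝ) 1, 0 ≤ -S.travel (Fin.castAdd p r) x ∧
      -S.travel (Fin.castAdd p r) x ≤ τ r := fun r x hx => by
    have h1 := S.monotone_sgn_mul_travel (Fin.castAdd p r) hx.1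
    have h2 := S.monotone_sgn_mul_travel (Fin.castAdd p r) hx.2
    simp only [sgn_castAdd, S.travel_zero] at h1 h2
    exact ⟨by linarith, by rw [hτ]; linarith⟩
  have hmp : ∀ s, ∀ x ∈ Icc (0 : ℝ) 1, 0 ≤ S.travel (Fin.natAdd m s) x ∧
      S.travel (Fin.natAdd m s) x ≤ S.travel (Fin.natAdd m s) 1 := fun s x hx => by
    have h1 := S.monotone_sgn_mul_travel (Fin.natAdd m s) hx.1
    have h2 := S.monotone_sgn_mul_travel (Fin.natAdd m s) hx.2
    simp only [sgn_natAdd, S.travel_zero] at h1 h2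
    exact ⟨by linarith, by linarith⟩
  have hτpos : ∀ r, 0 ≤ τ r := fun r => (hmn r 1 ⟨zero_le_one, le_rfl⟩).1
  have hs : ∀ s, S.travel (Fin.natAdd m s) 1 ≤ τ₀ := fun s => by
    rw [hτ₀, travel_one_eq, travel_one_eq]
    refine intervalIntegral.integral_mono_on zero_le_one
      (((S.continuous_speed _).inv₀ (S.speed_ne_zero _)).intervalIntegrable _ _)
      (((S.continuous_speed _).inv₀ (S.speed_ne_zero _)).intervalIntegrable _ _) fun x _ => ?_
    refine inv_anti₀ (S.speed_natAdd_pos _ x) ?_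
    exact (S.lam_strictMono _ (unitClamp_mem x)).monotone (by
      rw [Fin.le_def]; simp)
  have hτ₀pos : 0 ≤ τ₀ := (hmp _ 1 ⟨zero_le_one, le_rfl⟩).1
  have hfin : S.finalTime hp = τ₀ + ∑ r, τ r := S.finalTime_eq hp
  -- Value of the phase at `x = 0`. A signal of the component `r` leaving through `x = 0` may still
  -- have to cross with all later components `q > r` and finally with the slowest positive one; a
  -- positive component only has to cross to `x = 1`.
  set c : Fin (m + p) → ℝ := Fin.addCases (fun r => τ₀ + ∑ q ∈ Finset.Ioi r, τ q)
    (fun s => S.travel (Fin.natAdd m s) 1) with hc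
  have hcl : ∀ r, c (Fin.castAdd p r) = τ₀ + ∑ q ∈ Finset.Ioi r, τ q := fun r => by
    simp only [hc, Fin.addCases_left]
  have hcr : ∀ s, c (Fin.natAdd m s) = S.travel (Fin.natAdd m s) 1 := fun s => by
    simp only [hc, Fin.addCases_right]
  have hsum : ∀ r, τ r + ∑ q ∈ Finset.Ioi r, τ q = ∑ q ∈ Finset.Ici r, τ q := fun r => by
    rw [← Finset.Ioi_insert, Finset.sum_insert (by simp)]
  refine ⟨fun i x => c i - S.travel i x, fun i x => ?_, fun i => ?_, fun i r => ?_⟩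
  · simpa using (S.hasDerivAt_travel i x).const_sub (c i)
  · refine Fin.addCases (fun r x hx => ?_) (fun s x hx => ?_) i
    · have h1 := hmn r x hx
      have h2 : 0 ≤ ∑ q ∈ Finset.Ioi r, τ q := Finset.sum_nonneg fun q _ => hτpos q
      have h3 : ∑ q ∈ Finset.Ici r, τ q ≤ ∑ q, τ q :=
        Finset.sum_le_sum_of_subset_of_nonneg (Finset.subset_univ _) fun q _ _ => hτpos q
      beta_reduce
      rw [hcl, hfin]
      exact ⟨by linarith, by linarith [hsum r]⟩
    · have h1 := hmp s x hx
      have h2 : 0 ≤ ∑ q, τ q := Finset.sum_nonneg fun q _ => hτpos q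
      beta_reduce
      rw [hcr, hfin]
      exact ⟨by linarith, by linarith [hs s]⟩
  · beta_reduce
    rw [hcl, S.travel_zero, sub_zero]
    refine Fin.addCases (fun q hq x hx => ?_) (fun s _ x hx => ?_) i
    · have h1 := hmn q x hx
      have h2 : ∑ q ∈ Finset.Ici q, τ q ≤ ∑ q ∈ Finset.Ioi r, τ q := by
        refine Finset.sum_le_sum_of_subset_of_nonneg (fun a ha => ?_) fun q _ _ => hτpos q
        rw [Finset.mem_Ici] at ha
        rw [Finset.mem_Ioi]
        exact lt_of_lt_of_le (Fin.lt_def.2 (by simpa using hq)) ha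
      rw [hcl]
      linarith [hsum q]
    · have h1 := hmp s x hx
      have h2 : 0 ≤ ∑ q ∈ Finset.Ioi r, τ q := Finset.sum_nonneg fun q _ => hτpos q
      rw [hcr]
      linarith [hs s]

end HypSystem
end
-- Weighted energy balance and boundary terms
noncomputable section

/-- Weighted energy balance of a scalar transport equation. -/
theorem IsPrimitive.two_mul_integral_le {μ D : ℝ} {w q sp γ δ η : ℝ → ℝ}
    (hw : ∀ x, HasDerivAt w (-(2 * μ) * q x) x) (hq : Continuous q)
    (hwq : ∀ x, w x * (sp x)⁻¹ = q x) (hq0 : ∀ x, 0 ≤ q x)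
    (hδ : IntervalIntegrable δ volume 0 1) (hη : Measurable η) (hηD : ∀ x, |η x| ≤ D)
    (hγ : IsPrimitive γ (fun x => (sp x)⁻¹ * (-δ x + η x)) 0 1) :
    2 * ∫ x in (0 : ℝ)..1, q x * γ x * δ x ≤ (1 - 2 * μ) * (∫ x in (0 : ℝ)..1, q x * γ x ^ 2)
      + (∫ x in (0 : ℝ)..1, q x * η x ^ 2) - w 1 * γ 1 ^ 2 + w 0 * γ 0 ^ 2 := by
  have hγc : ContinuousOn γ (uIcc 0 1) := by
    rw [uIcc_of_le zero_le_one]; exact hγ.continuousOn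
  have hD : 0 ≤ D := (abs_nonneg _).trans (hηD 0)
  have hηi : IntervalIntegrable η volume 0 1 := hη.intervalIntegrable_of_bound hηD 0 1
  have hη2 : IntervalIntegrable (fun x => η x ^ 2) volume 0 1 :=
    (hη.pow_const 2).intervalIntegrable_of_bound (C := D ^ 2) (fun x => by
      rw [abs_pow]; exact pow_le_pow_left₀ (abs_nonneg _) (hηD x) 2) 0 1
  have i1 : IntervalIntegrable (fun x => q x * γ x * δ x) volume 0 1 :=
    hδ.continuousOn_mul (hq.continuousOn.mul hγc)
  have i2 : IntervalIntegrable (fun x => q x * γ x ^ 2) volume 0 1 :=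
    (hq.continuousOn.mul (hγc.pow 2)).intervalIntegrable
  have i3 : IntervalIntegrable (fun x => q x * γ x * η x) volume 0 1 :=
    hηi.continuousOn_mul (hq.continuousOn.mul hγc)
  have i4 : IntervalIntegrable (fun x => q x * η x ^ 2) volume 0 1 :=
    hη2.continuousOn_mul hq.continuousOn
  have hwp : IsPrimitive w (fun x => -(2 * μ) * q x) 0 1 :=
    IsPrimitive.of_hasDerivWithinAt zero_le_one (fun x _ => (hw x).hasDerivWithinAt)
      (continuous_const.mul hq).continuousOn
  -- The balance is the integral over `[0,1]` of the derivative of `w γ²`.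
  have key := hwp.integral_mul (hγ.mul hγ)
  have e : ∀ x, -(2 * μ) * q x * (γ x * γ x) + w x * ((sp x)⁻¹ * (-δ x + η x) * γ x
      + γ x * ((sp x)⁻¹ * (-δ x + η x)))
      = -(2 * μ) * (q x * γ x ^ 2) + (-2 * (q x * γ x * δ x) + 2 * (q x * γ x * η x)) := fun x => by
    rw [← hwq x]; ring
  simp only [e] at key
  rw [intervalIntegral.integral_add (i2.const_mul _) ((i1.const_mul _).add (i3.const_mul _)),
    intervalIntegral.integral_add (i1.const_mul _) (i3.const_mul _),
    intervalIntegral.integral_const_mul, intervalIntegral.integral_const_mul,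
    intervalIntegral.integral_const_mul] at key
  -- Young's inequality with constant one is the source of the `1` in `1 - 2 * μ`; it does not
  -- depend on `μ`.
  have hyoung : 2 * ∫ x in (0 : ℝ)..1, q x * γ x * η x
      ≤ (∫ x in (0 : ℝ)..1, q x * γ x ^ 2) + ∫ x in (0 : ℝ)..1, q x * η x ^ 2 := by
    rw [← intervalIntegral.integral_const_mul, ← intervalIntegral.integral_add i2 i4]
    refine intervalIntegral.integral_mono_on zero_le_one (i3.const_mul 2) (i2.add i4) fun x _ => ?_
    nlinarith [mul_nonneg (hq0 x) (sq_nonneg (γ x - η x))]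
  linarith

namespace HypSystem

variable {m p : ℕ}

namespace StateSpace

variable {n : ℕ}

theorem exists_multiplication {d : Fin n → ℝ → ℝ} (hd : ∀ i, Continuous (d i))
    (h0 : ∀ i x, d i x ≠ 0) :
    ∃ D : StateSpace n →L[ℝ] StateSpace n,
      (∀ W, ∀ᵐ x ∂unitVolume, ∀ i, D W x i = d i x * W x i) ∧ IsUnit D := by
  have hex : ∀ {d : Fin n → ℝ → ℝ}, (∀ i, Continuous (d i)) →
      ∃ D : StateSpace n →L[ℝ] StateSpace n,
        ∀ W, ∀ᵐ x ∂unitVolume, ∀ i, D W x i = d i x * W x i := fun {d} hd => by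
    choose C hC using fun i => (hd i).continuousOn.exists_abs_le_unit
    have hCC : ∀ i, |C i| ≤ ∑ j, |C j| := fun i =>
      Finset.single_le_sum (f := fun j => |C j|) (fun j _ => abs_nonneg _) (Finset.mem_univ i)
    refine exists_operator (fun W i x => d i x * W x i)
      (fun W i => (hd i).measurable.mul (measurable_coord W i))
      (fun W U => (add_ae W U).mono fun x hx i => by rw [hx, mul_add])
      (fun c W => (smul_ae c W).mono fun x hx i => by rw [hx]; ring) (C := ∑ j, |C j|)
      (Finset.sum_nonneg fun j _ => abs_nonneg _) fun W => ?_
    filter_upwards [ae_mem] with x hx i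
    rw [abs_mul]
    exact mul_le_mul (((hC i x hx).trans (le_abs_self _)).trans (hCC i))
      (le_add_of_nonneg_left (norm_nonneg _)) (abs_nonneg _)
      (Finset.sum_nonneg fun j _ => abs_nonneg _)
  obtain ⟨D, hD⟩ := hex hd
  obtain ⟨D', hD'⟩ := hex (d := fun i x => (d i x)⁻¹) fun i => (hd i).inv₀ (h0 i)
  refine ⟨D, hD, isUnit_iff_exists.2 ⟨D', ?_, ?_⟩⟩ <;> refine ContinuousLinearMap.ext fun W =>
    ext_ae ?_
  · filter_upwards [hD (D' W), hD' W] with x h1 h2 i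
    rw [mul_apply_eq_comp, h1, h2, mul_inv_cancel_left₀ (h0 i x)]; rfl
  · filter_upwards [hD' (D W), hD W] with x h1 h2 i
    rw [mul_apply_eq_comp, h1, h2, inv_mul_cancel_left₀ (h0 i x)]; rfl

theorem integral_eq_interval {f : ℝ → ℝ} :
    ∫ x in Icc (0 : ℝ) 1, f x = ∫ x in (0 : ℝ)..1, f x := by
  rw [intervalIntegral.integral_of_le zero_le_one, integral_Icc_eq_integral_Ioc]

theorem norm_sq_bounds {D : StateSpace n →L[ℝ] StateSpace n} {d : Fin n → ℝ → ℝ} {a b : ℝ}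
    (hD : ∀ W, ∀ᵐ x ∂unitVolume, ∀ i, D W x i = d i x * W x i)
    (hab : ∀ i, ∀ x ∈ Icc (0 : ℝ) 1, a ≤ d i x ^ 2 ∧ d i x ^ 2 ≤ b) (W : StateSpace n) :
    a * ‖W‖ ^ 2 ≤ ‖D W‖ ^ 2 ∧ ‖D W‖ ^ 2 ≤ b * ‖W‖ ^ 2 := by
  have hi : ∀ U : StateSpace n, Integrable (fun x => ∑ i, U x i ^ 2) unitVolume := fun U =>
    integrable_finsetSum _ fun j _ => integrable_sq_coord U j
  rw [norm_sq_eq, norm_sq_eq, ← integral_const_mul, ← integral_const_mul]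
  constructor
  · refine integral_mono_ae ((hi W).const_mul a) (hi _) ?_
    filter_upwards [hD W, ae_mem] with x h1 hx
    rw [Finset.mul_sum]
    exact Finset.sum_le_sum fun i _ => by
      rw [h1, mul_pow]; exact mul_le_mul_of_nonneg_right (hab i x hx).1 (sq_nonneg _)
  · refine integral_mono_ae (hi _) ((hi W).const_mul b) ?_
    filter_upwards [hD W, ae_mem] with x h1 hx
    rw [Finset.mul_sum]
    exact Finset.sum_le_sum fun i _ => by
      rw [h1, mul_pow]; exact mul_le_mul_of_nonneg_right (hab i x hx).2 (sq_nonneg _)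

end StateSpace

/-- The boundary terms of the energy balance are dominated by the dissipation at the boundary. -/
theorem sum_boundary_nonpos {θ B : ℝ} (hθ0 : 0 < θ) (hθ1 : θ ≤ 1) (hB : 0 ≤ B)
    (hθB : (m + p : ℕ) * B * θ ≤ 1) {e : Fin m → ℝ} (he : ∀ r, 0 ≤ e r)
    {b : Fin (m + p) → ℝ}
    (hl : ∀ q, b (Fin.castAdd p q) ≤ θ ^ (q : ℕ) * (B * ∑ r : Fin m, if (r : ℕ) < q then e r else 0)
      - θ ^ (q : ℕ) * e q)
    (hr : ∀ s, b (Fin.natAdd m s) ≤ θ ^ (m + s : ℕ) * (B * ∑ r, e r)) :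
    ∑ i, b i ≤ 0 := by
  -- Because `i > r`, the weight of the excited component is smaller than that of the exciting one
  -- by at least a factor `θ`.
  have h1 : ∀ i : Fin (m + p), ∀ r : Fin m, (r : ℕ) < i →
      θ ^ (i : ℕ) * (B * e r) ≤ θ * θ ^ (r : ℕ) * (B * e r) := fun i r hri => by
    refine mul_le_mul_of_nonneg_right ?_ (mul_nonneg hB (he r))
    rw [← pow_succ']
    exact pow_le_pow_of_le_one hθ0.le hθ1 hri
  -- After this estimate every excitation by `e r` is compared with the single dissipative term `θ ^
  -- r * e r`. At most `m + p` components are excited by it, which explains the smallness condition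
  -- on `θ`.
  have h2 : ∀ i : Fin (m + p), b i ≤ ∑ r : Fin m, (θ * θ ^ (r : ℕ) * (B * e r)
      - if (r : ℕ) = i then θ ^ (r : ℕ) * e r else 0) := fun i => by
    have h0 : ∀ r : Fin m, 0 ≤ θ * θ ^ (r : ℕ) * (B * e r) := fun r => by
      have := he r; positivity
    refine Fin.addCases (fun q => ?_) (fun s => ?_) i
    · rw [Finset.sum_sub_distrib]
      have e1 : ∑ r : Fin m, (if (r : ℕ) = (Fin.castAdd p q : Fin (m + p)) then
          θ ^ (r : ℕ) * e r else 0) = θ ^ (q : ℕ) * e q := by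
        simp only [Fin.val_castAdd, Fin.val_inj, Finset.sum_ite_eq', Finset.mem_univ, if_true]
      rw [e1]
      refine (hl q).trans (sub_le_sub_right ?_ _)
      rw [Finset.mul_sum, Finset.mul_sum]
      refine Finset.sum_le_sum fun r _ => ?_
      split_ifs with h
      · simpa using h1 (Fin.castAdd p q) r (by simpa using h)
      · simpa using h0 r
    · refine (hr s).trans ?_
      rw [Finset.mul_sum, Finset.mul_sum]
      refine Finset.sum_le_sum fun r _ => ?_
      rw [if_neg, sub_zero]
      · simpa using h1 (Fin.natAdd m s) r (by simpa using r.2.trans_le (Nat.le_add_right _ _))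
      · have := r.2
        simp only [Fin.val_natAdd]; omega
  refine (Finset.sum_le_sum fun i _ => h2 i).trans ?_
  rw [Finset.sum_comm]
  refine Finset.sum_nonpos fun r _ => ?_
  rw [Finset.sum_sub_distrib]
  have e1 : ∑ i : Fin (m + p), (if (r : ℕ) = i then θ ^ (r : ℕ) * e r else 0)
      = θ ^ (r : ℕ) * e r := by
    have : ∀ i : Fin (m + p), ((r : ℕ) = i) = (Fin.castAdd p r = i) := fun i => by
      rw [Fin.ext_iff, Fin.val_castAdd]
    simp only [this, Finset.sum_ite_eq, Finset.mem_univ, if_true]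
  rw [e1, Finset.sum_const, Finset.card_univ, Fintype.card_fin, nsmul_eq_mul]
  have h3 : 0 ≤ θ ^ (r : ℕ) * e r := mul_nonneg (pow_nonneg hθ0.le _) (he r)
  have := mul_le_mul_of_nonneg_right hθB h3
  linarith

/-- Cauchy–Schwarz that keeps only the indices with nonzero coefficient. The triangular structure of
the trace matrix survives the squaring in this form. -/
theorem sq_sum_le {c y : Fin m → ℝ} {M : ℝ} (hc : ∀ r, |c r| ≤ M) :
    (∑ r, c r * y r) ^ 2 ≤ m * M ^ 2 * ∑ r, if c r = 0 then 0 else y r ^ 2 := by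
  refine (sq_sum_le_card_mul_sum_sq (s := Finset.univ)).trans ?_
  rw [Finset.card_univ, Fintype.card_fin, mul_assoc, Finset.mul_sum _ _ (M ^ 2)]
  refine mul_le_mul_of_nonneg_left (Finset.sum_le_sum fun r _ => ?_) (Nat.cast_nonneg _)
  split_ifs with h
  · simp [h]
  · rw [mul_pow, ← sq_abs (c r)]
    exact mul_le_mul_of_nonneg_right (pow_le_pow_left₀ (abs_nonneg _) (hc r) 2) (sq_nonneg _)

/-- The feedback law as a family of continuous linear functionals. -/
theorem exists_feedback (S : HypSystem m p) {k₁ k₂ : Fin (m + p) → Fin (m + p) → ℝ → ℝ}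
    {K : Fin (m + p) → Fin (m + p) → ℝ × ℝ → ℝ} (hK : S.IsKernel k₁ k₂ K) :
    ∃ F : Fin m → StateSpace (m + p) →L[ℝ] ℝ, ∀ r W,
      F r W = ∫ ξ in Icc (0 : ℝ) 1, ∑ j, K (Fin.castAdd p r) j (1, ξ) * W ξ j := by
  obtain ⟨κ, C, hC, hκ, hκC, hκe, -⟩ := S.exists_kernel_extension hK
  refine ⟨fun r => innerSL ℝ (StateSpace.ofFun (fun j ξ => κ (Fin.castAdd p r) j (1, ξ))
    fun j => StateSpace.memLp_of_bound ((hκ _ j).comp measurable_prodMk_left)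
      fun ξ _ => hκC _ j (1, ξ)), fun r W => ?_⟩
  rw [innerSL_apply_apply, StateSpace.inner_eq]
  refine integral_congr_ae ?_
  filter_upwards [StateSpace.ofFun_ae (fun j ξ => κ (Fin.castAdd p r) j (1, ξ)) _,
    StateSpace.ae_mem] with ξ h1 hξ
  refine Finset.sum_congr rfl fun j _ => ?_
  rw [h1, hκe _ _ (1, ξ) ⟨hξ.1, hξ.2, le_rfl⟩]

end HypSystem
end
-- The Lyapunov functions
noncomputable section

namespace HypSystem

variable {m p : ℕ}

theorem exists_pos_le_norm_of_isUnit {E : Type*} [NormedAddCommGroup E] [NormedSpace ℝ E]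
    {T : E →L[ℝ] E} (hT : IsUnit T) : ∃ c : ℝ, 0 < c ∧ ∀ u, c * ‖u‖ ≤ ‖T u‖ := by
  obtain ⟨T', -, h⟩ := isUnit_iff_exists.1 hT
  refine ⟨(‖T'‖ + 1)⁻¹, by positivity, fun u => ?_⟩
  have h1 : T' (T u) = u := by rw [← mul_apply_eq_comp, h]; rfl
  have h2 := T'.le_opNorm (T u)
  rw [h1] at h2
  rw [inv_mul_le_iff₀ (by positivity)]
  nlinarith [norm_nonneg (T u)]

/-- Exponential weights along the chain of travel times. -/
theorem exists_weight (S : HypSystem m p) (hp : 0 < p) :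
    ∃ b : ℝ, 0 < b ∧ ∀ θ : ℝ, 0 < θ → θ ≤ 1 → ∃ a : ℝ, 0 < a ∧
      ∀ μ : ℝ, 0 ≤ μ → ∃ (w q : Fin (m + p) → ℝ → ℝ) (E : Fin m → ℝ),
      (∀ r, 0 ≤ E r) ∧ (∀ i x, HasDerivAt (w i) (-(2 * μ) * q i x) x) ∧
      (∀ i, Continuous (q i)) ∧ (∀ i x, w i x * (S.speed i x)⁻¹ = q i x) ∧ (∀ i x, 0 < q i x) ∧
      (∀ i, ∀ x ∈ Icc (0 : ℝ) 1, a ≤ q i x ∧ q i x ≤ b * Real.exp (2 * μ * S.finalTime hp)) ∧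
      (∀ q, w (Fin.castAdd p q) 0 = -(θ ^ (q : ℕ) * E q)) ∧
      (∀ s, 0 ≤ w (Fin.natAdd m s) 1) ∧
      (∀ s r, w (Fin.natAdd m s) 0 ≤ θ ^ (m + s : ℕ) * E r) ∧
      ∀ (i : Fin (m + p)) (r : Fin m), (r : ℕ) < i → ∀ x ∈ Icc (0 : ℝ) 1,
        q i x ≤ b * (θ ^ (i : ℕ) * E r) := by
  obtain ⟨R, hRd, hRb, hRr⟩ := S.exists_phase hp
  obtain ⟨Cs, hCs, hsp, -⟩ := S.exists_coeff_bound
  obtain ⟨Ci, hCi, hinv⟩ := S.exists_inv_speed_bound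
  have habs : ∀ (i : Fin (m + p)) x, sgn m i * (S.speed i x)⁻¹ = |S.speed i x|⁻¹ := fun i x => by
    have h := S.sgn_mul_speed_pos i x
    rcases sgn_eq i with h1 | h1
    · rw [h1, one_mul] at h ⊢; rw [abs_of_pos h]
    · rw [h1, neg_one_mul] at h ⊢; rw [abs_of_neg (by linarith), inv_neg]
  -- The order of the constants matters: `b` is fixed before `θ`, which is later chosen in terms of
  -- `b`, and `a` does not depend on `μ`, since `exp (2 * μ * R) ≥ 1` for `R ≥ 0`. The latter allows
  -- `μ → ∞`.
  refine ⟨Ci, hCi, fun θ hθ0 hθ1 => ⟨θ ^ (m + p) * Cs⁻¹, by positivity, fun μ hμ => ?_⟩⟩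
  have hq : ∀ i x, sgn m i * (θ ^ (i : ℕ) * Real.exp (2 * μ * R i x)) * (S.speed i x)⁻¹
      = θ ^ (i : ℕ) * Real.exp (2 * μ * R i x) * |S.speed i x|⁻¹ := fun i x => by
    rw [← habs]; ring
  have hexp : ∀ {a b : ℝ}, a ≤ b → Real.exp (2 * μ * a) ≤ Real.exp (2 * μ * b) := fun h =>
    Real.exp_le_exp.2 (mul_le_mul_of_nonneg_left h (by positivity))
  have hRc : ∀ i, Continuous (R i) := fun i =>
    continuous_iff_continuousAt.2 fun x => (hRd i x).continuousAt
  have hle : ∀ i x, |S.speed i x|⁻¹ ≤ Ci := fun i x => by rw [← abs_inv]; exact hinv i x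
  refine ⟨fun i x => sgn m i * (θ ^ (i : ℕ) * Real.exp (2 * μ * R i x)),
    fun i x => sgn m i * (θ ^ (i : ℕ) * Real.exp (2 * μ * R i x)) * (S.speed i x)⁻¹,
    fun r => Real.exp (2 * μ * R (Fin.castAdd p r) 0), fun r => (Real.exp_pos _).le,
    fun i x => ?_, fun i => ?_, fun i x => rfl, fun i x => ?_, fun i x hx => ⟨?_, ?_⟩, fun q => ?_,
    fun s => ?_, fun s r => ?_, fun i r hir x hx => ?_⟩
  · exact ((((hRd i x).const_mul (2 * μ)).exp.const_mul (θ ^ (i : ℕ))).const_mul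
      (sgn m i)).congr_deriv (by ring)
  · have := hRc i
    exact (continuous_const.mul (continuous_const.mul (Real.continuous_exp.comp
      (continuous_const.mul this)))).mul ((S.continuous_speed i).inv₀ (S.speed_ne_zero i))
  · beta_reduce
    rw [hq]
    have := abs_pos.2 (S.speed_ne_zero i x)
    positivity
  · beta_reduce
    rw [hq]
    have h1 : θ ^ (m + p) ≤ θ ^ (i : ℕ) := pow_le_pow_of_le_one hθ0.le hθ1 i.2.le
    have h2 : 1 ≤ Real.exp (2 * μ * R i x) := Real.one_le_exp (mul_nonneg (by positivity)
      (hRb i x hx).1)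
    have h3 : Cs⁻¹ ≤ |S.speed i x|⁻¹ := inv_anti₀ (abs_pos.2 (S.speed_ne_zero i x)) (hsp i x)
    have h4 : θ ^ (m + p) * 1 ≤ θ ^ (i : ℕ) * Real.exp (2 * μ * R i x) := by gcongr
    rw [mul_one] at h4
    exact mul_le_mul h4 h3 (by positivity) (by positivity)
  · beta_reduce
    rw [hq]
    have h1 : θ ^ (i : ℕ) ≤ 1 := pow_le_one₀ hθ0.le hθ1
    have h2 := hexp (hRb i x hx).2
    calc _ ≤ 1 * Real.exp (2 * μ * S.finalTime hp) * Ci := by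
          gcongr; exact hle i x
      _ = _ := by ring
  · simp only [sgn_castAdd, Fin.val_castAdd]; ring
  · simp only [sgn_natAdd, one_mul]; positivity
  · simp only [sgn_natAdd, one_mul, Fin.val_natAdd]
    have := hexp (hRr (Fin.natAdd m s) r (by simp only [Fin.val_natAdd]; have := r.2; omega) 0
      ⟨le_rfl, zero_le_one⟩)
    gcongr
  · beta_reduce
    rw [hq]
    have := hexp (hRr i r hir x hx)
    calc _ ≤ θ ^ (i : ℕ) * Real.exp (2 * μ * R (Fin.castAdd p r) 0) * Ci := by
          gcongr; exact hle i x
      _ = _ := by ring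

/-- Lyapunov functions `‖P w‖²` for the closed loop, with arbitrarily large decay rates. -/
theorem exists_lyapunov (S : HypSystem m p) (hp : 0 < p)
    {k₁ k₂ : Fin (m + p) → Fin (m + p) → ℝ → ℝ}
    {K : Fin (m + p) → Fin (m + p) → ℝ × ℝ → ℝ} (hK : S.IsKernel k₁ k₂ K)
    {F : Fin m → StateSpace (m + p) →L[ℝ] ℝ}
    (hF : ∀ r W, F r W = ∫ ξ in Icc (0 : ℝ) 1, ∑ j, K (Fin.castAdd p r) j (1, ξ) * W ξ j) :
    ∃ c C : ℝ, 0 < c ∧ 0 < C ∧ ∀ μ : ℝ, 0 ≤ μ →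
      ∃ P : StateSpace (m + p) →L[ℝ] StateSpace (m + p), IsUnit P ∧
        (∀ u, c * ‖u‖ ≤ ‖P u‖) ∧
        (∀ u, ‖P u‖ ≤ C * Real.exp (μ * S.finalTime hp) * ‖u‖) ∧
        ∀ q ∈ S.generator F, 2 * inner ℝ (P q.1) (P q.2) ≤ (1 - 2 * μ) * ‖P q.1‖ ^ 2 := by
  obtain ⟨κ, C, hC, hκ, hκC, hκe, hh, hhC, harc⟩ := S.exists_kernel_extension hK
  obtain ⟨T, hT, hTu⟩ := StateSpace.exists_volterra hκ hκC
  obtain ⟨M, hM, hGM⟩ := S.exists_traceCoeff_bound hC hκC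
  obtain ⟨Cs, hCs, -, -, -, hQ⟩ := S.exists_coeff_bound
  obtain ⟨c₀, hc₀, hc₀T⟩ := exists_pos_le_norm_of_isUnit hTu
  obtain ⟨b, hb, hwt⟩ := S.exists_weight hp
  -- The first term accounts for the excitation by the trace coefficients in the interior, the
  -- second for the reflection by `Q` at `x = 0`.
  set B : ℝ := b * (m * M ^ 2) + m * Cs ^ 2 with hBdef
  have hB : 0 ≤ B := by positivity
  set θ : ℝ := ((m + p : ℕ) * B + 1)⁻¹ with hθ
  have hθ0 : 0 < θ := by positivity
  have hθ1 : θ ≤ 1 := inv_le_one_of_one_le₀ (le_add_of_nonneg_left (by positivity))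
  have hθB : (m + p : ℕ) * B * θ ≤ 1 := by
    rw [hθ, ← div_eq_mul_inv, div_le_one (by positivity)]; linarith
  obtain ⟨a, ha, hwt⟩ := hwt θ hθ0 hθ1
  refine ⟨√a * c₀, √b * (‖1 - T‖ + 1), by positivity, by positivity, fun μ hμ => ?_⟩
  obtain ⟨w, q, E, hE, hwd, hqc, hwq, hq0, hqab, hw0, hw1, hws, hqE⟩ := hwt μ hμ
  -- Multiplication by `√q` turns the weighted norm into the norm of the state space, so `P = D * (1
  -- - T)` represents the Lyapunov function.
  obtain ⟨D, hD, hDu⟩ := StateSpace.exists_multiplication (d := fun i x => √(q i x))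
    (fun i => (hqc i).sqrt) fun i x => (Real.sqrt_pos.2 (hq0 i x)).ne'
  have hsq : ∀ i x, √(q i x) ^ 2 = q i x := fun i x => Real.sq_sqrt (hq0 i x).le
  have hDb := fun W => StateSpace.norm_sq_bounds hD (fun i x hx => by
    rw [hsq]; exact hqab i x hx) W
  refine ⟨D * (1 - T), hDu.mul hTu, fun u => ?_, fun u => ?_, ?_⟩
  · rw [mul_apply_eq_comp]
    refine le_of_sq_le_sq ?_ (norm_nonneg _)
    calc (√a * c₀ * ‖u‖) ^ 2 = a * (c₀ * ‖u‖) ^ 2 := by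
          rw [mul_assoc, mul_pow, Real.sq_sqrt ha.le]
      _ ≤ a * ‖(1 - T) u‖ ^ 2 := by
          have := hc₀T u
          gcongr
      _ ≤ _ := (hDb _).1
  · rw [mul_apply_eq_comp]
    refine le_of_sq_le_sq ?_ (by positivity)
    have h1 : ‖(1 - T) u‖ ≤ (‖1 - T‖ + 1) * ‖u‖ := ((1 - T).le_opNorm u).trans (by
      nlinarith [norm_nonneg u])
    have h2 : Real.exp (2 * μ * S.finalTime hp) = Real.exp (μ * S.finalTime hp) ^ 2 := by
      rw [← Real.exp_nat_mul]; congr 1; push_cast; ring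
    calc _ ≤ _ := (hDb ((1 - T) u)).2
      _ ≤ b * Real.exp (2 * μ * S.finalTime hp) * ((‖1 - T‖ + 1) * ‖u‖) ^ 2 := by gcongr
      _ = (√b * (‖1 - T‖ + 1) * Real.exp (μ * S.finalTime hp) * ‖u‖) ^ 2 := by
          rw [h2, mul_pow, mul_pow, mul_pow, mul_pow, Real.sq_sqrt hb.le]; ring
  rintro ⟨W, V⟩ hWV
  obtain ⟨f, hf⟩ := mem_generator.1 hWV
  have hγ := S.isPrimitive_transform hK hκe hκ hκC hh hhC harc hf.continuous hf.ae_eq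
    hf.isPrimitive hf.left
  set γ : Fin (m + p) → ℝ → ℝ :=
    fun i x => f i x - ∫ ξ in (0 : ℝ)..x, ∑ j, κ i j (x, ξ) * f j ξ with hγdef
  set δ : Fin (m + p) → ℝ → ℝ :=
    fun i x => V x i - ∫ ξ in (0 : ℝ)..x, ∑ j, κ i j (x, ξ) * V ξ j with hδdef
  set y : Fin m → ℝ := fun r => f (Fin.castAdd p r) 0 with hy
  set η : Fin (m + p) → ℝ → ℝ := fun i x => ∑ r, S.traceCoeff κ i r x * y r with hη
  have hγW : ∀ᵐ x ∂unitVolume, ∀ i, ((1 - T) W) x i = γ i x := by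
    filter_upwards [StateSpace.sub_ae W (T W), hT W, hf.ae_eq, StateSpace.ae_mem]
      with x h1 h2 h3 hx i
    have e : (1 - T) W = W - T W := rfl
    rw [e, h1, h2, h3]
    congr 1
    refine StateSpace.integral_congr_unit ?_ hx
    filter_upwards [hf.ae_eq] with ξ hξ
    simp only [hξ]
  have hδV : ∀ᵐ x ∂unitVolume, ∀ i, ((1 - T) V) x i = δ i x := by
    filter_upwards [StateSpace.sub_ae V (T V), hT V] with x h1 h2 i
    have e : (1 - T) V = V - T V := rfl
    rw [e, h1, h2]
  have hδi : ∀ i, IntervalIntegrable (δ i) volume 0 1 := fun i =>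
    (StateSpace.intervalIntegrable_coord ((1 - T) V) i).congr_ae (by
      rw [uIoc_of_le zero_le_one]
      exact ae_restrict_of_ae_restrict_of_subset Ioc_subset_Icc_self (hδV.mono fun x hx => hx i))
  have hGy : ∀ i x, |η i x| ≤ ∑ r, M * |y r| := fun i x =>
    (Finset.abs_sum_le_sum_abs _ _).trans (Finset.sum_le_sum fun r _ => by
      rw [abs_mul]; exact mul_le_mul_of_nonneg_right (hGM i r x) (abs_nonneg _))
  have hηm : ∀ i, Measurable (η i) := fun i =>
    Finset.measurable_sum _ fun r _ => (S.measurable_traceCoeff hκ i r).mul_const _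
  have hbal := fun i => IsPrimitive.two_mul_integral_le (hwd i) (hqc i) (hwq i)
    (fun x => (hq0 i x).le) (hδi i) (hηm i) (hGy i) (hγ i)
  -- Only indices `r < i` appear, the other trace coefficients being zero. For them the phase
  -- inequality compares the weight at `x` with the weight at which the component `r` leaves.
  have hηq : ∀ i, ∫ x in (0 : ℝ)..1, q i x * η i x ^ 2
      ≤ θ ^ (i : ℕ) * (b * (m * M ^ 2) * ∑ r : Fin m, if (r : ℕ) < i then E r * y r ^ 2 else 0) := by
    intro i
    have h := abs_intervalIntegral_le (a := 0) (b := 1) (f := fun x => q i x * η i x ^ 2)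
      (C := θ ^ (i : ℕ) * (b * (m * M ^ 2) *
        ∑ r : Fin m, if (r : ℕ) < i then E r * y r ^ 2 else 0)) fun x hx => by
        rw [uIoc_of_le zero_le_one] at hx
        rw [abs_of_nonneg (mul_nonneg (hq0 i x).le (sq_nonneg _))]
        have h1 := sq_sum_le (y := y) (fun r => hGM i r x)
        refine (mul_le_mul_of_nonneg_left h1 (hq0 i x).le).trans ?_
        have h2 : q i x * ∑ r, (if S.traceCoeff κ i r x = 0 then 0 else y r ^ 2)
            ≤ b * θ ^ (i : ℕ) * ∑ r : Fin m, if (r : ℕ) < i then E r * y r ^ 2 else 0 := by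
          rw [Finset.mul_sum, Finset.mul_sum]
          refine Finset.sum_le_sum fun r _ => ?_
          split_ifs with h3 h4 h4
          · have := hE r; rw [mul_zero]; positivity
          · simp
          · have := mul_le_mul_of_nonneg_right (hqE i r h4 x ⟨hx.1.le, hx.2⟩) (sq_nonneg (y r))
            linarith
          · exact absurd (S.traceCoeff_eq_zero hK hκe (not_lt.1 h4) hx) h3
        have h3 := mul_le_mul_of_nonneg_left h2 (show 0 ≤ m * M ^ 2 by positivity)
        linarith
    simp only [sub_zero, abs_one, mul_one] at h
    exact (le_abs_self _).trans h
  have hγ0 : ∀ i, γ i 0 = f i 0 := fun i => by simp [hγdef]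
  -- The feedback is the moment of the kernel at `x = 1`, so it cancels exactly the value of the
  -- profile there.
  have hγ1 : ∀ r, γ (Fin.castAdd p r) 1 = 0 := fun r => by
    rw [hγdef]
    beta_reduce
    rw [hf.right, hF, StateSpace.integral_eq_interval, sub_eq_zero]
    rw [← StateSpace.integral_eq_interval, ← StateSpace.integral_eq_interval]
    refine integral_congr_ae ?_
    filter_upwards [hf.ae_eq, StateSpace.ae_mem] with ξ h1 hξ
    exact Finset.sum_congr rfl fun j _ => by rw [h1, hκe _ _ (1, ξ) ⟨hξ.1, hξ.2, le_rfl⟩]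
  -- For the negative components the boundary value at `x = 0` is dissipative. The positive ones are
  -- dissipative at `x = 1` and are driven at `x = 0` by the reflection.
  have hbd : ∑ i, ((∫ x in (0 : ℝ)..1, q i x * η i x ^ 2) - w i 1 * γ i 1 ^ 2
      + w i 0 * γ i 0 ^ 2) ≤ 0 := by
    refine sum_boundary_nonpos hθ0 hθ1 hB hθB (e := fun r => E r * y r ^ 2)
      (fun r => mul_nonneg (hE r) (sq_nonneg _)) (fun r => ?_) fun s => ?_
    · have h1 : ∫ x in (0 : ℝ)..1, q (Fin.castAdd p r) x * η (Fin.castAdd p r) x ^ 2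
          ≤ θ ^ (r : ℕ) * (b * (m * M ^ 2) *
            ∑ q : Fin m, if (q : ℕ) < (r : ℕ) then E q * y q ^ 2 else 0) := hηq (Fin.castAdd p r)
      have h3 : 0 ≤ ∑ q : Fin m, (if (q : ℕ) < (r : ℕ) then E q * y q ^ 2 else 0) :=
        Finset.sum_nonneg fun q _ => by
          split_ifs
          · exact mul_nonneg (hE q) (sq_nonneg _)
          · exact le_rfl
      have h4 : b * (m * M ^ 2) * (∑ q : Fin m, (if (q : ℕ) < (r : ℕ) then E q * y q ^ 2 else 0))
          ≤ B * ∑ q : Fin m, (if (q : ℕ) < (r : ℕ) then E q * y q ^ 2 else 0) :=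
        mul_le_mul_of_nonneg_right (le_add_of_nonneg_right (by positivity)) h3
      have h5 := mul_le_mul_of_nonneg_left h4 (pow_nonneg hθ0.le (r : ℕ))
      have h6 : w (Fin.castAdd p r) 0 * γ (Fin.castAdd p r) 0 ^ 2
          = -(θ ^ (r : ℕ) * (E r * y r ^ 2)) := by rw [hw0, hγ0]; ring
      rw [hγ1, h6]
      linarith
    · have h1 := hηq (Fin.natAdd m s)
      have h2 : ∀ q : Fin m, (q : ℕ) < m + s := fun q => by
        have := q.2; omega
      simp only [Fin.val_natAdd, h2, if_true] at h1
      have h3 : 0 ≤ w (Fin.natAdd m s) 1 * γ (Fin.natAdd m s) 1 ^ 2 :=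
        mul_nonneg (hw1 s) (sq_nonneg _)
      have h4 : w (Fin.natAdd m s) 0 * γ (Fin.natAdd m s) 0 ^ 2
          ≤ θ ^ (m + s : ℕ) * (m * Cs ^ 2 * ∑ r, E r * y r ^ 2) := by
        rw [hγ0, hf.left]
        have h5 : 0 ≤ w (Fin.natAdd m s) 0 := by
          have h6 := hwq (Fin.natAdd m s) 0
          have h7 := hq0 (Fin.natAdd m s) 0
          rw [← h6] at h7
          exact (pos_of_mul_pos_left h7 (inv_pos.2 (S.speed_natAdd_pos s 0)).le).le
        refine (mul_le_mul_of_nonneg_left (sq_sum_le (y := y) (fun r => hQ s r)) h5).trans ?_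
        have h6 : w (Fin.natAdd m s) 0 * ∑ r, (if S.Q s r = 0 then 0 else y r ^ 2)
            ≤ θ ^ (m + s : ℕ) * ∑ r, E r * y r ^ 2 := by
          rw [Finset.mul_sum, Finset.mul_sum]
          refine Finset.sum_le_sum fun r _ => ?_
          split_ifs
          · have := hE r; rw [mul_zero]; positivity
          · have := mul_le_mul_of_nonneg_right (hws s r) (sq_nonneg (y r))
            linarith
        have h7 := mul_le_mul_of_nonneg_left h6 (show 0 ≤ m * Cs ^ 2 by positivity)
        linarith
      have h5 : θ ^ (m + s : ℕ) * (B * ∑ r, E r * y r ^ 2)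
          = θ ^ (m + s : ℕ) * (b * (m * M ^ 2) * ∑ r, E r * y r ^ 2)
            + θ ^ (m + s : ℕ) * (m * Cs ^ 2 * ∑ r, E r * y r ^ 2) := by rw [hBdef]; ring
      rw [h5]
      linarith
  have hγc : ∀ i, ContinuousOn (γ i) (uIcc 0 1) := fun i => by
    rw [uIcc_of_le zero_le_one]; exact (hγ i).continuousOn
  have hi1 : ∀ i ∈ Finset.univ, IntervalIntegrable (fun x => q i x * γ i x * δ i x) volume 0 1 :=
    fun i _ => (hδi i).continuousOn_mul ((hqc i).continuousOn.mul (hγc i))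
  have hi2 : ∀ i ∈ Finset.univ, IntervalIntegrable (fun x => q i x * γ i x ^ 2) volume 0 1 :=
    fun i _ => ((hqc i).continuousOn.mul ((hγc i).pow 2)).intervalIntegrable
  have e1 : inner ℝ ((D * (1 - T)) W) ((D * (1 - T)) V)
      = ∑ i, ∫ x in (0 : ℝ)..1, q i x * γ i x * δ i x := by
    rw [StateSpace.inner_eq, StateSpace.integral_eq_interval,
      ← intervalIntegral.integral_finsetSum hi1]
    refine StateSpace.integral_congr_unit ?_ ⟨zero_le_one, le_rfl⟩
    filter_upwards [hD ((1 - T) W), hD ((1 - T) V), hγW, hδV] with x h1 h2 h3 h4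
    refine Finset.sum_congr rfl fun i _ => ?_
    rw [mul_apply_eq_comp, mul_apply_eq_comp, h1, h2, h3, h4]
    linear_combination γ i x * δ i x * hsq i x
  have e2 : ‖(D * (1 - T)) W‖ ^ 2 = ∑ i, ∫ x in (0 : ℝ)..1, q i x * γ i x ^ 2 := by
    rw [StateSpace.norm_sq_eq, StateSpace.integral_eq_interval,
      ← intervalIntegral.integral_finsetSum hi2]
    refine StateSpace.integral_congr_unit ?_ ⟨zero_le_one, le_rfl⟩
    filter_upwards [hD ((1 - T) W), hγW] with x h1 h3
    refine Finset.sum_congr rfl fun i _ => ?_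
    rw [mul_apply_eq_comp, h1, h3, mul_pow, hsq]
  rw [e1, e2, Finset.mul_sum, Finset.mul_sum]
  have e3 : ∀ i, (1 - 2 * μ) * (∫ x in (0 : ℝ)..1, q i x * γ i x ^ 2)
      + (∫ x in (0 : ℝ)..1, q i x * η i x ^ 2) - w i 1 * γ i 1 ^ 2 + w i 0 * γ i 0 ^ 2
      = (1 - 2 * μ) * (∫ x in (0 : ℝ)..1, q i x * γ i x ^ 2)
        + ((∫ x in (0 : ℝ)..1, q i x * η i x ^ 2) - w i 1 * γ i 1 ^ 2 + w i 0 * γ i 0 ^ 2) :=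
    fun i => by ring
  refine (Finset.sum_le_sum fun i _ => (hbal i).trans_eq (e3 i)).trans ?_
  rw [Finset.sum_add_distrib]
  linarith

end HypSystem
end
-- Resolvent equation and Green's formula
noncomputable section

namespace HypSystem

variable {m p : ℕ}

theorem integrable_slope (S : HypSystem m p) (W V : StateSpace (m + p)) (i : Fin (m + p)) :
    IntervalIntegrable (S.slope W V i) volume 0 1 := by
  have h1 : ∀ k ∈ Finset.univ, IntervalIntegrable (fun x => S.coup i k x * W x k) volume 0 1 :=
    fun k _ => (StateSpace.intervalIntegrable_coord W k).continuousOn_mul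
      (S.continuous_coup i k).continuousOn
  have h2 := ((IntervalIntegrable.sum Finset.univ h1).sub
    (StateSpace.intervalIntegrable_coord V i)).continuousOn_mul
      ((S.continuous_speed i).inv₀ (S.speed_ne_zero i)).continuousOn
  exact h2.congr fun x _ => by simp [slope]

theorem isPrimitive_unitClamp {c : ℝ} {g : ℝ → ℝ} (hg : IntervalIntegrable g volume 0 1) :
    Continuous (fun x => c + ∫ ξ in (0 : ℝ)..unitClamp x, g ξ) ∧
      IsPrimitive (fun x => c + ∫ ξ in (0 : ℝ)..unitClamp x, g ξ) g 0 1 := by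
  have h0 : unitClamp 0 = 0 := unitClamp_of_mem ⟨le_rfl, zero_le_one⟩
  have h : IsPrimitive (fun x => c + ∫ ξ in (0 : ℝ)..x, g ξ) g 0 1 :=
    ⟨zero_le_one, hg, fun x _ => by simp⟩
  refine ⟨?_, zero_le_one, hg, fun x hx => ?_⟩
  · exact h.continuousOn.comp_unitClamp
  · rw [unitClamp_of_mem hx, h0]; simp

/-- Solvability of the resolvent equation without boundary condition at `x = 1`. -/
theorem exists_isPreProfile (S : HypSystem m p) (c : ℝ) (g : StateSpace (m + p)) (b : Fin m → ℝ) :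
    ∃ W f, S.IsPreProfile W (c • W - g) f ∧ ∀ r, f (Fin.castAdd p r) 0 = b r := by
  obtain ⟨Cs, hCs, -, -, hcoup, -⟩ := S.exists_coeff_bound
  obtain ⟨Ci, hCi, hinv⟩ := S.exists_inv_speed_bound
  have hsc : ∀ i, Continuous fun x => (S.speed i x)⁻¹ := fun i =>
    (S.continuous_speed i).inv₀ (S.speed_ne_zero i)
  -- The equation `Λ W' = Σ W - c W + g` with given values at `x = 0`, integrated from `0`, is the
  -- Volterra equation `W - T W = h`.
  set κ : Fin (m + p) → Fin (m + p) → ℝ × ℝ → ℝ := fun i j q =>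
    (S.speed i q.2)⁻¹ * (S.coup i j q.2 - if i = j then c else 0) with hκ
  have hκm : ∀ i j, Measurable (κ i j) := fun i j =>
    (((hsc i).comp continuous_snd).mul (((S.continuous_coup i j).comp continuous_snd).sub
      continuous_const)).measurable
  have hκC : ∀ i j q, |κ i j q| ≤ Ci * (Cs + |c|) := fun i j q => by
    rw [hκ, abs_mul]
    refine mul_le_mul (hinv _ _) ((abs_sub _ _).trans (add_le_add (hcoup _ _ _) ?_))
      (abs_nonneg _) hCi.le
    split_ifs
    · exact le_rfl
    · rw [abs_zero]; exact abs_nonneg c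
  obtain ⟨T, hT, hTu⟩ := StateSpace.exists_volterra hκm hκC
  set b' : Fin (m + p) → ℝ := fun i => Fin.addCases b (fun s => ∑ r, S.Q s r * b r) i with hb'
  have hbl : ∀ r, b' (Fin.castAdd p r) = b r := fun r => by simp only [hb', Fin.addCases_left]
  have hbr : ∀ s, b' (Fin.natAdd m s) = ∑ r, S.Q s r * b r := fun s => by
    simp only [hb', Fin.addCases_right]
  have hgi : ∀ i, IntervalIntegrable (fun x => (S.speed i x)⁻¹ * g x i) volume 0 1 := fun i =>
    (StateSpace.intervalIntegrable_coord g i).continuousOn_mul (hsc i).continuousOn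
  set h : Fin (m + p) → ℝ → ℝ := fun i x =>
    b' i + ∫ ξ in (0 : ℝ)..unitClamp x, (S.speed i ξ)⁻¹ * g ξ i with hh
  have hhc : ∀ i, Continuous (h i) := fun i => (isPrimitive_unitClamp (hgi i)).1
  have hmem : ∀ i, MemLp (h i) 2 unitVolume := fun i => by
    obtain ⟨C, hC⟩ := (hhc i).continuousOn.exists_abs_le_unit
    exact StateSpace.memLp_of_bound (hhc i).measurable hC
  obtain ⟨T', hT', -⟩ := isUnit_iff_exists.1 hTu
  set W := T' (StateSpace.ofFun h hmem) with hW
  have hWT : W - T W = StateSpace.ofFun h hmem := by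
    have : (1 - T) (T' (StateSpace.ofFun h hmem)) = StateSpace.ofFun h hmem := by
      rw [← mul_apply_eq_comp, hT']; rfl
    exact this
  have hprim := fun i => isPrimitive_unitClamp (c := b' i) (S.integrable_slope W (c • W - g) i)
  have h0 : unitClamp 0 = 0 := unitClamp_of_mem ⟨le_rfl, zero_le_one⟩
  refine ⟨W, fun i x => b' i + ∫ ξ in (0 : ℝ)..unitClamp x, S.slope W (c • W - g) i ξ,
    ⟨fun i => (hprim i).1, ?_, fun i => (hprim i).2, fun s => ?_⟩, fun r => ?_⟩
  · filter_upwards [StateSpace.sub_ae W (T W), StateSpace.ofFun_ae h hmem, hT W,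
      StateSpace.ae_mem] with x h1 h2 h3 hx i
    have h4 : (W - T W : StateSpace (m + p)) x i = h i x := by rw [hWT]; exact h2 i
    rw [h1, h3] at h4
    rw [sub_eq_iff_eq_add.1 h4, hh]
    beta_reduce
    have i1 : IntervalIntegrable (fun ξ => (S.speed i ξ)⁻¹ * g ξ i) volume 0 x :=
      (hgi i).mono_set (uIcc_subset_uIcc left_mem_uIcc (Icc_subset_uIcc hx))
    rw [unitClamp_of_mem hx, add_assoc, ← intervalIntegral.integral_add i1
      (StateSpace.intervalIntegrable_volterra hκm hκC W i hx)]
    congr 1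
    refine StateSpace.integral_congr_unit ?_ hx
    filter_upwards [StateSpace.sub_ae (c • W) g, StateSpace.smul_ae c W] with ξ h5 h6
    rw [slope, h5, h6, hκ]
    simp only [mul_sub, sub_mul, mul_ite, ite_mul, mul_zero, zero_mul, Finset.sum_sub_distrib,
      Finset.sum_ite_eq, Finset.mem_univ, if_true, Finset.mul_sum, mul_assoc]
    ring
  · simp only [h0, intervalIntegral.integral_same, add_zero, hbl, hbr]
  · simp only [h0, intervalIntegral.integral_same, add_zero, hbl]

/-- The range condition for the generator. -/
theorem generator_range (S : HypSystem m p) {F : Fin m → StateSpace (m + p) →L[ℝ] ℝ} {c : ℝ}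
    (hinj : ∀ W, (W, c • W) ∈ S.generator F → W = 0) (g : StateSpace (m + p)) :
    ∃ q ∈ S.generator F, c • q.1 - q.2 = g := by
  let E := StateSpace (m + p) × StateSpace (m + p) × (Fin (m + p) → ℝ → ℝ)
  let eig : E →ₗ[ℝ] StateSpace (m + p) :=
    c • LinearMap.fst ℝ _ _ - (LinearMap.fst ℝ _ _).comp (LinearMap.snd ℝ _ _)
  -- Solutions of the homogeneous equation with the boundary condition at `x = 0`; their values
  -- `f₋(0)` can be prescribed.
  let N : Submodule ℝ E := S.profiles ⊓ LinearMap.ker eig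
  let τ : N →ₗ[ℝ] (Fin m → ℝ) :=
    { toFun := fun t r => t.1.2.2 (Fin.castAdd p r) 0
      map_add' := fun _ _ => rfl
      map_smul' := fun _ _ => rfl }
  have hτ : LinearMap.range τ = ⊤ := by
    refine LinearMap.range_eq_top.2 fun b => ?_
    obtain ⟨W, f, hf, hfb⟩ := S.exists_isPreProfile c 0 b
    refine ⟨⟨(W, c • W - 0, f), hf, LinearMap.mem_ker.2 ?_⟩, funext hfb⟩
    show c • W - (c • W - 0) = 0
    simp
  obtain ⟨s, hs⟩ := LinearMap.exists_rightInverse_of_surjective τ hτ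
  -- The map from `f₋(0)` to the defect in the feedback condition at `x = 1`. It acts on a
  -- finite-dimensional space and is injective since its kernel consists of eigenvectors excluded by
  -- `hinj`, so it is onto.
  let A : (Fin m → ℝ) →ₗ[ℝ] (Fin m → ℝ) := (boundaryDefect F).comp (N.subtype.comp s)
  have hA : Function.Injective A := by
    refine (injective_iff_map_eq_zero A).2 fun b hb => ?_
    obtain ⟨h1, h2⟩ := (s b).2
    have h3 : c • (s b).1.1 - (s b).1.2.1 = 0 := LinearMap.mem_ker.1 h2
    have h4 : ((s b).1.1, c • (s b).1.1) ∈ S.generator F := by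
      rw [sub_eq_zero.1 h3]
      exact mem_generator.2 ⟨(s b).1.2.2, h1, fun r => sub_eq_zero.1 (congrFun hb r)⟩
    have h5 := hinj _ h4
    have h6 : τ (s b) = b := LinearMap.congr_fun hs b
    have h7 : ∀ᵐ x ∂unitVolume, ∀ i, (0 : StateSpace (m + p)) x i = 0 :=
      (Lp.coeFn_zero _ 2 unitVolume).mono fun x hx i => by rw [hx]; rfl
    rw [← h6]
    ext r
    have h8 : (s b).1.2.2 (Fin.castAdd p r) =ᵐ[volume.restrict (Icc (0 : ℝ) 1)] fun _ => 0 := by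
      filter_upwards [h1.ae_eq, h7] with x h9 h10
      rw [← h9, h5]; exact h10 _
    exact Measure.eqOn_Icc_of_ae_eq (μ := volume) zero_ne_one h8
      (h1.continuous _).continuousOn continuousOn_const ⟨le_rfl, zero_le_one⟩
  obtain ⟨W, f, hf, -⟩ := S.exists_isPreProfile c g 0
  -- A homogeneous solution with the same defect is subtracted from a particular solution.
  obtain ⟨b, hb⟩ := LinearMap.injective_iff_surjective.1 hA
    (boundaryDefect F (W, c • W - g, f))
  obtain ⟨h1, h2⟩ := (s b).2
  have h3 : c • (s b).1.1 - (s b).1.2.1 = 0 := LinearMap.mem_ker.1 h2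
  refine ⟨(W - (s b).1.1, c • W - g - (s b).1.2.1), ⟨(W, c • W - g, f) - (s b).1,
    ⟨S.profiles.sub_mem hf h1, LinearMap.mem_ker.2 ?_⟩, rfl⟩, ?_⟩
  · rw [map_sub, ← hb]; exact sub_self _
  · rw [← sub_eq_zero.1 h3]
    simp only [smul_sub]; abel

/-- Green's formula. -/
theorem green (S : HypSystem m p) {W V : StateSpace (m + p)} {f : Fin (m + p) → ℝ → ℝ}
    (hW : ∀ᵐ x ∂unitVolume, ∀ i, W x i = f i x)
    (hf : ∀ i, IsPrimitive (f i) (S.slope W V i) 0 1) {φ φ' : Fin (m + p) → ℝ → ℝ}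
    (hφ : ∀ i x, HasDerivAt (φ i) (φ' i x) x) (hφ' : ∀ i, Continuous (φ' i)) :
    ∫ x in Icc (0 : ℝ) 1, ∑ i, φ i x * V x i =
      (∫ x in Icc (0 : ℝ) 1, ∑ i, (S.speed i x * φ' i x + S.speedDeriv i x * φ i x
        + ∑ k, S.coup k i x * φ k x) * W x i)
      - ∑ i, S.speed i 1 * φ i 1 * f i 1 + ∑ i, S.speed i 0 * φ i 0 * f i 0 := by
  have hφc : ∀ i, Continuous (φ i) := fun i =>
    continuous_iff_continuousAt.2 fun x => (hφ i x).continuousAt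
  have hVi := fun i => StateSpace.intervalIntegrable_coord V i
  have hWi := fun i => StateSpace.intervalIntegrable_coord W i
  have hcl : ∀ i, Continuous fun x => S.speed i x * φ' i x + S.speedDeriv i x * φ i x
      + ∑ k, S.coup k i x * φ k x := fun i => by
    have h1 := S.continuous_speed i
    have h2 := S.continuous_speedDeriv i
    have h3 : Continuous fun x => ∑ k, S.coup k i x * φ k x :=
      continuous_finsetSum _ fun k _ => (S.continuous_coup k i).mul (hφc k)
    exact ((h1.mul (hφ' i)).add (h2.mul (hφc i))).add h3
  have i1 : ∀ i ∈ Finset.univ, IntervalIntegrable (fun x => φ i x * V x i) volume 0 1 :=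
    fun i _ => (hVi i).continuousOn_mul (hφc i).continuousOn
  have i2 : ∀ i ∈ Finset.univ, IntervalIntegrable (fun x => (S.speed i x * φ' i x
      + S.speedDeriv i x * φ i x + ∑ k, S.coup k i x * φ k x) * W x i) volume 0 1 :=
    fun i _ => (hWi i).continuousOn_mul (hcl i).continuousOn
  have hsp : ∀ i, IsPrimitive (fun x => S.speed i x * φ i x)
      (fun x => S.speedDeriv i x * φ i x + S.speed i x * φ' i x) 0 1 := fun i => by
    refine IsPrimitive.of_hasDerivWithinAt zero_le_one (fun x hx => ?_)
      (((S.continuous_speedDeriv i).mul (hφc i)).add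
        ((S.continuous_speed i).mul (hφ' i))).continuousOn
    have h1 : HasDerivWithinAt (S.speed i) (S.speedDeriv i x) (Icc 0 1) x := by
      rw [S.speedDeriv_of_mem i hx]
      exact (S.hasDerivWithinAt_lam i hx).congr (fun y hy => S.speed_of_mem i hy)
        (S.speed_of_mem i hx)
    exact h1.mul (hφ i x).hasDerivWithinAt
  have key := fun i => (hsp i).integral_mul (hf i)
  have i3 : ∀ i ∈ Finset.univ, IntervalIntegrable (fun x => (S.speedDeriv i x * φ i x
      + S.speed i x * φ' i x) * f i x + S.speed i x * φ i x * S.slope W V i x) volume 0 1 :=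
    fun i _ => ((hsp i).mul (hf i)).integrable
  rw [StateSpace.integral_eq_interval, StateSpace.integral_eq_interval, sub_add,
    ← Finset.sum_sub_distrib, ← Finset.sum_congr rfl fun i _ => key i,
    ← intervalIntegral.integral_finsetSum i3, intervalIntegral.integral_finsetSum i2,
    intervalIntegral.integral_finsetSum i3, ← Finset.sum_sub_distrib]
  rw [← Finset.sum_congr rfl fun i hi => intervalIntegral.integral_sub (i2 i hi) (i3 i hi),
    ← intervalIntegral.integral_finsetSum fun i hi => (i2 i hi).sub (i3 i hi)]
  refine StateSpace.integral_congr_unit ?_ ⟨zero_le_one, le_rfl⟩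
  filter_upwards [hW] with x hx
  have e1 : ∀ i, S.speed i x * φ i x * S.slope W V i x
      = φ i x * (∑ k, S.coup i k x * W x k - V x i) := fun i => by
    rw [← S.speed_mul_slope W V i x]; ring
  have e2 : ∑ i, (∑ k, S.coup k i x * φ k x) * W x i
      = ∑ i, φ i x * ∑ k, S.coup i k x * W x k := by
    simp only [Finset.sum_mul, Finset.mul_sum]
    rw [Finset.sum_comm]
    exact Finset.sum_congr rfl fun i _ => Finset.sum_congr rfl fun k _ => by ring
  simp only [e1, hx, add_mul, mul_sub, Finset.sum_add_distrib, Finset.sum_sub_distrib] at e2 ⊢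
  rw [e2]
  ring

end HypSystem
end
-- Weak characterization of the generator
noncomputable section

namespace HypSystem

variable {m p : ℕ}

/-- The lemma of du Bois-Reymond on the unit interval. -/
theorem ae_eq_sub_integral_of_weak {z h : ℝ → ℝ} (hz : IntervalIntegrable z volume 0 1)
    (hh : IntervalIntegrable h volume 0 1)
    (hw : ∀ ψ : ℝ → ℝ, ContDiff ℝ 1 ψ → ψ 0 = 0 → ψ 1 = 0 →
      ∫ x in (0 : ℝ)..1, deriv ψ x * z x = ∫ x in (0 : ℝ)..1, ψ x * h x) :
    ∃ C : ℝ, ∀ᵐ x ∂unitVolume, z x = C - ∫ ξ in (0 : ℝ)..unitClamp x, h ξ := by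
  obtain ⟨hHc, hH⟩ := isPrimitive_unitClamp (c := 0) hh
  simp only [zero_add] at hHc hH
  set H : ℝ → ℝ := fun x => ∫ ξ in (0 : ℝ)..unitClamp x, h ξ with hHdef
  have hHi : IntervalIntegrable H volume 0 1 := hHc.intervalIntegrable _ _
  set C := ∫ x in (0 : ℝ)..1, (z x + H x) with hC
  have hvi : IntervalIntegrable (fun x => z x + H x - C) volume 0 1 :=
    (hz.add hHi).sub intervalIntegrable_const
  -- Any continuous `g` becomes admissible after subtraction of its mean: the primitive of `g - a`
  -- vanishes at both ends. As `C` is the mean of `z + H`, the subtraction is harmless.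
  have key : ∀ g : ℝ → ℝ, Continuous g → ∫ x in (0 : ℝ)..1, g x * (z x + H x - C) = 0 := by
    intro g hg
    set a := ∫ x in (0 : ℝ)..1, g x with ha
    set ψ : ℝ → ℝ := fun x => ∫ y in (0 : ℝ)..x, (g y - a) with hψ
    have hgc : Continuous fun y => g y - a := hg.sub continuous_const
    have hd : ∀ x, HasDerivAt ψ (g x - a) x := fun x =>
      intervalIntegral.integral_hasDerivAt_right (hgc.intervalIntegrable _ _)
        (hgc.stronglyMeasurableAtFilter _ _) hgc.continuousAt
    have hdv : deriv ψ = fun x => g x - a := funext fun x => (hd x).deriv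
    have hψ1 : ψ 1 = 0 := by
      rw [hψ]
      beta_reduce
      rw [intervalIntegral.integral_sub (hg.intervalIntegrable _ _) intervalIntegrable_const, ← ha]
      simp
    have hψ0 : ψ 0 = 0 := by simp [hψ]
    have h1 := hw ψ (contDiff_one_iff_deriv.2 ⟨fun x => (hd x).differentiableAt, by rwa [hdv]⟩)
      hψ0 hψ1
    have hp : IsPrimitive ψ (fun x => g x - a) 0 1 := ⟨zero_le_one, hgc.intervalIntegrable _ _,
      fun x _ => by rw [hψ0, zero_add]⟩
    have h2 := hp.integral_mul hH
    rw [hψ1, hψ0] at h2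
    have i1 : IntervalIntegrable (fun x => (g x - a) * H x) volume 0 1 :=
      (hgc.mul hHc).intervalIntegrable _ _
    have i2 : IntervalIntegrable (fun x => ψ x * h x) volume 0 1 :=
      hh.continuousOn_mul (continuous_iff_continuousAt.2 fun x => (hd x).continuousAt).continuousOn
    have i3 : IntervalIntegrable (fun x => (g x - a) * z x) volume 0 1 :=
      hz.continuousOn_mul hgc.continuousOn
    rw [intervalIntegral.integral_add i1 i2, ← h1, hdv, ← intervalIntegral.integral_add i1 i3] at h2
    have i4 : IntervalIntegrable (fun x => g x * (z x + H x)) volume 0 1 :=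
      (hz.add hHi).continuousOn_mul hg.continuousOn
    have e1 : ∀ x, (g x - a) * H x + (g x - a) * z x = g x * (z x + H x) - a * (z x + H x) :=
      fun x => by ring
    simp only [e1] at h2
    rw [intervalIntegral.integral_sub i4 ((hz.add hHi).const_mul a),
      intervalIntegral.integral_const_mul, ← hC] at h2
    have e2 : ∀ x, g x * (z x + H x - C) = g x * (z x + H x) - C * g x := fun x => by ring
    simp only [e2]
    rw [intervalIntegral.integral_sub i4 ((hg.intervalIntegrable _ _).const_mul C),
      intervalIntegral.integral_const_mul, ← ha]
    linarith
  refine ⟨C, ?_⟩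
  have hloc : LocallyIntegrable (fun x => z x + H x - C) unitVolume := by
    refine Integrable.locallyIntegrable ?_
    rw [intervalIntegrable_iff_integrableOn_Icc_of_le zero_le_one] at hvi
    exact hvi
  filter_upwards [ae_eq_zero_of_integral_contDiff_smul_eq_zero hloc fun g hg _ => by
    simpa only [smul_eq_mul, StateSpace.integral_eq_interval] using key g hg.continuous] with x hx
  linarith

/-- The formal adjoint of `-Λ ∂ₓ + Σ`. -/
def adj (S : HypSystem m p) (φ : Fin (m + p) → ℝ → ℝ) (i : Fin (m + p)) (x : ℝ) : ℝ :=
  S.speed i x * deriv (φ i) x + S.speedDeriv i x * φ i x + ∑ k, S.coup k i x * φ k x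

/-- Time-independent test functions. -/
structure IsStaticTest (S : HypSystem m p) (φ : Fin (m + p) → ℝ → ℝ) : Prop where
  contDiff : ∀ i, ContDiff ℝ 1 (φ i)
  right : ∀ s, φ (Fin.natAdd m s) 1 = 0
  left : ∀ r, S.speed (Fin.castAdd p r) 0 * φ (Fin.castAdd p r) 0
    + ∑ s, S.Q s r * S.speed (Fin.natAdd m s) 0 * φ (Fin.natAdd m s) 0 = 0

/-- The adjoint boundary conditions remove the traces that are not prescribed: `φ₊(1) = 0` removes
`f₊(1)`, and the condition at `x = 0` removes `f₋(0)` once `f₊(0)` is eliminated. -/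
theorem IsStaticTest.green {S : HypSystem m p} {φ : Fin (m + p) → ℝ → ℝ}
    (hφ : S.IsStaticTest φ) {F : Fin m → StateSpace (m + p) →L[ℝ] ℝ} {W V : StateSpace (m + p)}
    (h : (W, V) ∈ S.generator F) :
    ∫ x in Icc (0 : ℝ) 1, ∑ i, φ i x * V x i =
      (∫ x in Icc (0 : ℝ) 1, ∑ i, S.adj φ i x * W x i)
      - ∑ r, S.speed (Fin.castAdd p r) 1 * φ (Fin.castAdd p r) 1 * F r W := by
  obtain ⟨f, hf⟩ := mem_generator.1 h
  rw [S.green hf.ae_eq hf.isPrimitive (φ := φ) (φ' := fun i => deriv (φ i))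
    (fun i x => ((hφ.contDiff i).differentiable one_ne_zero x).hasDerivAt)
    (fun i => (contDiff_one_iff_deriv.1 (hφ.contDiff i)).2)]
  have h1 : ∑ i, S.speed i 1 * φ i 1 * f i 1
      = ∑ r, S.speed (Fin.castAdd p r) 1 * φ (Fin.castAdd p r) 1 * F r W := by
    rw [Fin.sum_univ_add]
    simp only [hφ.right, hf.right, mul_zero, zero_mul, Finset.sum_const_zero, add_zero]
  have h2 : ∑ i, S.speed i 0 * φ i 0 * f i 0 = 0 := by
    rw [Fin.sum_univ_add]
    simp only [hf.left, Finset.mul_sum]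
    rw [Finset.sum_comm, ← Finset.sum_add_distrib]
    refine Finset.sum_eq_zero fun r _ => ?_
    have e : ∑ s, S.speed (Fin.natAdd m s) 0 * φ (Fin.natAdd m s) 0
        * (S.Q s r * f (Fin.castAdd p r) 0)
        = (∑ s, S.Q s r * S.speed (Fin.natAdd m s) 0 * φ (Fin.natAdd m s) 0)
          * f (Fin.castAdd p r) 0 := by
      rw [Finset.sum_mul]; exact Finset.sum_congr rfl fun s _ => by ring
    rw [e, ← add_mul, hφ.left, zero_mul]
  rw [h1, h2, add_zero]
  rfl

/-- A pair satisfying the weak form of the stationary equation belongs to the generator. -/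
theorem mem_generator_of_weak (S : HypSystem m p) {F : Fin m → StateSpace (m + p) →L[ℝ] ℝ}
    {W V : StateSpace (m + p)}
    (h : ∀ φ, S.IsStaticTest φ → ∫ x in Icc (0 : ℝ) 1, ∑ i, φ i x * V x i =
      (∫ x in Icc (0 : ℝ) 1, ∑ i, S.adj φ i x * W x i)
      - ∑ r, S.speed (Fin.castAdd p r) 1 * φ (Fin.castAdd p r) 1 * F r W) :
    (W, V) ∈ S.generator F := by
  have hWi := fun i => StateSpace.intervalIntegrable_coord W i
  have hVi := fun i => StateSpace.intervalIntegrable_coord V i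
  have hcW : ∀ i, IntervalIntegrable (fun x => ∑ j, S.coup i j x * W x j) volume 0 1 := fun i =>
    (IntervalIntegrable.sum Finset.univ fun j _ =>
      (hWi j).continuousOn_mul (S.continuous_coup i j).continuousOn).congr fun x _ => by simp
  have hsW : ∀ i, IntervalIntegrable (fun x => S.speedDeriv i x * W x i) volume 0 1 := fun i =>
    (hWi i).continuousOn_mul (S.continuous_speedDeriv i).continuousOn
  set hfun : Fin (m + p) → ℝ → ℝ := fun i x =>
    V x i - S.speedDeriv i x * W x i - ∑ j, S.coup i j x * W x j with hdef
  have hhi : ∀ i, IntervalIntegrable (hfun i) volume 0 1 := fun i =>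
    ((hVi i).sub (hsW i)).sub (hcW i)
  have hzi : ∀ i, IntervalIntegrable (fun x => S.speed i x * W x i) volume 0 1 := fun i =>
    (hWi i).continuousOn_mul (S.continuous_speed i).continuousOn
  -- Test functions with one nonzero component, vanishing at both ends, show that `λ_i W_i` has the
  -- weak derivative `-hfun i`.
  have hweak : ∀ i, ∀ ψ : ℝ → ℝ, ContDiff ℝ 1 ψ → ψ 0 = 0 → ψ 1 = 0 →
      ∫ x in (0 : ℝ)..1, deriv ψ x * (S.speed i x * W x i)
        = ∫ x in (0 : ℝ)..1, ψ x * hfun i x := by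
    intro i ψ hψ h0 h1
    have hψd : Continuous (deriv ψ) := (contDiff_one_iff_deriv.1 hψ).2
    set φ : Fin (m + p) → ℝ → ℝ := fun j x => if j = i then ψ x else 0 with hφ
    have hφ0 : ∀ j, φ j 0 = 0 := fun j => by simp [hφ, h0]
    have hφ1 : ∀ j, φ j 1 = 0 := fun j => by simp [hφ, h1]
    have ht : S.IsStaticTest φ := ⟨fun j => by
      by_cases hj : j = i
      · simpa only [hφ, hj, if_true] using hψ
      · simpa only [hφ, hj, if_false] using contDiff_const,
      fun s => hφ1 _, fun r => by simp [hφ0]⟩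
    have key := h φ ht
    have hdφ : ∀ j x, deriv (φ j) x = if j = i then deriv ψ x else 0 := fun j x => by
      by_cases hj : j = i
      · simp only [hφ, hj, if_true]
      · simp only [hφ, hj, if_false, deriv_const]
    simp only [hφ1, mul_zero, zero_mul, Finset.sum_const_zero, sub_zero,
      StateSpace.integral_eq_interval] at key
    have e1 : ∀ x, ∑ j, φ j x * V x j = ψ x * V x i := fun x => by
      simp [hφ]
    have e2 : ∀ x, ∑ j, S.adj φ j x * W x j = deriv ψ x * (S.speed i x * W x i)
        + (ψ x * V x i - ψ x * hfun i x) := fun x => by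
      simp only [adj, hdφ, hdef]
      simp only [hφ, mul_ite, mul_zero, Finset.sum_ite_eq', Finset.mem_univ, if_true, add_mul,
        ite_mul, zero_mul, Finset.sum_add_distrib]
      have : ∑ j, S.coup i j x * ψ x * W x j = ψ x * ∑ j, S.coup i j x * W x j := by
        rw [Finset.mul_sum]; exact Finset.sum_congr rfl fun j _ => by ring
      rw [this]; ring
    simp only [e1, e2] at key
    have i1 := (hzi i).continuousOn_mul hψd.continuousOn
    have i2 := (hVi i).continuousOn_mul hψ.continuous.continuousOn
    have i3 := (hhi i).continuousOn_mul hψ.continuous.continuousOn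
    rw [intervalIntegral.integral_add i1 (i2.sub i3), intervalIntegral.integral_sub i2 i3] at key
    linarith
  choose C hC using fun i => ae_eq_sub_integral_of_weak (hzi i) (hhi i) (hweak i)
  have hprim := fun i => isPrimitive_unitClamp (c := 0) (hhi i)
  simp only [zero_add] at hprim
  set f : Fin (m + p) → ℝ → ℝ := fun i x =>
    (S.speed i x)⁻¹ * (C i - ∫ ξ in (0 : ℝ)..unitClamp x, hfun i ξ) with hf
  have hsc : ∀ i, Continuous fun x => (S.speed i x)⁻¹ := fun i =>
    (S.continuous_speed i).inv₀ (S.speed_ne_zero i)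
  have hWf : ∀ᵐ x ∂unitVolume, ∀ i, W x i = f i x := by
    filter_upwards [ae_all_iff.2 hC] with x hx i
    rw [hf]
    beta_reduce
    rw [← hx i, inv_mul_cancel_left₀ (S.speed_ne_zero i x)]
  have hfp : ∀ i, IsPrimitive (f i) (S.slope W V i) 0 1 := fun i => by
    have h1 : IsPrimitive (fun x => (S.speed i x)⁻¹)
        (fun x => -S.speedDeriv i x / S.speed i x ^ 2) 0 1 := by
      refine IsPrimitive.of_hasDerivWithinAt zero_le_one (fun x hx => ?_)
        ((S.continuous_speedDeriv i).neg.div₀ ((S.continuous_speed i).pow 2)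
          fun x => pow_ne_zero 2 (S.speed_ne_zero i x)).continuousOn
      have h2 : HasDerivWithinAt (S.speed i) (S.speedDeriv i x) (Icc 0 1) x := by
        rw [S.speedDeriv_of_mem i hx]
        exact (S.hasDerivWithinAt_lam i hx).congr (fun y hy => S.speed_of_mem i hy)
          (S.speed_of_mem i hx)
      exact h2.inv (S.speed_ne_zero i x)
    have hconst : IsPrimitive (fun _ => C i) (fun _ => 0) 0 1 :=
      ⟨zero_le_one, by simp, fun x _ => by simp⟩
    refine (h1.mul (hconst.sub (hprim i).2)).congr_ae (fun x _ => rfl) ?_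
    filter_upwards [hC i] with x hx
    rw [← hx, slope, hdef]
    have := S.speed_ne_zero i x
    field_simp
    ring
  have hgreen := fun (φ : Fin (m + p) → ℝ → ℝ) (hφ : S.IsStaticTest φ) =>
    (h φ hφ).symm.trans (S.green hWf hfp (φ := φ) (φ' := fun i => deriv (φ i))
      (fun i x => ((hφ.contDiff i).differentiable one_ne_zero x).hasDerivAt)
      (fun i => (contDiff_one_iff_deriv.1 (hφ.contDiff i)).2))
  -- Comparison of the weak form with Green's formula for the representative found leaves only
  -- boundary terms, from which the two boundary conditions are extracted.
  have hbd : ∀ φ, S.IsStaticTest φ →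
      ∑ r, S.speed (Fin.castAdd p r) 1 * φ (Fin.castAdd p r) 1 * F r W
        = ∑ i, S.speed i 1 * φ i 1 * f i 1 - ∑ i, S.speed i 0 * φ i 0 * f i 0 := fun φ hφ => by
    have : (∫ x in Icc (0 : ℝ) 1, ∑ i, S.adj φ i x * W x i)
      = ∫ x in Icc (0 : ℝ) 1, ∑ i, (S.speed i x * deriv (φ i) x + S.speedDeriv i x * φ i x
        + ∑ k, S.coup k i x * φ k x) * W x i := rfl
    have h1 := hgreen φ hφ
    rw [this] at h1
    linarith
  refine mem_generator.2 ⟨f, ⟨fun i => (hsc i).mul (continuous_const.sub (hprim i).1), hWf, hfp,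
    fun s => ?_⟩, fun r => ?_⟩
  -- One positive component equals `1` at `x = 0`, the negative ones are forced by the adjoint
  -- condition, and the factor `1 - x` removes the terms at `x = 1`. This isolates one row of the
  -- reflection law.
  · set φ : Fin (m + p) → ℝ → ℝ := fun i x => Fin.addCases
      (fun r => -(S.Q s r * S.speed (Fin.natAdd m s) 0 / S.speed (Fin.castAdd p r) 0))
      (fun s' => if s' = s then 1 else 0) i * (1 - x) with hφ
    have hl : ∀ r x, φ (Fin.castAdd p r) x
        = -(S.Q s r * S.speed (Fin.natAdd m s) 0 / S.speed (Fin.castAdd p r) 0) * (1 - x) :=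
      fun r x => by simp only [hφ, Fin.addCases_left]
    have hr : ∀ s' x, φ (Fin.natAdd m s') x = (if s' = s then 1 else 0) * (1 - x) :=
      fun s' x => by simp only [hφ, Fin.addCases_right]
    have hφ1 : ∀ i, φ i 1 = 0 := fun i => by simp [hφ]
    have ht : S.IsStaticTest φ := by
      refine ⟨fun i => contDiff_const.mul (contDiff_const.sub contDiff_id), fun s' => hφ1 _,
        fun r => ?_⟩
      simp only [hl, hr, sub_zero, mul_one, mul_ite, mul_zero, Finset.sum_ite_eq', Finset.mem_univ,
        if_true]
      have := S.speed_ne_zero (Fin.castAdd p r) 0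
      field_simp
      ring
    have h1 := hbd φ ht
    rw [Fin.sum_univ_add (f := fun i => S.speed i 0 * φ i 0 * f i 0)] at h1
    simp only [hφ1, mul_zero, zero_mul, Finset.sum_const_zero, zero_sub] at h1
    simp only [hl, hr, sub_zero, mul_one, mul_ite, ite_mul, mul_zero, zero_mul,
      Finset.sum_ite_eq', Finset.mem_univ, if_true] at h1
    have e : ∀ r, S.speed (Fin.castAdd p r) 0
        * -(S.Q s r * S.speed (Fin.natAdd m s) 0 / S.speed (Fin.castAdd p r) 0)
        * f (Fin.castAdd p r) 0
        = -(S.speed (Fin.natAdd m s) 0 * (S.Q s r * f (Fin.castAdd p r) 0)) := fun r => by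
      have := S.speed_ne_zero (Fin.castAdd p r) 0
      field_simp
    simp only [e, Finset.sum_neg_distrib, ← Finset.mul_sum] at h1
    refine mul_left_cancel₀ (S.speed_ne_zero (Fin.natAdd m s) 0) ?_
    linarith
  -- A single negative component, vanishing at `x = 0`, isolates one feedback condition.
  · set φ : Fin (m + p) → ℝ → ℝ := fun i x => (if i = Fin.castAdd p r then 1 else 0) * x with hφ
    have hφ0 : ∀ i, φ i 0 = 0 := fun i => by simp [hφ]
    have ht : S.IsStaticTest φ := by
      refine ⟨fun i => contDiff_const.mul contDiff_id, fun s => ?_, fun r => by simp [hφ0]⟩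
      have : Fin.natAdd m s ≠ Fin.castAdd p r := by
        intro h; have := congrArg Fin.val h; simp at this; omega
      simp [hφ, this]
    have h1 := hbd φ ht
    simp only [hφ0, mul_zero, zero_mul, Finset.sum_const_zero, sub_zero] at h1
    simp only [hφ, mul_one, mul_ite, ite_mul, mul_zero, zero_mul, Finset.sum_ite_eq',
      Finset.mem_univ, if_true, Fin.castAdd_inj] at h1
    exact (mul_left_cancel₀ (S.speed_ne_zero _ _) h1).symm

end HypSystem
end
-- Decay of weak solutions
noncomputable section

namespace HypSystem

variable {m p : ℕ}

namespace StateSpace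

variable {n : ℕ}

theorem memLp_of_continuous {a : Fin n → ℝ → ℝ} (ha : ∀ i, Continuous (a i)) (i : Fin n) :
    MemLp (a i) 2 unitVolume := by
  obtain ⟨C, hC⟩ := (ha i).continuousOn.exists_abs_le_unit
  exact memLp_of_bound (ha i).measurable hC

/-- The state with given continuous components. -/
def ofCont (a : Fin n → ℝ → ℝ) (ha : ∀ i, Continuous (a i)) : StateSpace n :=
  ofFun a (memLp_of_continuous ha)

theorem inner_ofCont {a : Fin n → ℝ → ℝ} (ha : ∀ i, Continuous (a i)) (W : StateSpace n) :
    inner ℝ (ofCont a ha) W = ∫ x in Icc (0 : ℝ) 1, ∑ i, a i x * W x i := by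
  rw [inner_eq]
  refine integral_congr_ae ?_
  filter_upwards [ofFun_ae a (memLp_of_continuous ha)] with x hx
  exact Finset.sum_congr rfl fun i _ => by rw [ofCont, hx]

end StateSpace

theorem continuous_adj (S : HypSystem m p) {φ : Fin (m + p) → ℝ → ℝ}
    (hφ : ∀ i, ContDiff ℝ 1 (φ i)) (i : Fin (m + p)) : Continuous (S.adj φ i) :=
  (((S.continuous_speed i).mul (contDiff_one_iff_deriv.1 (hφ i)).2).add
    ((S.continuous_speedDeriv i).mul (hφ i).continuous)).add
      (continuous_finsetSum _ fun k _ => (S.continuous_coup k i).mul (hφ k).continuous)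

/-- The functional paired with the state in the weak formulation. -/
def weakFunctional (S : HypSystem m p) (F : Fin m → StateSpace (m + p) →L[ℝ] ℝ)
    (φ : Fin (m + p) → ℝ → ℝ) (hφ : ∀ i, ContDiff ℝ 1 (φ i)) : StateSpace (m + p) →L[ℝ] ℝ :=
  innerSL ℝ (StateSpace.ofCont (S.adj φ) (S.continuous_adj hφ))
    - ∑ r, (S.speed (Fin.castAdd p r) 1 * φ (Fin.castAdd p r) 1) • F r

theorem weakFunctional_apply (S : HypSystem m p) (F : Fin m → StateSpace (m + p) →L[ℝ] ℝ)
    (φ : Fin (m + p) → ℝ → ℝ) (hφ : ∀ i, ContDiff ℝ 1 (φ i)) (W : StateSpace (m + p)) :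
    S.weakFunctional F φ hφ W = (∫ x in Icc (0 : ℝ) 1, ∑ i, S.adj φ i x * W x i)
      - ∑ r, S.speed (Fin.castAdd p r) 1 * φ (Fin.castAdd p r) 1 * F r W := by
  simp [weakFunctional, StateSpace.inner_ofCont]

section Decay

variable {S : HypSystem m p} {K : Fin (m + p) → Fin (m + p) → ℝ × ℝ → ℝ}
  {F : Fin m → StateSpace (m + p) →L[ℝ] ℝ} {w₀ : StateSpace (m + p)}
  {w : ℝ → StateSpace (m + p)}

theorem feedback_eq
    (hF : ∀ r W, F r W = ∫ ξ in Icc (0 : ℝ) 1, ∑ j, K (Fin.castAdd p r) j (1, ξ) * W ξ j)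
    (w : ℝ → StateSpace (m + p)) (t : ℝ) (r : Fin m) : feedback K w t r = F r (w t) :=
  (hF r (w t)).symm

theorem continuous_extend (hw : ContinuousOn w (Ici 0)) : Continuous fun t => w (max t 0) :=
  hw.comp_continuous (continuous_id.max continuous_const) fun t => mem_Ici.2 (le_max_right t 0)

/-- Time-independent test functions suffice for the decay estimate. The argument `max t 0` extends
the solution continuously to negative times, so that integrals and derivatives in time need no
one-sided versions. -/
theorem IsClosedLoopSolution.inner_eq
    (hF : ∀ r W, F r W = ∫ ξ in Icc (0 : ℝ) 1, ∑ j, K (Fin.castAdd p r) j (1, ξ) * W ξ j)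
    (hw : S.IsClosedLoopSolution K w₀ w) {φ : Fin (m + p) → ℝ → ℝ} (hφ : S.IsStaticTest φ)
    {T : ℝ} (hT : 0 ≤ T) :
    inner ℝ (StateSpace.ofCont φ fun i => (hφ.contDiff i).continuous) (w T)
      = inner ℝ (StateSpace.ofCont φ fun i => (hφ.contDiff i).continuous) w₀
        + ∫ t in (0 : ℝ)..T, S.weakFunctional F φ hφ.contDiff (w (max t 0)) := by
  have h0 : (0 : ℝ) ∈ Icc (0 : ℝ) 1 := ⟨le_rfl, zero_le_one⟩
  have h1 : (1 : ℝ) ∈ Icc (0 : ℝ) 1 := ⟨zero_le_one, le_rfl⟩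
  have ht : S.IsTest T fun i _ x => φ i x :=
    ⟨fun i => (hφ.contDiff i).comp contDiff_snd, fun t _ s => hφ.right s, fun t _ r => by
      simpa only [S.speed_of_mem _ h0] using hφ.left r⟩
  have key := hw.weak T hT _ ht
  have hc := continuous_extend hw.continuousOn
  have hcF : ∀ r, Continuous fun t => F r (w (max t 0)) := fun r => (F r).continuous.comp hc
  have e1 : ∫ t in (0 : ℝ)..T, S.weakFunctional F φ hφ.contDiff (w (max t 0))
      = (∫ t in (0 : ℝ)..T, ∫ x in Icc (0 : ℝ) 1, ∑ i, S.adj φ i x * w (max t 0) x i)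
        - ∫ t in (0 : ℝ)..T, ∑ r, S.speed (Fin.castAdd p r) 1 * φ (Fin.castAdd p r) 1
          * F r (w (max t 0)) := by
    simp only [weakFunctional_apply]
    refine intervalIntegral.integral_sub ?_ ?_
    · simp only [← StateSpace.inner_ofCont (S.continuous_adj hφ.contDiff)]
      exact (continuous_const.inner hc).intervalIntegrable _ _
    · exact (continuous_finsetSum _ fun r _ => continuous_const.mul (hcF r)).intervalIntegrable _ _
  rw [e1, StateSpace.inner_ofCont, StateSpace.inner_ofCont, key, add_sub_assoc]
  congr 2
  · refine intervalIntegral.integral_congr fun t ht => ?_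
    rw [uIcc_of_le hT] at ht
    refine setIntegral_congr_fun measurableSet_Icc fun x hx => ?_
    beta_reduce
    rw [max_eq_left ht.1]
    refine Finset.sum_congr rfl fun i _ => ?_
    simp only [deriv_const, zero_add, adj, S.speed_of_mem _ hx, S.speedDeriv_of_mem _ hx,
      S.coup_of_mem _ _ hx]
  · refine intervalIntegral.integral_congr fun t ht => ?_
    rw [uIcc_of_le hT] at ht
    beta_reduce
    rw [max_eq_left ht.1]
    exact Finset.sum_congr rfl fun r _ => by rw [feedback_eq hF, S.speed_of_mem _ h1]

/-- Time averages of a weak solution are strong solutions. -/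
theorem IsClosedLoopSolution.average_mem_generator
    (hF : ∀ r W, F r W = ∫ ξ in Icc (0 : ℝ) 1, ∑ j, K (Fin.castAdd p r) j (1, ξ) * W ξ j)
    (hw : S.IsClosedLoopSolution K w₀ w) {h : ℝ} (hh : 0 < h) {t : ℝ} (ht : 0 ≤ t) :
    (h⁻¹ • ∫ s in t..t + h, w (max s 0), h⁻¹ • (w (max (t + h) 0) - w (max t 0)))
      ∈ S.generator F := by
  have hc := continuous_extend hw.continuousOn
  -- The weak identities at `t + h` and `t` are subtracted and divided by `h`; the bounded
  -- functional commutes with the average.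
  refine S.mem_generator_of_weak fun φ hφ => ?_
  have hcφ : ∀ a b, IntervalIntegrable (fun s => S.weakFunctional F φ hφ.contDiff (w (max s 0)))
      volume a b := fun a b =>
    ((S.weakFunctional F φ hφ.contDiff).continuous.comp hc).intervalIntegrable _ _
  rw [← S.weakFunctional_apply F φ hφ.contDiff, map_smul,
    ← ContinuousLinearMap.intervalIntegral_comp_comm _ (hc.intervalIntegrable _ _),
    ← StateSpace.inner_ofCont fun i => (hφ.contDiff i).continuous, real_inner_smul_right,
    inner_sub_right, max_eq_left ht, max_eq_left (add_nonneg ht hh.le), hw.inner_eq hF hφ ht,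
    hw.inner_eq hF hφ (add_nonneg ht hh.le), add_sub_add_left_eq_sub,
    intervalIntegral.integral_interval_sub_left (hcφ _ _) (hcφ _ _), smul_eq_mul]

/-- A weak solution need not be differentiable, but its averages over `[t, t + h]` are, and they lie
in the domain of the generator with their time derivative as image. The Lyapunov inequality makes
the weighted energy of the averages nonincreasing, and `h → 0` gives the estimate. -/
theorem IsClosedLoopSolution.norm_sq_le
    (hF : ∀ r W, F r W = ∫ ξ in Icc (0 : ℝ) 1, ∑ j, K (Fin.castAdd p r) j (1, ξ) * W ξ j)
    (hw : S.IsClosedLoopSolution K w₀ w) {P : StateSpace (m + p) →L[ℝ] StateSpace (m + p)} {μ : ℝ}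
    (hP : ∀ q ∈ S.generator F, 2 * inner ℝ (P q.1) (P q.2) ≤ (1 - 2 * μ) * ‖P q.1‖ ^ 2)
    {t : ℝ} (ht : 0 ≤ t) :
    Real.exp ((2 * μ - 1) * t) * ‖P (w t)‖ ^ 2 ≤ ‖P w₀‖ ^ 2 := by
  have hc := continuous_extend hw.continuousOn
  have hI : ∀ a t, HasDerivAt (fun t => ∫ s in a..t, w (max s 0)) (w (max t 0)) t := fun a t =>
    intervalIntegral.integral_hasDerivAt_right (hc.intervalIntegrable _ _)
      (hc.stronglyMeasurableAtFilter _ _) hc.continuousAt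
  have hsub : ∀ t h, ∫ s in t..t + h, w (max s 0)
      = (∫ s in (0 : ℝ)..t + h, w (max s 0)) - ∫ s in (0 : ℝ)..t, w (max s 0) := fun t h =>
    (intervalIntegral.integral_interval_sub_left (hc.intervalIntegrable _ _)
      (hc.intervalIntegrable _ _)).symm
  have hlim : ∀ t, Filter.Tendsto (fun h => h⁻¹ • ∫ s in t..t + h, w (max s 0))
      (nhdsWithin 0 (Ioi 0)) (nhds (w (max t 0))) := fun t => by
    simp only [hsub]
    exact (hasDerivAt_iff_tendsto_slope_zero.1 (hI 0 t)).mono_left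
      (nhdsWithin_mono _ fun h (hh : 0 < h) => hh.ne')
  have hmain : ∀ h : ℝ, 0 < h → Real.exp ((2 * μ - 1) * t)
      * ‖P (h⁻¹ • ∫ s in t..t + h, w (max s 0))‖ ^ 2
      ≤ ‖P (h⁻¹ • ∫ s in (0 : ℝ)..0 + h, w (max s 0))‖ ^ 2 := by
    intro h hh
    set W : ℝ → StateSpace (m + p) := fun t => h⁻¹ • ∫ s in t..t + h, w (max s 0) with hW
    set V : ℝ → StateSpace (m + p) := fun t => h⁻¹ • (w (max (t + h) 0) - w (max t 0)) with hV
    have hWd : ∀ t, HasDerivAt W (V t) t := fun t => by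
      have h1 : HasDerivAt (fun t => ∫ s in (0 : ℝ)..t + h, w (max s 0)) (w (max (t + h) 0)) t := by
        simpa using (hI 0 (t + h)).comp_add_const t h
      simp only [hW, hsub]
      exact (h1.sub (hI 0 t)).const_smul h⁻¹
    have hE : ∀ t, HasDerivAt (fun t => Real.exp ((2 * μ - 1) * t) * ‖P (W t)‖ ^ 2)
        (Real.exp ((2 * μ - 1) * t) * ((2 * μ - 1) * ‖P (W t)‖ ^ 2
          + 2 * inner ℝ (P (W t)) (P (V t)))) t := fun t => by
      have h1 : HasDerivAt (fun t => Real.exp ((2 * μ - 1) * t))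
          (Real.exp ((2 * μ - 1) * t) * (2 * μ - 1)) t := by
        simpa using ((hasDerivAt_id t).const_mul (2 * μ - 1)).exp
      exact (h1.mul (P.hasFDerivAt.comp_hasDerivAt t (hWd t)).norm_sq).congr_deriv (by
        simp only [Function.comp_apply]; ring)
    have hanti := antitoneOn_of_deriv_nonpos (convex_Ici (0 : ℝ))
      (fun t _ => (hE t).continuousAt.continuousWithinAt)
      (fun t _ => (hE t).differentiableAt.differentiableWithinAt)
      (fun t ht => by
        rw [(hE t).deriv]
        have h1 := hP _ (hw.average_mem_generator hF hh (interior_subset ht : t ∈ Ici (0 : ℝ)))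
        refine mul_nonpos_of_nonneg_of_nonpos (Real.exp_pos _).le ?_
        have h2 : 2 * inner ℝ (P (W t)) (P (V t)) ≤ (1 - 2 * μ) * ‖P (W t)‖ ^ 2 := h1
        linarith)
    have h1 := hanti (mem_Ici.2 le_rfl) ht ht
    simpa [hW] using h1
  have hl : ∀ t, Filter.Tendsto (fun h => ‖P (h⁻¹ • ∫ s in t..t + h, w (max s 0))‖ ^ 2)
      (nhdsWithin 0 (Ioi 0)) (nhds (‖P (w (max t 0))‖ ^ 2)) := fun t =>
    ((P.continuous.tendsto _).comp (hlim t)).norm.pow 2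
  have := le_of_tendsto_of_tendsto ((hl t).const_mul (Real.exp ((2 * μ - 1) * t))) (hl 0)
    (by filter_upwards [self_mem_nhdsWithin] with h hh using hmain h hh)
  rwa [max_eq_left ht, max_self, hw.initial] at this

end Decay

end HypSystem
end
-- Existence of weak solutions
noncomputable section

namespace HypSystem

open Filter Topology

variable {m p : ℕ}

namespace StateSpace

variable {n : ℕ}

theorem eventually_forall_abs_sub_le {a : ℝ → ℝ → ℝ} (ha : Continuous (Function.uncurry a))
    (t : ℝ) {ε : ℝ} (hε : 0 < ε) :
    ∀ᶠ s in 𝓝 t, ∀ x ∈ Icc (0 : ℝ) 1, |a s x - a t x| ≤ ε := by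
  refine isCompact_Icc.eventually_forall_of_forall_eventually fun y _ => ?_
  have h1 : Continuous fun z : ℝ × ℝ => |a z.1 z.2 - a t z.2| :=
    (ha.sub (ha.comp (continuous_const.prodMk continuous_snd))).abs
  have h2 := h1.tendsto (t, y)
  simp only [sub_self, abs_zero] at h2
  exact (h2.eventually (gt_mem_nhds hε)).mono fun z hz => hz.le

theorem continuous_slice {a : ℝ → ℝ → ℝ} (ha : Continuous (Function.uncurry a)) (t : ℝ) :
    Continuous (a t) :=
  ha.comp (continuous_const.prodMk continuous_id : Continuous fun x : ℝ => (t, x))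

theorem ofCont_ae {a : Fin n → ℝ → ℝ} (ha : ∀ i, Continuous (a i)) :
    ∀ᵐ x ∂unitVolume, ∀ i, ofCont a ha x i = a i x :=
  ofFun_ae a (memLp_of_continuous ha)

theorem continuous_ofCont {a : Fin n → ℝ → ℝ → ℝ}
    (ha : ∀ i, Continuous (Function.uncurry (a i))) :
    Continuous fun t => ofCont (fun i => a i t) fun i => continuous_slice (ha i) t := by
  refine continuous_iff_continuousAt.2 fun t => Metric.tendsto_nhds.2 fun ε hε => ?_
  have hδ : 0 < ε / (n + 1) := by positivity
  filter_upwards [eventually_all.2 fun i => eventually_forall_abs_sub_le (ha i) t hδ] with s hs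
  rw [dist_eq_norm]
  refine (norm_le_of_ae hδ.le ?_).trans_lt (b := n * (ε / (n + 1))) ?_
  · have h1 := fun t => ofCont_ae fun i => continuous_slice (ha i) t
    filter_upwards [sub_ae (ofCont (fun i => a i s) fun i => continuous_slice (ha i) s) (ofCont (fun i => a i t) fun i => continuous_slice (ha i) t), h1 s, h1 t,
      ae_mem] with x h2 h3 h4 hx i
    rw [h2]
    exact (congrArg₂ (fun u v : ℝ => |u - v|) (h3 i) (h4 i)).trans_le (hs i x hx)
  · rw [mul_div_assoc', div_lt_iff₀ (by positivity)]
    nlinarith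

/-- Differentiability in `L²` follows from the mean value inequality at each `x`, uniformly in `x`,
because the time derivative is uniformly continuous over the compact interval. -/
theorem hasDerivAt_ofCont {a a' : Fin n → ℝ → ℝ → ℝ}
    (ha : ∀ i, Continuous (Function.uncurry (a i)))
    (ha' : ∀ i, Continuous (Function.uncurry (a' i)))
    (hd : ∀ i t x, HasDerivAt (fun s => a i s x) (a' i t x) t) (t : ℝ) :
    HasDerivAt (fun t => ofCont (fun i => a i t) fun i => continuous_slice (ha i) t) (ofCont (fun i => a' i t) fun i => continuous_slice (ha' i) t) t := by
  refine hasDerivAt_iff_isLittleO.2 (Asymptotics.isLittleO_iff.2 fun ε hε => ?_)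
  have hδ : 0 < ε / (n + 1) := by positivity
  obtain ⟨r, hr, hball⟩ := Metric.eventually_nhds_iff_ball.1
    (eventually_all.2 fun i => eventually_forall_abs_sub_le (ha' i) t hδ)
  filter_upwards [Metric.ball_mem_nhds t hr] with s hs
  have hpt : ∀ i, ∀ x ∈ Icc (0 : ℝ) 1, |a i s x - a i t x - (s - t) * a' i t x|
      ≤ ε / (n + 1) * |s - t| := fun i x hx => by
    have h1 := (convex_ball t r).norm_image_sub_le_of_norm_hasDerivWithin_le
      (f := fun s => a i s x - s * a' i t x) (f' := fun s => a' i s x - a' i t x)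
      (C := ε / (n + 1)) (fun y _ => by
        exact ((hd i y x).fun_sub ((hasDerivAt_id y).mul_const (a' i t x))).congr_deriv
          (by simp) |>.hasDerivWithinAt)
      (fun y hy => by simpa using hball y hy i x hx) (Metric.mem_ball_self hr) hs
    simp only [Real.norm_eq_abs] at h1
    convert h1 using 2
    ring
  refine (norm_le_of_ae (C := ε / (n + 1) * |s - t|) (by positivity) ?_).trans ?_
  · have h1 := fun t => ofCont_ae fun i => continuous_slice (ha i) t
    have h2 := ofCont_ae fun i => continuous_slice (ha' i) t
    filter_upwards [sub_ae (ofCont (fun i => a i s) (fun i => continuous_slice (ha i) s) -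
        ofCont (fun i => a i t) fun i => continuous_slice (ha i) t)
        ((s - t) • ofCont (fun i => a' i t) fun i => continuous_slice (ha' i) t),
      sub_ae (ofCont (fun i => a i s) fun i => continuous_slice (ha i) s) (ofCont (fun i => a i t) fun i => continuous_slice (ha i) t),
      smul_ae (s - t) (ofCont (fun i => a' i t) fun i => continuous_slice (ha' i) t), h1 s, h1 t, h2, ae_mem]
      with x e1 e2 e3 e4 e5 e6 hx i
    rw [e1, e2, e3]
    refine le_trans (le_of_eq ?_) (hpt i x hx)
    have e4 := e4 i
    have e5 := e5 i
    have e6 := e6 i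
    rw [e4, e5, e6]
  · rw [Real.norm_eq_abs, ← mul_assoc]
    refine mul_le_mul_of_nonneg_right ?_ (abs_nonneg _)
    rw [mul_div_assoc', div_le_iff₀ (by positivity)]
    nlinarith

end StateSpace

theorem continuous_deriv_fst {φ : ℝ → ℝ → ℝ}
    (hφ : ContDiff ℝ 1 fun q : ℝ × ℝ => φ q.1 q.2) :
    Continuous (Function.uncurry fun t x => deriv (fun t' => φ t' x) t) ∧
      ∀ t x, HasDerivAt (fun t' => φ t' x) (deriv (fun t' => φ t' x) t) t := by
  have h1 : ∀ t x, HasDerivAt (fun t' => φ t' x)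
      (fderiv ℝ (fun q : ℝ × ℝ => φ q.1 q.2) (t, x) (1, 0)) t := fun t x =>
    HasFDerivAt.comp_hasDerivAt (l := fun q : ℝ × ℝ => φ q.1 q.2) (f := fun s => (s, x)) t
      (hφ.differentiable one_ne_zero (t, x)).hasFDerivAt
      ((hasDerivAt_id t).prodMk (hasDerivAt_const t x))
  refine ⟨?_, fun t x => (h1 t x).differentiableAt.hasDerivAt⟩
  have h2 : (Function.uncurry fun t x => deriv (fun t' => φ t' x) t)
      = fun q : ℝ × ℝ => fderiv ℝ (fun q : ℝ × ℝ => φ q.1 q.2) q (1, 0) := by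
    ext q; exact (h1 q.1 q.2).deriv
  rw [h2]
  exact (hφ.continuous_fderiv one_ne_zero).clm_apply continuous_const

theorem continuous_deriv_snd {φ : ℝ → ℝ → ℝ}
    (hφ : ContDiff ℝ 1 fun q : ℝ × ℝ => φ q.1 q.2) :
    Continuous (Function.uncurry fun t x => deriv (fun x' => φ t x') x) :=
  (continuous_deriv_fst (φ := fun x t => φ t x) (hφ.comp (contDiff_snd.prodMk contDiff_fst))).1.comp continuous_swap

/-- Existence of solutions of the closed loop. -/
theorem exists_isClosedLoopSolution (S : HypSystem m p)
    {K : Fin (m + p) → Fin (m + p) → ℝ × ℝ → ℝ} {F : Fin m → StateSpace (m + p) →L[ℝ] ℝ}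
    (hF : ∀ r W, F r W = ∫ ξ in Icc (0 : ℝ) 1, ∑ j, K (Fin.castAdd p r) j (1, ξ) * W ξ j)
    {P : StateSpace (m + p) →L[ℝ] StateSpace (m + p)} (hPu : IsUnit P)
    (hP : ∀ q ∈ S.generator F, inner ℝ (P q.1) (P q.2) ≤ (0 : ℝ)) (w₀ : StateSpace (m + p)) :
    ∃ w, S.IsClosedLoopSolution K w₀ w := by
  obtain ⟨P', hPP', hP'P⟩ := isUnit_iff_exists.1 hPu
  have hr : ∀ u, P (P' u) = u := fun u => by rw [← mul_apply_eq_comp, hPP']; rfl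
  have hl : ∀ u, P' (P u) = u := fun u => by rw [← mul_apply_eq_comp, hP'P]; rfl
  -- Conjugation by `P` replaces the Lyapunov norm by the norm of the space, in which the generator
  -- is dissipative.
  let G : Submodule ℝ (StateSpace (m + p) × StateSpace (m + p)) :=
    (S.generator F).map (P.prodMap P).toLinearMap
  have hG : ∀ {u v}, (u, v) ∈ G → (P' u, P' v) ∈ S.generator F := by
    rintro u v ⟨⟨a, b⟩, hab, he⟩
    have e1 : P a = u := congrArg Prod.fst he
    have e2 : P b = v := congrArg Prod.snd he
    rw [← e1, ← e2, hl, hl]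
    exact hab
  obtain ⟨u, huc, hu0, un, vn, dn, hun⟩ := Dissipative.exists_trajectory (G := G)
    (by
      rintro _ ⟨q, hq, rfl⟩
      exact hP q hq)
    (fun c hc g => by
      -- An eigenvector for `c > 0` would give `c * ‖P W‖ ^ 2 ≤ 0`; this provides the injectivity
      -- that the range condition requires.
      obtain ⟨q, hq, he⟩ := S.generator_range (F := F) (c := c) (fun W hW => by
        have h1 := hP _ hW
        simp only [map_smul, real_inner_smul_right, real_inner_self_eq_norm_sq] at h1
        have h2 : ‖P W‖ = 0 := by
          by_contra h3
          have : 0 < c * ‖P W‖ ^ 2 := by positivity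
          linarith
        rw [← hl W, norm_eq_zero.1 h2, map_zero]) (P' g)
      refine ⟨(P q.1, P q.2), ⟨q, hq, rfl⟩, ?_⟩
      simp only
      rw [← map_smul, ← map_sub, he, hr])
    (fun v hv => by
      have h1 := hG hv
      rw [map_zero] at h1
      rw [← hr v, generator_zero h1, map_zero])
    (P w₀)
  refine ⟨fun t => P' (u t), P'.continuous.comp_continuousOn huc, by simp only [hu0, hl],
    fun T hT φ hφ => ?_⟩
  have h0 : (0 : ℝ) ∈ Icc (0 : ℝ) 1 := ⟨le_rfl, zero_le_one⟩
  have h1 : (1 : ℝ) ∈ Icc (0 : ℝ) 1 := ⟨zero_le_one, le_rfl⟩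
  have hφc : ∀ i, Continuous (Function.uncurry (φ i)) := fun i => (hφ.contDiff i).continuous
  have hφt := fun i => continuous_deriv_fst (hφ.contDiff i)
  have hφx := fun i => continuous_deriv_snd (hφ.contDiff i)
  have hslice : ∀ t i, ContDiff ℝ 1 (φ i t) := fun t i =>
    (hφ.contDiff i).comp (contDiff_const.prodMk contDiff_id : ContDiff ℝ 1 fun x : ℝ => (t, x))
  have hadj : ∀ i, Continuous (Function.uncurry fun t x => S.adj (fun k => φ k t) i x) := fun i =>
    ((((S.continuous_speed i).comp continuous_snd).mul (hφx i)).add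
      (((S.continuous_speedDeriv i).comp continuous_snd).mul (hφc i))).add
      (continuous_finsetSum _ fun k _ => ((S.continuous_coup k i).comp continuous_snd).mul (hφc k))
  have hstat : ∀ t ∈ Icc 0 T, S.IsStaticTest fun i => φ i t := fun t ht =>
    ⟨hslice t, hφ.right t ht, fun r => by
      simpa only [S.speed_of_mem _ h0] using hφ.left t ht r⟩
  set Φ : ℝ → StateSpace (m + p) := fun t =>
    StateSpace.ofCont (fun i => φ i t) fun i => StateSpace.continuous_slice (hφc i) t with hΦ
  set Φ' : ℝ → StateSpace (m + p) := fun t =>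
    StateSpace.ofCont (fun i x => deriv (fun t' => φ i t' x) t)
      fun i => StateSpace.continuous_slice (hφt i).1 t with hΦ'
  set A : ℝ → StateSpace (m + p) := fun t =>
    StateSpace.ofCont (fun i => S.adj (fun k => φ k t) i) fun i => StateSpace.continuous_slice (hadj i) t with hA
  have hΦd : ∀ t, HasDerivAt Φ (Φ' t) t := StateSpace.hasDerivAt_ofCont hφc (fun i => (hφt i).1)
    fun i t x => (hφt i).2 t x
  have hΦc : Continuous Φ := continuous_iff_continuousAt.2 fun t => (hΦd t).continuousAt
  have hΦ'c : Continuous Φ' := StateSpace.continuous_ofCont fun i => (hφt i).1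
  have hAc : Continuous A := StateSpace.continuous_ofCont hadj
  have hbc : ∀ r, Continuous fun t => S.speed (Fin.castAdd p r) 1 * φ (Fin.castAdd p r) t 1 :=
    fun r => continuous_const.mul ((hφc _).comp (by fun_prop : Continuous fun t : ℝ => (t, (1 : ℝ))))
  -- the weak identity with separate arguments in the bulk and boundary terms
  set Θ : ℝ → StateSpace (m + p) → StateSpace (m + p) → ℝ := fun t a b =>
    inner ℝ (Φ' t) a + (inner ℝ (A t) b
      - ∑ r, S.speed (Fin.castAdd p r) 1 * φ (Fin.castAdd p r) t 1 * F r b) with hΘ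
  have hΘc : ∀ {a b : ℝ → StateSpace (m + p)}, Continuous a → Continuous b →
      Continuous fun t => Θ t (a t) (b t) := fun {a b} ha hb =>
    (hΦ'c.inner ha).add ((hAc.inner hb).sub (continuous_finsetSum _ fun r _ =>
      (hbc r).mul ((F r).continuous.comp hb)))
  have hun0 := hun 0 le_rfl
  have hunc : ∀ n, ∀ t, 0 ≤ t → HasDerivAt (fun t => P' (un n t)) (P' (dn n t)) t :=
    fun n t ht => P'.hasFDerivAt.comp_hasDerivAt t ((hun t ht).2.1 n)
  have hvc : ∀ n, Continuous fun t => P' (vn n t) := fun n =>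
    P'.continuous.comp (hun0.2.2.2.1 n).2
  -- For a Yosida approximation the time derivative acts on `un`, whereas the generator acts on `vn
  -- = J un`. Both arguments are kept apart until the limit, where they coincide.
  have hident : ∀ n, inner ℝ (Φ T) (P' (un n T)) - inner ℝ (Φ 0) w₀
      = ∫ t in (0 : ℝ)..T, Θ t (P' (un n t)) (P' (vn n t)) := by
    intro n
    have hd : ∀ t ∈ uIcc 0 T, HasDerivAt (fun t => inner ℝ (Φ t) (P' (un n t)))
        (inner ℝ (Φ t) (P' (dn n t)) + inner ℝ (Φ' t) (P' (un n t))) t := fun t ht => by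
      rw [uIcc_of_le hT] at ht
      exact (hΦd t).inner ℝ (hunc n t ht.1)
    have hcont : ContinuousOn (fun t => inner ℝ (Φ t) (P' (dn n t))
        + inner ℝ (Φ' t) (P' (un n t))) (uIcc 0 T) := by
      refine ((hΦc.inner (P'.continuous.comp (hun0.2.2.2.1 n).1)).continuousOn).add
        (hΦ'c.continuousOn.inner fun t ht => ?_)
      rw [uIcc_of_le hT] at ht
      exact (hunc n t ht.1).continuousAt.continuousWithinAt
    have h2 := intervalIntegral.integral_eq_sub_of_hasDerivAt hd hcont.intervalIntegrable
    rw [hun0.1 n, hl] at h2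
    rw [← h2]
    refine intervalIntegral.integral_congr fun t ht => ?_
    rw [uIcc_of_le hT] at ht
    have h3 := (hstat t ht).green (hG ((hun t ht.1).2.2.1 n))
    rw [← StateSpace.inner_ofCont fun i => StateSpace.continuous_slice (hφc i) t,
      ← StateSpace.inner_ofCont fun i => StateSpace.continuous_slice (hadj i) t] at h3
    simp only [hΘ]
    rw [add_comm, ← h3]
  -- Dominated convergence: `un` and `vn` converge at each time and are bounded by the norm of the
  -- initial value.
  have hlim : Tendsto (fun n => ∫ t in (0 : ℝ)..T, Θ t (P' (un n t)) (P' (vn n t))) atTop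
      (𝓝 (∫ t in (0 : ℝ)..T, Θ t (P' (u t)) (P' (u t)))) := by
    set B := ‖P'‖ * ‖P w₀‖ with hB
    refine intervalIntegral.tendsto_integral_filter_of_dominated_convergence
      (fun t => ‖Φ' t‖ * B + (‖A t‖ * B
        + ∑ r, |S.speed (Fin.castAdd p r) 1 * φ (Fin.castAdd p r) t 1| * (‖F r‖ * B)))
      (Eventually.of_forall fun n => ?_) (Eventually.of_forall fun n => Eventually.of_forall
        fun t ht => ?_) ?_ (Eventually.of_forall fun t ht => ?_)
    · refine ContinuousOn.aestronglyMeasurable (fun t ht => ?_) measurableSet_uIoc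
      rw [uIoc_of_le hT] at ht
      have e1 : ContinuousAt (fun t => P' (un n t)) t := (hunc n t ht.1.le).continuousAt
      have e2 : ContinuousAt (fun t => P' (vn n t)) t := (hvc n).continuousAt
      refine ContinuousAt.continuousWithinAt ?_
      exact (hΦ'c.continuousAt.inner e1).add ((hAc.continuousAt.inner e2).sub
        (tendsto_finsetSum _ fun r _ => ((hbc r).continuousAt).mul
          ((F r).continuous.continuousAt.comp e2)))
    · rw [uIoc_of_le hT] at ht
      have hb1 : ‖P' (un n t)‖ ≤ B := (P'.le_opNorm _).trans
        (mul_le_mul_of_nonneg_left ((hun t ht.1.le).2.2.2.2.1 n) (norm_nonneg _))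
      have hb2 : ‖P' (vn n t)‖ ≤ B := (P'.le_opNorm _).trans
        (mul_le_mul_of_nonneg_left ((hun t ht.1.le).2.2.2.2.2.1 n) (norm_nonneg _))
      refine (norm_add_le _ _).trans (add_le_add ((norm_inner_le_norm _ _).trans
        (mul_le_mul_of_nonneg_left hb1 (norm_nonneg _))) ((norm_sub_le _ _).trans (add_le_add
        ((norm_inner_le_norm _ _).trans (mul_le_mul_of_nonneg_left hb2 (norm_nonneg _)))
        ((norm_sum_le _ _).trans (Finset.sum_le_sum fun r _ => ?_)))))
      rw [norm_mul, Real.norm_eq_abs]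
      exact mul_le_mul_of_nonneg_left (((F r).le_opNorm _).trans
        (mul_le_mul_of_nonneg_left hb2 (norm_nonneg _))) (abs_nonneg _)
    · refine Continuous.intervalIntegrable ?_ _ _
      exact (hΦ'c.norm.mul continuous_const).add ((hAc.norm.mul continuous_const).add
        (continuous_finsetSum _ fun r _ => (hbc r).abs.mul continuous_const))
    · rw [uIoc_of_le hT] at ht
      have e1 : Tendsto (fun n => P' (un n t)) atTop (𝓝 (P' (u t))) :=
        (P'.continuous.tendsto _).comp (hun t ht.1.le).2.2.2.2.2.2.1
      have e2 : Tendsto (fun n => P' (vn n t)) atTop (𝓝 (P' (u t))) :=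
        (P'.continuous.tendsto _).comp (hun t ht.1.le).2.2.2.2.2.2.2
      exact (tendsto_const_nhds.inner e1).add ((tendsto_const_nhds.inner e2).sub
        (tendsto_finsetSum _ fun r _ => tendsto_const_nhds.mul
          (((F r).continuous.tendsto _).comp e2)))
  have hlimT : Tendsto (fun n => inner ℝ (Φ T) (P' (un n T)) - inner ℝ (Φ 0) w₀) atTop
      (𝓝 (inner ℝ (Φ T) (P' (u T)) - inner ℝ (Φ 0) w₀)) :=
    (tendsto_const_nhds.inner ((P'.continuous.tendsto _).comp
      (hun T hT).2.2.2.2.2.2.1)).sub tendsto_const_nhds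
  simp only [hident] at hlimT
  have hfinal := tendsto_nhds_unique hlimT hlim
  have huc' : Continuous fun t => P' (u (max t 0)) := P'.continuous.comp (continuous_extend huc)
  have i1 : IntervalIntegrable (fun t => inner ℝ (Φ' t) (P' (u t)) + inner ℝ (A t) (P' (u t)))
      volume 0 T := by
    refine ((hΦ'c.inner huc').add (hAc.inner huc')).intervalIntegrable 0 T |>.congr
      fun t ht => ?_
    rw [uIoc_of_le hT] at ht
    simp only [Pi.add_apply, max_eq_left ht.1.le]
  have i2 : IntervalIntegrable (fun t => ∑ r, S.speed (Fin.castAdd p r) 1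
      * φ (Fin.castAdd p r) t 1 * F r (P' (u t))) volume 0 T := by
    refine (continuous_finsetSum Finset.univ fun r _ => (hbc r).mul
      ((F r).continuous.comp huc')).intervalIntegrable 0 T |>.congr fun t ht => ?_
    rw [uIoc_of_le hT] at ht
    simp only [Pi.mul_apply, Function.comp_apply, max_eq_left ht.1.le]
  have e1 : ∫ t in (0 : ℝ)..T, Θ t (P' (u t)) (P' (u t))
      = (∫ t in (0 : ℝ)..T, (inner ℝ (Φ' t) (P' (u t)) + inner ℝ (A t) (P' (u t))))
        - ∫ t in (0 : ℝ)..T, ∑ r, S.speed (Fin.castAdd p r) 1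
          * φ (Fin.castAdd p r) t 1 * F r (P' (u t)) := by
    rw [← intervalIntegral.integral_sub i1 i2]
    simp only [hΘ, add_sub_assoc]
  rw [e1, StateSpace.inner_ofCont, StateSpace.inner_ofCont, sub_eq_iff_eq_add', ← add_sub_assoc]
    at hfinal
  rw [hfinal]
  congr 2
  · refine intervalIntegral.integral_congr fun t _ => ?_
    beta_reduce
    rw [← inner_add_left, StateSpace.inner_eq]
    refine integral_congr_ae ?_
    filter_upwards [StateSpace.add_ae (Φ' t) (A t), StateSpace.ofCont_ae
      (fun i => StateSpace.continuous_slice (hφt i).1 t), StateSpace.ofCont_ae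
      (fun i => StateSpace.continuous_slice (hadj i) t), StateSpace.ae_mem]
      with x h2 h3 h4 hx
    refine Finset.sum_congr rfl fun i _ => ?_
    rw [h2]
    congr 1
    refine (congrArg₂ (· + ·) (h3 i) (h4 i)).trans ?_
    simp only [adj, S.speed_of_mem _ hx,
      S.speedDeriv_of_mem _ hx, S.coup_of_mem _ _ hx]
    ring
  · funext t
    exact Finset.sum_congr rfl fun r _ => by
      rw [feedback_eq hF, S.speed_of_mem _ h1]

end HypSystem
end
-- Conclusion
noncomputable section

namespace HypSystem

variable {m p : ℕ} {S : HypSystem m p} {K : Fin (m + p) → Fin (m + p) → ℝ × ℝ → ℝ}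
  {F : Fin m → StateSpace (m + p) →L[ℝ] ℝ} {w₀ : StateSpace (m + p)}
  {w : ℝ → StateSpace (m + p)}

theorem finalTime_nonneg (S : HypSystem m p) (hp : 0 < p) : 0 ≤ S.finalTime hp :=
  intervalIntegral.integral_nonneg zero_le_one fun s hs =>
    add_nonneg (one_div_nonneg.2 (S.lam_pos s hs _).le)
      (Finset.sum_nonneg fun _ _ => one_div_nonneg.2 (abs_nonneg _))

/-- The energy estimate is translated back to the original norm by the two bounds on `P`. The shift
`1 / 2` in the rate is the loss from Young's inequality. -/
theorem IsClosedLoopSolution.norm_le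
    (hF : ∀ r W, F r W = ∫ ξ in Icc (0 : ℝ) 1, ∑ j, K (Fin.castAdd p r) j (1, ξ) * W ξ j)
    {P : StateSpace (m + p) →L[ℝ] StateSpace (m + p)} {c D μ : ℝ} (hc : 0 < c)
    (hlow : ∀ u, c * ‖u‖ ≤ ‖P u‖) (hup : ∀ u, ‖P u‖ ≤ D * ‖u‖)
    (hP : ∀ q ∈ S.generator F, 2 * inner ℝ (P q.1) (P q.2) ≤ (1 - 2 * μ) * ‖P q.1‖ ^ 2)
    (hw : S.IsClosedLoopSolution K w₀ w) {t : ℝ} (ht : 0 ≤ t) :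
    ‖w t‖ ≤ D / c * Real.exp (-(μ - 1 / 2) * t) * ‖w₀‖ := by
  have h1 := hw.norm_sq_le hF hP ht
  have h2 : Real.exp ((2 * μ - 1) * t) = Real.exp ((μ - 1 / 2) * t) ^ 2 := by
    rw [← Real.exp_nat_mul]
    congr 1
    push_cast
    ring
  rw [h2, ← mul_pow] at h1
  have h3 := (abs_le_of_sq_le_sq' h1 (norm_nonneg _)).2
  have h4 : Real.exp ((μ - 1 / 2) * t) * (c * ‖w t‖) ≤ D * ‖w₀‖ :=
    (mul_le_mul_of_nonneg_left (hlow _) (Real.exp_pos _).le).trans (h3.trans (hup _))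
  rw [neg_mul, Real.exp_neg]
  have h5 : D / c * (Real.exp ((μ - 1 / 2) * t))⁻¹ * ‖w₀‖
      = D * ‖w₀‖ / (Real.exp ((μ - 1 / 2) * t) * c) := by
    field_simp
  rw [h5, le_div_iff₀ (by positivity)]
  linarith

end HypSystem
end

theorem theorem2p1 {m p : ℕ} (hp : 0 < p) (S : HypSystem m p)
    (k₁ k₂ : Fin (m + p) → Fin (m + p) → ℝ → ℝ)
    (hk₁ : ∀ i j, ContDiffOn ℝ ∞ (k₁ i j) (Set.Icc 0 1))
    (hk₂ : ∀ i j, ContDiffOn ℝ ∞ (k₂ i j) (Set.Icc 0 1)) :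
    (∃ K, S.IsKernel k₁ k₂ K) ∧
    ∀ K, S.IsKernel k₁ k₂ K →
      (∀ w₀ : HypSystem.StateSpace (m + p), ∃ w, S.IsClosedLoopSolution K w₀ w) ∧
      (∀ η : ℝ, 0 < η → ∃ c : ℝ, 0 < c ∧
        ∀ w₀ w, S.IsClosedLoopSolution K w₀ w →
          ∀ t : ℝ, 0 ≤ t → ‖w t‖ ≤ c * Real.exp (-η * t) * ‖w₀‖) ∧
      (∀ w₀ w, S.IsClosedLoopSolution K w₀ w →
        ∀ t : ℝ, S.finalTime hp < t → w t = 0) := by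
  refine ⟨S.exists_isKernel (fun i j => (hk₁ i j).continuousOn) fun i j =>
    (hk₂ i j).continuousOn, fun K hK => ?_⟩
  obtain ⟨F, hF⟩ := S.exists_feedback hK
  obtain ⟨c, C, hc, hC, hP⟩ := S.exists_lyapunov hp hK hF
  refine ⟨fun w₀ => ?_, fun η hη => ?_, fun w₀ w hw t ht => ?_⟩
  -- For `μ = 1 / 2` the factor `1 - 2 * μ` vanishes, and the generator is dissipative in the norm
  -- `‖P ·‖`.
  · obtain ⟨P, hPu, -, -, hPd⟩ := hP (1 / 2) (by norm_num)
    refine S.exists_isClosedLoopSolution hF hPu (fun q hq => ?_) w₀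
    have := hPd q hq
    norm_num at this
    linarith
  -- The additional `1 / 2` compensates the loss in the rate.
  · obtain ⟨P, -, hlow, hup, hPd⟩ := hP (η + 1 / 2) (by positivity)
    refine ⟨C * Real.exp ((η + 1 / 2) * S.finalTime hp) / c, by positivity,
      fun w₀ w hw t ht => ?_⟩
    simpa only [add_sub_cancel_right] using hw.norm_le hF hc hlow hup hPd ht
  · have h0 : 0 ≤ t := (S.finalTime_nonneg hp).trans ht.le
    -- Since `c` and `C` do not depend on `μ`, the whole dependence on `μ` is the factor `exp (-(μ *
    -- (t - t_F)))`, which tends to zero as `μ → ∞` when `t > t_F`.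
    have hb : ∀ μ : ℝ, 0 ≤ μ →
        ‖w t‖ ≤ C / c * Real.exp (t / 2) * ‖w₀‖ * Real.exp (-(μ * (t - S.finalTime hp))) := by
      intro μ hμ
      obtain ⟨P, -, hlow, hup, hPd⟩ := hP μ hμ
      refine (hw.norm_le hF hc hlow hup hPd h0).trans_eq ?_
      have h1 : Real.exp (μ * S.finalTime hp) * Real.exp (-(μ - 1 / 2) * t)
          = Real.exp (t / 2) * Real.exp (-(μ * (t - S.finalTime hp))) := by
        rw [← Real.exp_add, ← Real.exp_add]
        congr 1
        ring
      linear_combination C / c * ‖w₀‖ * h1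
    have hlim : Filter.Tendsto (fun μ : ℝ => C / c * Real.exp (t / 2) * ‖w₀‖
        * Real.exp (-(μ * (t - S.finalTime hp)))) Filter.atTop (nhds 0) := by
      have h1 := (Real.tendsto_exp_neg_atTop_nhds_zero.comp
        (Filter.tendsto_id.atTop_mul_const (sub_pos.2 ht))).const_mul
        (C / c * Real.exp (t / 2) * ‖w₀‖)
      rwa [mul_zero] at h1
    have h2 := ge_of_tendsto hlim (Filter.eventually_atTop.2 ⟨0, hb⟩)
    exact norm_le_zero_iff.1 h2
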